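/- For $j\in\{1,2\}$ let $p_j,q_j\ge 1$ be integers, $n_j=p_j+q_j$, and let $\mathcal Q_j(x)=\sum_{i=1}^{p_j}x_i^2-\sum_{i=1}^{q_j}x_{p_j+i}^2$ on $\mathbb R^{n_j}$. Let $\mathcal D(E)$ be the space of real-valued $C^\infty$ functions with compact support on $E$, with its usual LF topology, and $\mathbb R^*=\mathbb R\setminus\{0\}$. Let $\eta_j$ be the following function on $\mathbb R^*$, where $Y$ is the Heaviside function (indices omitted): $\eta(t)=Y(t)\,t^{n/2-1}$ if $p$ is odd and $q$ even; $\eta(t)=Y(-t)(-t)^{n/2-1}$ if $p$ is even and $q$ odd; $\eta(t)=\frac12\operatorname{sgn}(t)\,t^{n/2-1}$ if $p,q$ are even; $\eta(t)=t^{n/2-1}\log|t|$ if $p,q$ are odd. Let $\mathcal H_{\eta_1,\eta_2}$ be the space of functions $\mathbb R^*\times\mathbb R^*\to\mathbb R$ of the form $$\varphi(t_1,t_2)=\psi_0(t_1,t_2)+\eta_1(t_1)\psi_1(t_1,t_2)+\eta_2(t_2)\psi_2(t_1,t_2)+\eta_1(t_1)\eta_2(t_2)\psi_3(t_1,t_2),\qquad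 \psi_0,\dots,\psi_3\in\mathcal D(\mathbb R^2).$$ For such $\varphi$ put $$a_k(t_2)=\tfrac1{k!}\bigl(\partial_1^k\psi_1+\eta_2(t_2)\,\partial_1^k\psi_3\bigr)(0,t_2),\quad b_l(t_1)=\tfrac1{l!}\bigl(\partial_2^l\psi_2+\eta_1(t_1)\,\partial_2^l\psi_3\bigr)(t_1,0),\quad c_{k,l}=\tfrac1{k!\,l!}\partial_1^k\partial_2^l\psi_3(0,0)$$ for $t_1,t_2\neq0$; these depend only on $\varphi$. Fix $\chi_1,\chi_2\in\mathcal D(\mathbb R)$ equal to $1$ near $0$, and let $$T_N\varphi=\varphi-\chi_1(t_1)\eta_1(t_1)\sum_{k\le N}t_1^k a_k(t_2)-\chi_2(t_2)\eta_2(t_2)\sum_{l\le N}t_2^l b_l(t_1)+\chi_1(t_1)\chi_2(t_2)\eta_1(t_1)\eta_2(t_2)\sum_{k,l\le N}c_{k,l}t_1^kt_2^l .$$ For compact $K\subset\mathbb R^2$, the space $\mathcal H_{\eta_1,\eta_2,K}$ of those $\varphi\in\mathcal H_{\eta_1,\eta_2}$ that vanish outside $K$ is given the topology of the seminorms $\sup|\partial_1^k\partial_2^l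 T_N\varphi|$ for $k+l<N+\frac12\min(n_1,n_2)$; $\sup\bigl|\frac{d^j}{ds^j}\bigl(a_k(s)-\chi_2(s)\eta_2(s)\sum_{l\le N}c_{k,l}s^l\bigr)\bigr|$ for $j<N+\frac{n_2}2$; $\sup\bigl|\frac{d^j}{ds^j}\bigl(b_l(s)-\chi_1(s)\eta_1(s)\sum_{k\le N}c_{k,l}s^k\bigr)\bigr|$ for $j<N+\frac{n_1}2$; and $|c_{k,l}|$ (all $N,k,l,j\in\mathbb N$, suprema over nonzero values of the variables). The space $\mathcal H_{\eta_1,\eta_2}$ carries the locally convex inductive limit topology of the $\mathcal H_{\eta_1,\eta_2,K}$. For every $f\in\mathcal D(\mathbb R^{n_1}\times\mathbb R^{n_2})$ there is a unique function $M_{\mathcal Q_1,\mathcal Q_2}f$ on $\mathbb R^*\times\mathbb R^*$ that is $C^\infty$ there, integrable on $\mathbb R^2$, and satisfies for all $F\in\mathcal D(\mathbb R^2)$ $$\int_{\mathbb R^{n_1}\times\mathbb R^{n_2}}F(\mathcal Q_1(x),\mathcal Q_2(y))f(x,y)\,dx\,dy=\int_{\mathbb R^2}F(t_1,t_2)\,M_{\mathcal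 Q_1,\mathcal Q_2}f(t_1,t_2)\,dt_1\,dt_2 .$$ **Proposition 2.2.1.** The function $M_{\mathcal Q_1,\mathcal Q_2}f$ belongs to $\mathcal H_{\eta_1,\eta_2}$ for every $f$, and the map $f\mapsto M_{\mathcal Q_1,\mathcal Q_2}f$ from $\mathcal D(\mathbb R^{n_1}\times\mathbb R^{n_2})$ to $\mathcal H_{\eta_1,\eta_2}$ is continuous and surjective. -/

import Mathlib

open Set Filter MeasureTheory TopologicalSpace
open scoped Topology ENNReal ContDiff

namespace OrbitalMean

noncomputable section

/-- The space `ℝ^(p+q)`. -/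
abbrev Space (p q : ℕ) : Type := EuclideanSpace ℝ (Fin (p + q))

/-- The quadratic form `x₁² + ⋯ + x_p² - x_{p+1}² - ⋯ - x_{p+q}²`. -/
def quadForm (p q : ℕ) (x : Space p q) : ℝ :=
  ∑ i : Fin p, x (Fin.castAdd q i) ^ 2 - ∑ j : Fin q, x (Fin.natAdd p j) ^ 2

/-- `𝓓(E)`: real-valued smooth compactly supported functions on `E`, with Mathlib's LF topology. -/
abbrev Test (E : Type) [NormedAddCommGroup E] [NormedSpace ℝ E] : Type :=
  TestFunction (⊤ : Opens E) ℝ ⊤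

/-- The singularity function `η` of the form of signature `(p, q)`, with `n = p + q`.
Only its values at `t ≠ 0` are ever relevant. -/
def singularity (p q : ℕ) (t : ℝ) : ℝ :=
  if Even p then
    if Even q then 1 / 2 * Real.sign t * t ^ ((p + q) / 2 - 1)
    else if t < 0 then (-t) ^ (((p + q : ℕ) : ℝ) / 2 - 1) else 0
  else
    if Even q then (if 0 < t then t ^ (((p + q : ℕ) : ℝ) / 2 - 1) else 0)
    else t ^ ((p + q) / 2 - 1) * Real.log |t|

/-- The set `ℝ* × ℝ*` inside `ℝ²`. -/
def regSet : Set (ℝ × ℝ) := {t | t.1 ≠ 0 ∧ t.2 ≠ 0}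

/-- The space `ℝ* × ℝ*`. -/
abbrev Reg : Type := regSet

/-- Extension by zero of a function on `ℝ* × ℝ*` to `ℝ²` (the axes are a null set). -/
def extendZero (φ : Reg → ℝ) : ℝ × ℝ → ℝ := Function.extend Subtype.val φ 0

/-- `g` is the mean of `f` relative to `(𝒬₁, 𝒬₂)`: it is smooth on `ℝ* × ℝ*`, integrable on `ℝ²`,
and it is the density of the image of `f dx dy` under `(x, y) ↦ (𝒬₁ x, 𝒬₂ y)`. -/
def IsMean {p₁ q₁ p₂ q₂ : ℕ} (f : Test (Space p₁ q₁ × Space p₂ q₂)) (g : Reg → ℝ) : Prop :=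
  ContDiffOn ℝ ∞ (extendZero g) regSet ∧
  Integrable (extendZero g) ∧
  ∀ F : Test (ℝ × ℝ),
    ∫ z : Space p₁ q₁ × Space p₂ q₂, F (quadForm p₁ q₁ z.1, quadForm p₂ q₂ z.2) * f z
      = ∫ t : ℝ × ℝ, F t * extendZero g t

open Classical in
/-- The mean `M_{𝒬₁,𝒬₂} f`, the function determined by `IsMean f`. -/
def mean {p₁ q₁ p₂ q₂ : ℕ} (f : Test (Space p₁ q₁ × Space p₂ q₂)) : Reg → ℝ :=
  if h : ∃ g, IsMean f g then h.choose else 0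

section SingularSpace

variable (p₁ q₁ p₂ q₂ : ℕ)

/-- The function `ψ₀ + η₁ ψ₁ + η₂ ψ₂ + η₁ η₂ ψ₃`, as an expression on `ℝ²`. -/
def assemble (ψ : Fin 4 → Test (ℝ × ℝ)) (t : ℝ × ℝ) : ℝ :=
  ψ 0 t + singularity p₁ q₁ t.1 * ψ 1 t + singularity p₂ q₂ t.2 * ψ 2 t
    + singularity p₁ q₁ t.1 * singularity p₂ q₂ t.2 * ψ 3 t

/-- The space `ℋ_{η₁,η₂}` of functions `ψ₀ + η₁ ψ₁ + η₂ ψ₂ + η₁ η₂ ψ₃` on `ℝ* × ℝ*`. -/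
def singularSpace : Submodule ℝ (Reg → ℝ) where
  carrier := {φ | ∃ ψ : Fin 4 → Test (ℝ × ℝ), ∀ t : Reg, φ t = assemble p₁ q₁ p₂ q₂ ψ t}
  zero_mem' := ⟨0, fun t => by simp [assemble]⟩
  add_mem' := by
    rintro φ φ' ⟨ψ, h⟩ ⟨ψ', h'⟩
    refine ⟨ψ + ψ', fun t => ?_⟩
    simp only [Pi.add_apply, h, h', assemble, FunLike.coe_add]
    ring
  smul_mem' := by
    rintro c φ ⟨ψ, h⟩
    refine ⟨c • ψ, fun t => ?_⟩
    simp only [Pi.smul_apply, h, assemble, FunLike.coe_smul, smul_eq_mul]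
    ring

/-- The quadruples `(ψ₀, ψ₁, ψ₂, ψ₃)` that represent a given `φ`. -/
def Rep (φ : Reg → ℝ) : Type :=
  {ψ : Fin 4 → Test (ℝ × ℝ) // ∀ t : Reg, φ t = assemble p₁ q₁ p₂ q₂ ψ t}

/-- The partial derivative `(∂/∂t₁)^k (∂/∂t₂)^l g`. -/
def partialDeriv (k l : ℕ) (g : ℝ × ℝ → ℝ) (t : ℝ × ℝ) : ℝ :=
  iteratedDeriv k (fun s => iteratedDeriv l (fun u => g (s, u)) t.2) t.1

/-- The coefficient `a_k(t₂)` of `η₁(t₁) t₁^k` in the expansion at `t₁ = 0` of the function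
represented by `ψ`; it is a function of `t₂ ≠ 0`, of the form smooth + `η₂` times smooth. -/
def coeffFst (ψ : Fin 4 → Test (ℝ × ℝ)) (k : ℕ) (s : ℝ) : ℝ :=
  (partialDeriv k 0 (ψ 1) (0, s) + singularity p₂ q₂ s * partialDeriv k 0 (ψ 3) (0, s))
    / (k.factorial : ℝ)

/-- The coefficient `b_l(t₁)` of `η₂(t₂) t₂^l` in the expansion at `t₂ = 0` of the function
represented by `ψ`; it is a function of `t₁ ≠ 0`, of the form smooth + `η₁` times smooth. -/
def coeffSnd (ψ : Fin 4 → Test (ℝ × ℝ)) (l : ℕ) (s : ℝ) : ℝ :=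
  (partialDeriv 0 l (ψ 2) (s, 0) + singularity p₁ q₁ s * partialDeriv 0 l (ψ 3) (s, 0))
    / (l.factorial : ℝ)

/-- The coefficient `c_{k,l}` of `η₁(t₁) η₂(t₂) t₁^k t₂^l` in the expansion at the origin. -/
def coeffBoth (ψ : Fin 4 → Test (ℝ × ℝ)) (k l : ℕ) : ℝ :=
  partialDeriv k l (ψ 3) (0, 0) / ((k.factorial : ℝ) * (l.factorial : ℝ))

variable (χ₁ χ₂ : Test ℝ)

/-- The remainder `T_N(φ)`. The terms `η₁ η₂ t₁^k t₂^l` occur both in the `a_k` and in the `b_l`,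
whence the sign of the last sum. -/
def remainder (N : ℕ) (ψ : Fin 4 → Test (ℝ × ℝ)) (t : ℝ × ℝ) : ℝ :=
  assemble p₁ q₁ p₂ q₂ ψ t
    - χ₁ t.1 * singularity p₁ q₁ t.1
        * ∑ k ∈ Finset.range (N + 1), t.1 ^ k * coeffFst p₂ q₂ ψ k t.2
    - χ₂ t.2 * singularity p₂ q₂ t.2
        * ∑ l ∈ Finset.range (N + 1), t.2 ^ l * coeffSnd p₁ q₁ ψ l t.1
    + χ₁ t.1 * χ₂ t.2 * singularity p₁ q₁ t.1 * singularity p₂ q₂ t.2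
        * ∑ k ∈ Finset.range (N + 1), ∑ l ∈ Finset.range (N + 1),
            t.1 ^ k * t.2 ^ l * coeffBoth ψ k l

/-- The remainder of order `N` of the coefficient `a_k`. -/
def remainderFst (N k : ℕ) (ψ : Fin 4 → Test (ℝ × ℝ)) (s : ℝ) : ℝ :=
  coeffFst p₂ q₂ ψ k s
    - χ₂ s * singularity p₂ q₂ s * ∑ l ∈ Finset.range (N + 1), coeffBoth ψ k l * s ^ l

/-- The remainder of order `N` of the coefficient `b_l`. -/
def remainderSnd (N l : ℕ) (ψ : Fin 4 → Test (ℝ × ℝ)) (s : ℝ) : ℝ :=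
  coeffSnd p₁ q₁ ψ l s
    - χ₁ s * singularity p₁ q₁ s * ∑ k ∈ Finset.range (N + 1), coeffBoth ψ k l * s ^ k

/-! The coefficients and remainders above depend only on the function `φ` that `ψ` represents, so
that each infimum over the representations of `φ` below is the common value. -/

/-- The seminorm `sup |(∂/∂t₁)^k (∂/∂t₂)^l T_N(φ)|`. -/
def remainderNorm (N k l : ℕ) (φ : singularSpace p₁ q₁ p₂ q₂) : ℝ≥0∞ :=
  ⨅ ψ : Rep p₁ q₁ p₂ q₂ φ, ⨆ t : Reg,
    ‖partialDeriv k l (remainder p₁ q₁ p₂ q₂ χ₁ χ₂ N ψ.1) t‖ₑ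

/-- The seminorm `sup |(d/ds)^j (a_k - χ₂ η₂ ∑_{l ≤ N} c_{k,l} s^l)|` over `s ≠ 0`. -/
def coeffFstNorm (N j k : ℕ) (φ : singularSpace p₁ q₁ p₂ q₂) : ℝ≥0∞ :=
  ⨅ ψ : Rep p₁ q₁ p₂ q₂ φ, ⨆ s : {s : ℝ // s ≠ 0},
    ‖iteratedDeriv j (remainderFst p₂ q₂ χ₂ N k ψ.1) s‖ₑ

/-- The seminorm `sup |(d/ds)^j (b_l - χ₁ η₁ ∑_{k ≤ N} c_{k,l} s^k)|` over `s ≠ 0`. -/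
def coeffSndNorm (N j l : ℕ) (φ : singularSpace p₁ q₁ p₂ q₂) : ℝ≥0∞ :=
  ⨅ ψ : Rep p₁ q₁ p₂ q₂ φ, ⨆ s : {s : ℝ // s ≠ 0},
    ‖iteratedDeriv j (remainderSnd p₁ q₁ χ₁ N l ψ.1) s‖ₑ

/-- The seminorm `|c_{k,l}|`. -/
def coeffBothNorm (k l : ℕ) (φ : singularSpace p₁ q₁ p₂ q₂) : ℝ≥0∞ :=
  ⨅ ψ : Rep p₁ q₁ p₂ q₂ φ, ‖coeffBoth ψ.1 k l‖ₑ

/-- The family of all seminorms above, the orders of differentiation being smaller than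
`N + n/2`, where `n` is `min n₁ n₂`, `n₂` and `n₁` respectively. -/
def seminorms : Set (singularSpace p₁ q₁ p₂ q₂ → ℝ≥0∞) :=
  {σ | (∃ N k l, 2 * (k + l) < 2 * N + min (p₁ + q₁) (p₂ + q₂) ∧
          σ = remainderNorm p₁ q₁ p₂ q₂ χ₁ χ₂ N k l) ∨
       (∃ N j k, 2 * j < 2 * N + (p₂ + q₂) ∧ σ = coeffFstNorm p₁ q₁ p₂ q₂ χ₂ N j k) ∨
       (∃ N j l, 2 * j < 2 * N + (p₁ + q₁) ∧ σ = coeffSndNorm p₁ q₁ p₂ q₂ χ₁ N j l) ∨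
       (∃ k l, σ = coeffBothNorm p₁ q₁ p₂ q₂ k l)}

/-- The subspace `ℋ_{η₁,η₂,K}` of the functions supported in the compact set `K ⊆ ℝ²`. -/
def supportedIn (K : Compacts (ℝ × ℝ)) : Submodule ℝ (singularSpace p₁ q₁ p₂ q₂) where
  carrier := {φ | ∀ t : Reg, (t : ℝ × ℝ) ∉ K → φ.1 t = 0}
  zero_mem' := fun _ _ => rfl
  add_mem' := by
    intro φ φ' h h' t ht
    simp [h t ht, h' t ht]
  smul_mem' := by
    intro c φ h t ht
    simp [h t ht]

/-- The Fréchet topology of `ℋ_{η₁,η₂,K}`, generated by the balls of the seminorms. -/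
@[reducible]
def supportedInTopology (K : Compacts (ℝ × ℝ)) :
    TopologicalSpace (supportedIn p₁ q₁ p₂ q₂ K) :=
  generateFrom {U | ∃ σ ∈ seminorms p₁ q₁ p₂ q₂ χ₁ χ₂, ∃ φ₀ : supportedIn p₁ q₁ p₂ q₂ K,
    ∃ ε : ℝ≥0∞, 0 < ε ∧ U = {φ | σ ((φ - φ₀ : supportedIn p₁ q₁ p₂ q₂ K) :
      singularSpace p₁ q₁ p₂ q₂) < ε}}

/-- The locally convex inductive limit topology on `ℋ_{η₁,η₂}`: the finest locally convex vector
space topology for which all the inclusions `ℋ_{η₁,η₂,K} → ℋ_{η₁,η₂}` are continuous. -/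
@[reducible]
def singularSpaceTopology : TopologicalSpace (singularSpace p₁ q₁ p₂ q₂) :=
  sInf {τ : TopologicalSpace (singularSpace p₁ q₁ p₂ q₂) |
    (∀ K : Compacts (ℝ × ℝ),
      Continuous[supportedInTopology p₁ q₁ p₂ q₂ χ₁ χ₂ K, τ]
        (fun φ : supportedIn p₁ q₁ p₂ q₂ K => (φ : singularSpace p₁ q₁ p₂ q₂))) ∧
    @IsTopologicalAddGroup (singularSpace p₁ q₁ p₂ q₂) τ _ ∧
    @ContinuousSMul ℝ (singularSpace p₁ q₁ p₂ q₂) _ _ τ ∧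
    @LocallyConvexSpace ℝ (singularSpace p₁ q₁ p₂ q₂) _ _ _ _ τ}

end SingularSpace

end

end OrbitalMean

/-! For one form, squared radii reduce everything to two variables. An even test function is a test
function of the square (`IsTest.exists_comp_sq`), and sums of squares add by beta convolution
(`exists_beta_density`). So a test function on `ℝ^p × ℝ^q` integrates against `F(𝒬)` like some test
function `h(a, b)` against `F(a - b) a^(p/2-1) b^(q/2-1)` on the quadrant (`exists_radial_pair`),
and every `h` occurs (`exists_of_radial_pair`). The density of `a - b` then has to be smooth plus
`η` times smooth, with `η`-coefficient at `0` equal to a nonzero constant `κ` times `h(0, 0)`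
(`exists_pairIntegral_eq`).

If one exponent is an integer `m`, the weight `b^(m-1)` is a polynomial. The half-line integral is a
full-line integral, smooth in `t`, minus the integral over the other half-line, which is a beta
convolution and gives a half-line power. If `p` and `q` are both odd, `a = u²` and `b = v²` turn the
density into an integral over the hyperbola `x z = t` of a function invariant under `(x, z) ↦ (-x,
-z)`. Repeatedly subtracting the values on the two axes peels off terms `t^k log|t|`, and a Borel
sum collects them (`IsHypTest.exists_expansion`). The constant `κ` is a beta integral in one case
and, up to sign and a power of two, the central coefficient of `(X+1)^(2i) (X-1)^(2j)` in the other.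

Because `κ ≠ 0`, the mean of one fixed bump has a nonvanishing `η`-coefficient near `0`. Multiplying
that bump by a function of `a - b` produces any prescribed `η`-part near `0`, and a smooth density
is always attained, so the single-form mean is surjective (`exists_of_pairIntegral`). All of this
carries a parameter, so it can be applied in `x` and afterwards in `y`; this gives membership in the
space and surjectivity for two forms. Uniqueness holds because densities that agree almost
everywhere and are continuous on an open set agree there.

Continuity is obtained without estimating the construction. For a fixed compact support, the pairs
`(f, ψ)` with `ψ` representing the mean of `f` form a closed subspace of a Fréchet space, and its
projection to `f` is onto. By the open mapping theorem, small `f` have small representing quadruples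
(`exists_small_represents`). Each seminorm is bounded by the supremum of a pointwise bounded family
of continuous functionals of `ψ` (`exists_isBoundedFamily`), so by uniform boundedness it is small
for small `ψ`. The pointwise bound is the fact that the remainders are of class `C^m` with compact
support: Taylor remainders supply the factors `t^(N+1)` that tame the singularity functions. -/

namespace OrbitalMean

noncomputable section

/-! ### Test functions, parameter integrals, Hadamard quotients and a bump -/

section Basic

variable {E P V W : Type} [NormedAddCommGroup E] [NormedSpace ℝ E] [NormedAddCommGroup P]
  [NormedSpace ℝ P] [NormedAddCommGroup V] [NormedSpace ℝ V] [NormedAddCommGroup W]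
  [NormedSpace ℝ W]

/-- Smooth functions with bounded support. -/
structure IsTest (f : E → V) : Prop where
  smooth : ContDiff ℝ ∞ f
  bounded : ∃ R : ℝ, ∀ x, R < ‖x‖ → f x = 0

theorem IsTest.hasCompactSupport [ProperSpace E] {f : E → V} (hf : IsTest f) :
    HasCompactSupport f := by
  obtain ⟨R, hR⟩ := hf.bounded
  refine HasCompactSupport.intro (isCompact_closedBall (0 : E) R) fun x hx => hR x ?_
  simpa using hx

theorem isTest_of_hasCompactSupport {f : E → V} (hf : ContDiff ℝ ∞ f)
    (h : HasCompactSupport f) : IsTest f := by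
  obtain ⟨R, hR⟩ := h.isCompact.isBounded.exists_norm_le
  refine ⟨hf, R, fun x hx => ?_⟩
  by_contra hne
  exact absurd (hR x (subset_tsupport f hne)) (not_le.2 hx)

theorem IsTest.exists_radius {f : E → V} (hf : IsTest f) :
    ∃ R : ℝ, 1 ≤ R ∧ ∀ x, R < ‖x‖ → f x = 0 := by
  obtain ⟨R, hR⟩ := hf.bounded
  exact ⟨max 1 R, le_max_left _ _, fun x hx => hR x (lt_of_le_of_lt (le_max_right _ _) hx)⟩

theorem IsTest.exists_norm_le [ProperSpace E] {f : E → V} (hf : IsTest f) :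
    ∃ C : ℝ, 0 ≤ C ∧ ∀ x, ‖f x‖ ≤ C := by
  obtain ⟨C, hC⟩ := hf.hasCompactSupport.exists_bound_of_continuous hf.smooth.continuous
  exact ⟨C, (norm_nonneg _).trans (hC 0), hC⟩

theorem IsTest.add {f g : E → V} (hf : IsTest f) (hg : IsTest g) :
    IsTest fun x => f x + g x := by
  obtain ⟨R, hR⟩ := hf.bounded
  obtain ⟨S, hS⟩ := hg.bounded
  exact ⟨hf.smooth.add hg.smooth, max R S, fun x hx => by
    rw [hR x ((le_max_left _ _).trans_lt hx), hS x ((le_max_right _ _).trans_lt hx), add_zero]⟩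

theorem IsTest.smul {f : E → V} {a : E → ℝ} (hf : IsTest f) (ha : ContDiff ℝ ∞ a) :
    IsTest fun x => a x • f x := by
  obtain ⟨R, hR⟩ := hf.bounded
  exact ⟨ha.smul hf.smooth, R, fun x hx => by rw [hR x hx, smul_zero]⟩

theorem IsTest.mul {f a : E → ℝ} (ha : ContDiff ℝ ∞ a) (hf : IsTest f) :
    IsTest fun x => a x * f x := hf.smul ha

theorem IsTest.neg {f : E → V} (hf : IsTest f) : IsTest fun x => -f x := by
  obtain ⟨R, hR⟩ := hf.bounded
  exact ⟨hf.smooth.neg, R, fun x hx => by rw [hR x hx, neg_zero]⟩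

theorem IsTest.sub {f g : E → V} (hf : IsTest f) (hg : IsTest g) :
    IsTest fun x => f x - g x := by
  simpa [sub_eq_add_neg] using hf.add hg.neg

theorem isTest_zero : IsTest fun _ : E => (0 : V) := ⟨contDiff_const, 0, fun _ _ => rfl⟩

theorem IsTest.sum {ι : Type} {s : Finset ι} {f : ι → E → V} (hf : ∀ i ∈ s, IsTest (f i)) :
    IsTest fun x => ∑ i ∈ s, f i x := by
  classical
  induction s using Finset.induction_on with
  | empty => simpa using (isTest_zero (E := E) (V := V))
  | insert a s ha ih =>
    simp only [Finset.sum_insert ha]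
    exact (hf a (by simp)).add (ih fun i hi => hf i (by simp [hi]))

/-- Composition with a map that does not decrease the norm by more than a factor. -/
theorem IsTest.comp {f : E → V} (hf : IsTest f) {g : W → E} (hg : ContDiff ℝ ∞ g)
    (hb : ∀ R : ℝ, ∃ S : ℝ, ∀ x, S < ‖x‖ → R < ‖g x‖) : IsTest fun x => f (g x) := by
  obtain ⟨R, hR⟩ := hf.bounded
  obtain ⟨S, hS⟩ := hb R
  exact ⟨hf.smooth.comp hg, S, fun x hx => hR _ (hS x hx)⟩

theorem IsTest.comp_equiv {f : E → V} (hf : IsTest f) (e : W ≃L[ℝ] E) :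
    IsTest fun x => f (e x) := by
  refine hf.comp e.contDiff fun R => ⟨‖(e.symm : E →L[ℝ] W)‖ * max R 0, fun x hx => ?_⟩
  by_contra hlt
  have h1 : ‖x‖ ≤ ‖(e.symm : E →L[ℝ] W)‖ * ‖e x‖ := by
    simpa using (e.symm : E →L[ℝ] W).le_opNorm (e x)
  have h2 : ‖(e.symm : E →L[ℝ] W)‖ * ‖e x‖ ≤ ‖(e.symm : E →L[ℝ] W)‖ * max R 0 :=
    mul_le_mul_of_nonneg_left ((not_lt.1 hlt).trans (le_max_left _ _)) (norm_nonneg _)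
  linarith

omit [NormedSpace ℝ V] in
theorem eq_at_zero_of_eq_of_ne {f g : ℝ → V} (hf : Continuous f) (hg : Continuous g)
    (h : ∀ t, t ≠ 0 → f t = g t) : f 0 = g 0 :=
  congrFun (hf.ext_on (dense_compl_singleton (0 : ℝ)) hg fun t ht => h t ht) 0

/-- Dominated differentiation: the derivative is bounded on the compact product of `K` with a unit
ball around `e`, and `μ` is finite on `K`. -/
theorem hasFDerivAt_setIntegral_param [FiniteDimensional ℝ E] (μ : Measure ℝ)
    [IsLocallyFiniteMeasure μ] {K : Set ℝ} (hK : IsCompact K) {f : ℝ × E → V}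
    (hf : ContDiff ℝ ∞ f) (e : E) :
    HasFDerivAt (fun e => ∫ x in K, f (x, e) ∂μ)
      (∫ x in K, (fderiv ℝ f (x, e)).comp (ContinuousLinearMap.inr ℝ ℝ E) ∂μ) e := by
  have : ProperSpace E := FiniteDimensional.proper ℝ E
  have hf' : Continuous fun p : ℝ × E =>
      (fderiv ℝ f p).comp (ContinuousLinearMap.inr ℝ ℝ E) :=
    (hf.continuous_fderiv (by simp)).clm_comp continuous_const
  obtain ⟨C, hC⟩ := (hK.prod (isCompact_closedBall e 1)).exists_bound_of_continuousOn
    hf'.continuousOn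
  have hfin : IsFiniteMeasure (μ.restrict K) := ⟨by simpa using hK.measure_lt_top⟩
  have hcont : ∀ {U : Type} [NormedAddCommGroup U] {g : ℝ × E → U}, Continuous g →
      ∀ e, Continuous fun x => g (x, e) := fun hg e =>
    hg.comp (continuous_id.prodMk continuous_const)
  refine hasFDerivAt_integral_of_dominated_of_fderiv_le (s := Metric.closedBall e 1)
    (F' := fun e x => (fderiv ℝ f (x, e)).comp (ContinuousLinearMap.inr ℝ ℝ E))
    (bound := fun _ => C) (Metric.closedBall_mem_nhds e one_pos)
    (Eventually.of_forall fun e' => (hcont hf.continuous e').aestronglyMeasurable)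
    ((hcont hf.continuous e).continuousOn.integrableOn_compact hK)
    (hcont hf' e).aestronglyMeasurable ?_ (integrable_const _)
    (Eventually.of_forall fun x e' _ => ?_)
  · filter_upwards [ae_restrict_mem hK.measurableSet] with x hx e' he'
    exact hC (x, e') ⟨hx, he'⟩
  · have h1 := (hf.differentiable (by simp) (x, e')).hasFDerivAt
    exact h1.comp e' (hasFDerivAt_prodMk_right x e')

/-- The derivative is a parameter integral of the same kind with values in a space of linear maps,
so the induction has to let the target space vary. -/
theorem contDiff_setIntegral_param_nat [FiniteDimensional ℝ E] (μ : Measure ℝ)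
    [IsLocallyFiniteMeasure μ] {K : Set ℝ} (hK : IsCompact K) (n : ℕ) :
    ∀ {V : Type} [NormedAddCommGroup V] [NormedSpace ℝ V] {f : ℝ × E → V},
      ContDiff ℝ ∞ f → ContDiff ℝ n (fun e => ∫ x in K, f (x, e) ∂μ) := by
  have : ProperSpace E := FiniteDimensional.proper ℝ E
  induction n with
  | zero =>
    intro V _ _ f hf
    rw [Nat.cast_zero, contDiff_zero]
    refine continuous_parametric_integral_of_continuous (f := fun e x => f (x, e)) ?_ hK
    exact hf.continuous.comp (continuous_snd.prodMk continuous_fst)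
  | succ n ih =>
    intro V _ _ f hf
    rw [Nat.cast_add, Nat.cast_one, contDiff_succ_iff_hasFDerivAt]
    have hf' : ContDiff ℝ ∞ fun p : ℝ × E =>
        (fderiv ℝ f p).comp (ContinuousLinearMap.inr ℝ ℝ E) :=
      (hf.fderiv_right (m := ∞) (by simp)).clm_comp contDiff_const
    exact ⟨_, ih hf', hasFDerivAt_setIntegral_param μ hK hf⟩

theorem contDiff_setIntegral_param [FiniteDimensional ℝ E] (μ : Measure ℝ)
    [IsLocallyFiniteMeasure μ] {K : Set ℝ} (hK : IsCompact K) {f : ℝ × E → V}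
    (hf : ContDiff ℝ ∞ f) : ContDiff ℝ ∞ (fun e => ∫ x in K, f (x, e) ∂μ) :=
  contDiff_infty.2 fun n => contDiff_setIntegral_param_nat μ hK n hf

/-- The Hadamard quotient `(f (t, e) - f (0, e)) / t`. -/
def hadamard (f : ℝ × E → V) (p : ℝ × E) : V :=
  ∫ s in Icc (0 : ℝ) 1, fderiv ℝ f (s * p.1, p.2) (1, 0)

theorem contDiff_hadamard [FiniteDimensional ℝ E] {f : ℝ × E → V} (hf : ContDiff ℝ ∞ f) :
    ContDiff ℝ ∞ (hadamard f) := by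
  refine contDiff_setIntegral_param (E := ℝ × E) volume isCompact_Icc
    (f := fun q : ℝ × (ℝ × E) => fderiv ℝ f (q.1 * q.2.1, q.2.2) (1, 0)) ?_
  refine ContDiff.clm_apply ?_ contDiff_const
  exact (hf.fderiv_right (m := ∞) (by simp)).comp
    ((contDiff_fst.mul (contDiff_fst.comp contDiff_snd)).prodMk (contDiff_snd.comp contDiff_snd))

/-- The fundamental theorem of calculus for `s ↦ f (s t, e)` on `[0, 1]`. -/
theorem eq_add_smul_hadamard [CompleteSpace V] {f : ℝ × E → V} (hf : ContDiff ℝ ∞ f) (t : ℝ)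
    (e : E) : f (t, e) = f (0, e) + t • hadamard f (t, e) := by
  have hd : ∀ s : ℝ, HasDerivAt (fun s : ℝ => f (s * t, e))
      (t • fderiv ℝ f (s * t, e) (1, 0)) s := by
    intro s
    have h1 := (hf.differentiable (by simp) (s * t, e)).hasFDerivAt
    have h2 : HasDerivAt (fun s : ℝ => ((s * t, e) : ℝ × E)) (t, 0) s := by
      have := (hasDerivAt_id s).mul_const t
      simpa using this.prodMk (hasDerivAt_const s e)
    have h3 := h1.comp_hasDerivAt s h2
    have h4 : ((t, 0) : ℝ × E) = t • ((1, 0) : ℝ × E) := by simp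
    rwa [h4, map_smul] at h3
  have hc : Continuous fun s : ℝ => t • fderiv ℝ f (s * t, e) (1, 0) := by
    have h1 : Continuous (fderiv ℝ f) := hf.continuous_fderiv (by simp)
    have h2 : Continuous fun s : ℝ => fderiv ℝ f (s * t, e) :=
      h1.comp ((continuous_id.mul continuous_const).prodMk continuous_const)
    exact (h2.clm_apply continuous_const).const_smul t
  have h := intervalIntegral.integral_eq_sub_of_hasDerivAt (a := 0) (b := 1)
    (fun s _ => hd s) (hc.intervalIntegrable _ _)
  rw [intervalIntegral.integral_smul, intervalIntegral.integral_of_le zero_le_one,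
    ← integral_Icc_eq_integral_Ioc] at h
  simp only [one_mul, zero_mul] at h
  rw [hadamard, h]
  abel

theorem hadamard_of_ne [CompleteSpace V] {f : ℝ × E → V} (hf : ContDiff ℝ ∞ f) {t : ℝ}
    (ht : t ≠ 0) (e : E) : hadamard f (t, e) = t⁻¹ • (f (t, e) - f (0, e)) := by
  rw [eq_add_smul_hadamard hf t e, add_sub_cancel_left, smul_smul, inv_mul_cancel₀ ht, one_smul]

omit [NormedSpace ℝ E] [NormedSpace ℝ V] in
theorem continuous_slice {f : ℝ × E → V} (hf : Continuous f) (e : E) :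
    Continuous fun t => f (t, e) := hf.comp (continuous_id.prodMk continuous_const)

omit [NormedSpace ℝ E] [NormedSpace ℝ V] in
/-- Two continuous functions that agree off `t = 0` agree. -/
theorem eq_of_eq_of_ne {f g : ℝ × E → V} (hf : Continuous f) (hg : Continuous g)
    (h : ∀ t e, t ≠ 0 → f (t, e) = g (t, e)) : f = g := by
  funext ⟨t, e⟩
  rcases eq_or_ne t 0 with rfl | ht
  · exact eq_at_zero_of_eq_of_ne (continuous_slice hf e) (continuous_slice hg e)
      fun t ht => h t e ht
  · exact h t e ht

/-- If `f` vanishes on `t = 0` then its Hadamard quotient is a test function. -/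
theorem isTest_hadamard [FiniteDimensional ℝ E] [CompleteSpace V] {f : ℝ × E → V}
    (hf : IsTest f) (h0 : ∀ e, f (0, e) = 0) : IsTest (hadamard f) := by
  obtain ⟨R, hR⟩ := hf.bounded
  have hs := contDiff_hadamard hf.smooth
  have hne : ∀ t e, t ≠ 0 → R < ‖((t, e) : ℝ × E)‖ → hadamard f (t, e) = 0 := by
    intro t e ht hlt
    rw [hadamard_of_ne hf.smooth ht, hR _ hlt, h0, sub_zero, smul_zero]
  refine ⟨hs, R, ?_⟩
  rintro ⟨t, e⟩ hlt
  rcases eq_or_ne t 0 with rfl | ht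
  · refine eq_at_zero_of_eq_of_ne (continuous_slice hs.continuous e) continuous_const
      fun t ht => hne t e ht ?_
    -- At `t = 0` the norm is that of `e` alone, so all points `(t, e)` lie outside the ball as
    -- well.
    simp only [Prod.norm_def, norm_zero, lt_sup_iff] at hlt ⊢
    rcases hlt with h | h
    · exact Or.inl (h.trans_le (norm_nonneg _))
    · exact Or.inr h
  · exact hne t e ht hlt

/-- A smooth even bump function equal to `1` on `[-1, 1]` and to `0` off `[-2, 2]`. -/
def bump (t : ℝ) : ℝ := (⟨1, 2, one_pos, one_lt_two⟩ : ContDiffBump (0 : ℝ)) t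

theorem contDiff_bump : ContDiff ℝ ∞ bump := ContDiffBump.contDiff _

theorem bump_of_le {t : ℝ} (ht : |t| ≤ 1) : bump t = 1 :=
  ContDiffBump.one_of_mem_closedBall _ (by simpa using ht)

theorem bump_of_ge {t : ℝ} (ht : 2 ≤ |t|) : bump t = 0 :=
  ContDiffBump.zero_of_le_dist _ (by simpa using ht)

theorem bump_neg (t : ℝ) : bump (-t) = bump t := ContDiffBump.neg _ t

theorem bump_nonneg (t : ℝ) : 0 ≤ bump t := ContDiffBump.nonneg _

theorem bump_le_one (t : ℝ) : bump t ≤ 1 := ContDiffBump.le_one _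

theorem bump_abs (t : ℝ) : bump |t| = bump t := by
  rcases abs_choice t with h | h <;> rw [h]
  exact bump_neg t

theorem isTest_bump : IsTest bump :=
  ⟨contDiff_bump, 2, fun _ hx => bump_of_ge (le_of_lt (by simpa using hx))⟩

end Basic

end

end OrbitalMean


namespace OrbitalMean

noncomputable section

/-! ### Borel's lemma with parameters -/

section Borel

variable {P V : Type} [NormedAddCommGroup P] [NormedSpace ℝ P] [NormedAddCommGroup V]
  [NormedSpace ℝ V]

/-- The map `(t, y) ↦ (λ t, y)`. -/
def scaleFst (P : Type) [NormedAddCommGroup P] [NormedSpace ℝ P] (l : ℝ) : ℝ × P →L[ℝ] ℝ × P :=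
  (l • ContinuousLinearMap.fst ℝ ℝ P).prod (ContinuousLinearMap.snd ℝ ℝ P)

theorem norm_scaleFst_le {l : ℝ} (hl : 1 ≤ l) : ‖scaleFst P l‖ ≤ l := by
  refine ContinuousLinearMap.opNorm_le_bound _ (by linarith) fun x => ?_
  have hl0 : 0 ≤ l := by linarith
  simp only [scaleFst, ContinuousLinearMap.prod_apply, _root_.smul_apply,
    ContinuousLinearMap.coe_fst', ContinuousLinearMap.coe_snd', Prod.norm_def,
    Real.norm_eq_abs, abs_of_nonneg hl0, smul_eq_mul, abs_mul]
  refine max_le (mul_le_mul_of_nonneg_left (le_max_left _ _) hl0) ?_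
  calc ‖x.2‖ ≤ 1 * max |x.1| ‖x.2‖ := by simp
    _ ≤ l * max |x.1| ‖x.2‖ := mul_le_mul_of_nonneg_right hl
        (le_max_of_le_right (norm_nonneg _))

/-- The summand `t ^ j χ(λ t) c(y)` of a Borel series. -/
def borelTerm (c : P → ℝ) (j : ℕ) (l : ℝ) (p : ℝ × P) : ℝ := p.1 ^ j * bump (l * p.1) * c p.2

theorem contDiff_borelTerm {c : P → ℝ} (hc : ContDiff ℝ ∞ c) (j : ℕ) (l : ℝ) :
    ContDiff ℝ ∞ (borelTerm c j l) :=
  ((contDiff_fst.pow j).mul (contDiff_bump.comp (contDiff_const.mul contDiff_fst))).mul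
    (hc.comp contDiff_snd)

theorem isTest_borelTerm {c : P → ℝ} (hc : IsTest c) (j : ℕ) : IsTest (borelTerm c j 1) := by
  obtain ⟨R, hR⟩ := hc.bounded
  refine ⟨contDiff_borelTerm hc.smooth j 1, max 2 R, ?_⟩
  rintro ⟨t, y⟩ h
  rw [Prod.norm_def, lt_max_iff] at h
  simp only [borelTerm, one_mul]
  rcases h with h | h
  · rw [bump_of_ge ((le_max_left _ _).trans h.le)]; simp
  · rw [hR y ((le_max_right _ _).trans_lt h)]; simp

/-- Rescaling `t` shows that the term with scale `l` is `l⁻ʲ` times the term with scale `1` composed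
with `scaleFst`. Each derivative costs at most a factor `l`, so for `i < j` one factor `1 / l`
survives. The condition `i < j` sits inside the existential so that constants can be chosen for all
indices at once. -/
theorem exists_borelTerm_bound [FiniteDimensional ℝ P] {c : P → ℝ} (hc : IsTest c) (i j : ℕ) :
    ∃ C : ℝ, 0 ≤ C ∧ (i < j → ∀ l : ℝ, 1 ≤ l → ∀ p,
      ‖iteratedFDeriv ℝ i (borelTerm c j l) p‖ ≤ C / l) := by
  have : ProperSpace P := FiniteDimensional.proper ℝ P
  have hG := isTest_borelTerm hc j
  obtain ⟨C, hC⟩ := (hG.hasCompactSupport.iteratedFDeriv (𝕜 := ℝ) i).exists_bound_of_continuous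
    (hG.smooth.continuous_iteratedFDeriv (m := i) (by exact_mod_cast le_top))
  refine ⟨C, (norm_nonneg _).trans (hC 0), fun hij l hl p => ?_⟩
  have hl0 : 0 < l := by linarith
  have heq : borelTerm c j l = (l⁻¹) ^ j • (borelTerm c j 1 ∘ scaleFst P l) := by
    funext p
    have : (l⁻¹) ^ j * l ^ j = 1 := by rw [← mul_pow, inv_mul_cancel₀ hl0.ne', one_pow]
    simp only [borelTerm, scaleFst, Pi.smul_apply, Function.comp, ContinuousLinearMap.prod_apply,
      _root_.smul_apply, ContinuousLinearMap.coe_fst', smul_eq_mul, one_mul,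
      ContinuousLinearMap.coe_snd', mul_pow]
    calc _ = ((l⁻¹) ^ j * l ^ j) * (p.1 ^ j * bump (l * p.1) * c p.2) := by rw [this, one_mul]
      _ = _ := by ring
  have hle : (i : WithTop ℕ∞) ≤ ((⊤ : ℕ∞) : WithTop ℕ∞) := by exact_mod_cast le_top
  rw [heq, iteratedFDeriv_const_smul_apply
    ((hG.smooth.comp (scaleFst P l).contDiff).of_le hle).contDiffAt,
    (scaleFst P l).iteratedFDeriv_comp_right hG.smooth p hle, norm_smul, norm_pow, norm_inv,
    Real.norm_eq_abs, abs_of_pos hl0]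
  have h1 := ContinuousMultilinearMap.norm_compContinuousLinearMap_le
    (iteratedFDeriv ℝ i (borelTerm c j 1) (scaleFst P l p)) fun _ => scaleFst P l
  rw [Finset.prod_const, Finset.card_univ, Fintype.card_fin] at h1
  have h2 : ‖scaleFst P l‖ ^ i ≤ l ^ i :=
    pow_le_pow_left₀ (norm_nonneg _) (norm_scaleFst_le hl) i
  have hC0 : 0 ≤ C := (norm_nonneg _).trans (hC 0)
  calc l⁻¹ ^ j * _ ≤ l⁻¹ ^ j * (C * l ^ i) := by
        refine mul_le_mul_of_nonneg_left (h1.trans ?_) (by positivity)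
        exact mul_le_mul (hC _) h2 (by positivity) hC0
    _ = C * (l ^ i / l ^ j) := by rw [inv_pow]; ring
    _ ≤ C * (1 / l) := by
        refine mul_le_mul_of_nonneg_left ?_ hC0
        rw [div_le_div_iff₀ (by positivity) hl0, one_mul, ← pow_succ]
        exact pow_le_pow_right₀ hl hij
    _ = C / l := by ring

/-- Borel's lemma with parameters: prescribed Taylor coefficients at `t = 0`. -/
theorem exists_borel [FiniteDimensional ℝ P] {c : ℕ → P → ℝ} (hc : ∀ k, ContDiff ℝ ∞ (c k))
    {S : ℝ} (hS : ∀ k y, S < ‖y‖ → c k y = 0) :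
    ∃ f : ℝ × P → ℝ, IsTest f ∧ ∃ R : ℕ → ℝ × P → ℝ, (∀ N, ContDiff ℝ ∞ (R N)) ∧ R 0 = f ∧
      (∀ N t y, S < ‖y‖ → R N (t, y) = 0) ∧ ∀ N t y, R N (t, y) = c N y + t * R (N + 1) (t, y) := by
  have hct : ∀ k, IsTest (c k) := fun k => ⟨hc k, S, hS k⟩
  choose C hC0 hC using fun k i j => exists_borelTerm_bound (hct k) i j
  set A : ℕ → ℝ := fun k => ∑ i ∈ Finset.range (k + 1), ∑ j ∈ Finset.range (k + 1), C k i j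
  -- `A k` dominates every bound `C k i j` with `i, j ≤ k`, so this scale makes those derivatives at
  -- most `2⁻ᵏ`.
  set l : ℕ → ℝ := fun k => max 1 (A k * 2 ^ k) with hl
  have hl1 : ∀ k, 1 ≤ l k := fun k => le_max_left _ _
  have hCA : ∀ k i j, i ≤ k → j ≤ k → C k i j / l k ≤ (1 / 2) ^ k := by
    intro k i j hi hj
    have h1 : C k i j ≤ A k := by
      calc C k i j ≤ ∑ j ∈ Finset.range (k + 1), C k i j :=
            Finset.single_le_sum (f := fun j => C k i j) (fun j _ => hC0 k i j)
              (Finset.mem_range.2 (Nat.lt_succ_of_le hj))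
        _ ≤ A k := Finset.single_le_sum
              (f := fun i => ∑ j ∈ Finset.range (k + 1), C k i j)
              (fun i _ => Finset.sum_nonneg fun j _ => hC0 k i j)
              (Finset.mem_range.2 (Nat.lt_succ_of_le hi))
    have h2 : A k * 2 ^ k ≤ l k := le_max_right _ _
    rw [div_le_iff₀ (by linarith [hl1 k]), one_div, inv_pow]
    have h3 : (0 : ℝ) < 2 ^ k := by positivity
    rw [inv_mul_eq_div, le_div_iff₀ h3]
    exact (mul_le_mul_of_nonneg_right h1 h3.le).trans h2
  -- This is the term of index `m + N` divided by `t ^ N` with its scale kept, so that the sum over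
  -- `m` is the `N`-th tail of the series divided by `t ^ N`.
  set T : ℕ → ℕ → ℝ × P → ℝ := fun N m => borelTerm (c (m + N)) m (l (m + N)) with hT
  have hbound : ∀ N i m, i < m → ∀ p, ‖iteratedFDeriv ℝ i (T N m) p‖ ≤ (1 / 2) ^ m := by
    intro N i m him p
    refine (hC (m + N) i m him _ (hl1 _) p).trans
      ((hCA (m + N) i m (by omega) (by omega)).trans ?_)
    exact pow_le_pow_of_le_one (by norm_num) (by norm_num) (by omega)
  have hgeo : Summable fun m : ℕ => (1 / 2 : ℝ) ^ m := summable_geometric_two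
  set Q : ℕ → ℝ × P → ℝ := fun N p => ∑' m, T N m p with hQ
  have hQs : ∀ N, ContDiff ℝ ∞ (Q N) := by
    intro N
    refine contDiff_tsum_of_eventually (N := ⊤) (v := fun _ m => (1 / 2 : ℝ) ^ m)
      (fun m => contDiff_borelTerm (hc _) _ _) (fun _ _ => hgeo) fun i _ => ?_
    rw [Nat.cofinite_eq_atTop]
    filter_upwards [eventually_gt_atTop i] with m hm p
    exact hbound N i m hm p
  have hsum : ∀ N p, Summable fun m => T N m p := by
    intro N p
    refine Summable.of_norm_bounded_eventually_nat hgeo ?_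
    filter_upwards [eventually_gt_atTop 0] with m hm
    simpa using hbound N 0 m hm p
  have hrec : ∀ N t y, Q N (t, y) = bump (l N * t) * c N y + t * Q (N + 1) (t, y) := by
    intro N t y
    simp only [hQ]
    rw [(hsum N (t, y)).tsum_eq_zero_add, ← tsum_mul_left]
    congr 1
    · simp [hT, borelTerm]
    · refine tsum_congr fun m => ?_
      have : m + 1 + N = m + (N + 1) := by ring
      simp only [hT, borelTerm, this]
      ring
  have htest : IsTest (Q 0) := by
    refine ⟨hQs 0, max 2 S, ?_⟩
    rintro ⟨t, y⟩ h
    rw [Prod.norm_def, lt_max_iff, Real.norm_eq_abs] at h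
    have : ∀ m, T 0 m (t, y) = 0 := by
      intro m
      simp only [hT, borelTerm]
      rcases h with h | h
      · have ht : 2 ≤ |t| := (le_max_left _ _).trans h.le
        rw [bump_of_ge, mul_zero, zero_mul]
        rw [abs_mul, abs_of_nonneg (by linarith [hl1 (m + 0)])]
        nlinarith [hl1 (m + 0)]
      · rw [hS _ y ((le_max_right _ _).trans_lt h), mul_zero]
    simp [hQ, this]
  -- The recursion for `Q` carries the cutoff `bump (l N * t)`, while the one wanted has none.
  -- Iterated Hadamard quotients satisfy the exact recursion with leading term `R N (0, y)`. They
  -- agree with `Q` for small `t`, where the cutoffs equal `1`, and this identifies `R N (0, y)` as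
  -- `c N y`.
  set R : ℕ → ℝ × P → ℝ := fun N => hadamard^[N] (Q 0) with hR
  have hRsucc : ∀ N, R (N + 1) = hadamard (R N) := fun N => Function.iterate_succ_apply' _ _ _
  have hRs : ∀ N, ContDiff ℝ ∞ (R N) := by
    intro N
    induction N with
    | zero => exact hQs 0
    | succ N ih => rw [hRsucc]; exact contDiff_hadamard ih
  have hclose : ∀ N, ∃ d : ℝ, 0 < d ∧ ∀ t y, |t| < d → R N (t, y) = Q N (t, y) := by
    intro N
    induction N with
    | zero => exact ⟨1, one_pos, fun t y _ => rfl⟩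
    | succ N ih =>
      obtain ⟨d, hd, h⟩ := ih
      have hlN : 0 < l N := by linarith [hl1 N]
      have hpos : 0 < min d (l N)⁻¹ := lt_min hd (inv_pos.2 hlN)
      have hb : ∀ t : ℝ, |t| < min d (l N)⁻¹ → bump (l N * t) = 1 := by
        intro t ht
        refine bump_of_le ?_
        rw [abs_mul, abs_of_pos hlN]
        have := (ht.trans_le (min_le_right _ _)).le
        calc l N * |t| ≤ l N * (l N)⁻¹ := mul_le_mul_of_nonneg_left this hlN.le
          _ = 1 := mul_inv_cancel₀ hlN.ne'
      have hne : ∀ t y, t ≠ 0 → |t| < min d (l N)⁻¹ → R (N + 1) (t, y) = Q (N + 1) (t, y) := by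
        intro t y ht0 ht
        have e1 := eq_add_smul_hadamard (hRs N) t y
        rw [h t y (ht.trans_le (min_le_left _ _)), h 0 y (by simpa using hd), hrec N t y,
          hrec N 0 y, hb t ht, hb 0 (by simpa using hpos), ← hRsucc] at e1
        simp only [one_mul, zero_mul, add_zero, smul_eq_mul] at e1
        exact (mul_left_cancel₀ ht0 (add_left_cancel e1)).symm
      refine ⟨_, hpos, fun t y ht => ?_⟩
      rcases eq_or_ne t 0 with rfl | ht0
      · have hmem : ∀ᶠ t : ℝ in 𝓝[≠] 0, R (N + 1) (t, y) = Q (N + 1) (t, y) := by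
          have : ∀ᶠ t : ℝ in 𝓝 0, |t| < min d (l N)⁻¹ :=
            (continuous_abs.tendsto' 0 0 abs_zero).eventually (gt_mem_nhds hpos)
          filter_upwards [nhdsWithin_le_nhds this, self_mem_nhdsWithin] with t h1 h2
          exact hne t y h2 h1
        exact tendsto_nhds_unique_of_eventuallyEq
          (((continuous_slice (hRs _).continuous y).tendsto 0).mono_left nhdsWithin_le_nhds)
          (((continuous_slice (hQs _).continuous y).tendsto 0).mono_left nhdsWithin_le_nhds) hmem
      · exact hne t y ht0 ht
  have hRzero : ∀ N t y, S < ‖y‖ → R N (t, y) = 0 := by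
    intro N
    induction N with
    | zero =>
      intro t y hy
      have : ∀ m, T 0 m (t, y) = 0 := fun m => by simp only [hT, borelTerm, hS _ y hy, mul_zero]
      simp [hR, hQ, this]
    | succ N ih =>
      intro t y hy
      have hne : ∀ t, t ≠ 0 → R (N + 1) (t, y) = 0 := fun t ht => by
        rw [hRsucc, hadamard_of_ne (hRs N) ht, ih t y hy, ih 0 y hy, sub_zero, smul_zero]
      rcases eq_or_ne t 0 with rfl | ht
      · exact eq_at_zero_of_eq_of_ne (continuous_slice (hRs _).continuous y) continuous_const hne
      · exact hne t ht
  refine ⟨Q 0, htest, R, hRs, rfl, hRzero, fun N t y => ?_⟩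
  obtain ⟨d, hd, h⟩ := hclose N
  rw [eq_add_smul_hadamard (hRs N) t y, hRsucc, h 0 y (by simpa using hd), hrec N 0 y, mul_zero,
    bump_of_le (by simp)]
  simp

/-- Both Whitney's theorem and the hyperbolic expansion compare a function with a Borel sum by
unrolling two such recursions. -/
theorem sum_form_of_rec {c : ℕ → ℝ} {r : ℕ → ℝ} {t : ℝ}
    (h : ∀ N, r N = c N + t * r (N + 1)) (N : ℕ) :
    r 0 = ∑ k ∈ Finset.range N, t ^ k * c k + t ^ N * r N := by
  induction N with
  | zero => simp
  | succ N ih => rw [ih, Finset.sum_range_succ, h N]; ring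

end Borel

end

end OrbitalMean


namespace OrbitalMean

noncomputable section

/-! ### Even functions as functions of the square -/

section Even

variable {P V : Type} [NormedAddCommGroup P] [NormedSpace ℝ P] [NormedAddCommGroup V]
  [NormedSpace ℝ V]

omit [NormedSpace ℝ P] in
-- Used with `u = √p.1`: four factors of `u` are quadratically small at points with first coordinate
-- `0` and the rest is bounded, so the derivative there exists and is zero.
theorem norm_pow_mul_le_of_continuous {q : ℝ × P → V} (hq : Continuous q) {u : ℝ × P → ℝ}
    (hu : Continuous u) (x : ℝ × P) {n : ℕ} (hle : ∀ p, |u p| ^ 4 ≤ |p.1| ^ 2) (hx : x.1 = 0)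
    (hn : 4 ≤ n) :
    (fun p => u p ^ n • q (u p, p.2)) =O[𝓝 x] fun p => ‖p - x‖ ^ 2 := by
  have hc : Continuous fun p => u p ^ (n - 4) • q (u p, p.2) :=
    (hu.pow _).smul (hq.comp (hu.prodMk continuous_snd))
  have h1 : (fun p => u p ^ (n - 4) • q (u p, p.2)) =O[𝓝 x] fun _ => (1 : ℝ) :=
    hc.continuousAt.isBigO_one ℝ
  have h2 : (fun p => u p ^ 4) =O[𝓝 x] fun p => ‖p - x‖ ^ 2 := by
    refine Asymptotics.IsBigO.of_bound 1 (Eventually.of_forall fun p => ?_)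
    rw [norm_pow, norm_pow, norm_norm, one_mul, Real.norm_eq_abs]
    refine (hle p).trans (pow_le_pow_left₀ (abs_nonneg _) ?_ 2)
    have := norm_fst_le (p - x)
    simpa [hx] using this
  refine (h2.smul h1).congr (fun p => ?_) fun p => ?_
  · rw [smul_smul, ← pow_add, Nat.add_sub_cancel' hn]
  · simp

/-- The derivative of `a ↦ √a ^ (2 n) q(√a, y)` is `√a ^ (2 (n - 1))` times this function
of `(√a, y)`. -/
def sqrtDeriv (n : ℕ) (q : ℝ × P → V) (p : ℝ × P) : ℝ × P →L[ℝ] V :=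
  (ContinuousLinearMap.fst ℝ ℝ P).smulRight ((n : ℝ) • q p) +
    (fderiv ℝ q p).comp
      ((p.1 / 2) • (ContinuousLinearMap.inl ℝ ℝ P).comp (ContinuousLinearMap.fst ℝ ℝ P) +
        p.1 ^ 2 • (ContinuousLinearMap.inr ℝ ℝ P).comp (ContinuousLinearMap.snd ℝ ℝ P))

theorem contDiff_sqrtDeriv (n : ℕ) {q : ℝ × P → V} (hq : ContDiff ℝ ∞ q) :
    ContDiff ℝ ∞ (sqrtDeriv n q) := by
  refine (contDiff_const.smulRight (hq.const_smul _)).add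
    ((hq.fderiv_right (m := ∞) (by simp)).clm_comp ?_)
  exact ((contDiff_fst.div_const 2).smul contDiff_const).add
    ((contDiff_fst.pow 2).smul contDiff_const)

theorem sqrt_pow_four_le (a : ℝ) : |√a| ^ 4 ≤ |a| ^ 2 := by
  rw [abs_of_nonneg (Real.sqrt_nonneg a), show 4 = 2 * 2 from rfl, pow_mul]
  refine pow_le_pow_left₀ (by positivity) ?_ 2
  rcases le_total 0 a with h | h
  · rw [Real.sq_sqrt h]; exact le_abs_self a
  · rw [Real.sqrt_eq_zero_of_nonpos h]; simp

/-- Differentiating costs two powers of `√a` and reproduces the same shape, with `sqrtDeriv` in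
place of `q`. For `a < 0` the function is locally zero, and at `a = 0` the quadratic bound gives
derivative zero. -/
theorem contDiff_sqrt_pow_smul (n : ℕ) : ∀ {V : Type} [NormedAddCommGroup V] [NormedSpace ℝ V]
    {q : ℝ × P → V}, ContDiff ℝ ∞ q →
      ContDiff ℝ n fun p : ℝ × P => √p.1 ^ (2 * (n + 1)) • q (√p.1, p.2) := by
  have hsq : Continuous fun p : ℝ × P => √p.1 := Real.continuous_sqrt.comp continuous_fst
  induction n with
  | zero =>
    intro V _ _ q hq
    rw [Nat.cast_zero, contDiff_zero]
    exact (hsq.pow _).smul (hq.continuous.comp (hsq.prodMk continuous_snd))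
  | succ n ih =>
    intro V _ _ q hq
    rw [Nat.cast_add, Nat.cast_one, contDiff_succ_iff_hasFDerivAt]
    refine ⟨_, ih (contDiff_sqrtDeriv (n + 2) hq), ?_⟩
    rintro ⟨a, y⟩
    rcases lt_trichotomy a 0 with ha | rfl | ha
    · have hev : ∀ᶠ p : ℝ × P in 𝓝 (a, y), √p.1 = 0 := by
        have : ∀ᶠ p : ℝ × P in 𝓝 (a, y), p.1 < 0 :=
          continuous_fst.continuousAt.eventually (gt_mem_nhds ha)
        exact this.mono fun p hp => Real.sqrt_eq_zero_of_nonpos hp.le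
      have h0 : √(a, y).1 = 0 := hev.self_of_nhds
      simp only [h0]
      rw [zero_pow (by positivity), zero_smul]
      refine (hasFDerivAt_const (0 : V) _).congr_of_eventuallyEq ?_
      filter_upwards [hev] with p hp
      rw [hp, zero_pow (by positivity), zero_smul]
    · have h := norm_pow_mul_le_of_continuous hq.continuous hsq ((0 : ℝ), y)
        (n := 2 * (n + 1 + 1)) (fun p => sqrt_pow_four_le p.1) rfl (by omega)
      simpa using h.hasFDerivAt one_lt_two
    · have hs0 : √a ≠ 0 := (Real.sqrt_pos.2 ha).ne'
      have h1 : HasFDerivAt (fun p : ℝ × P => √p.1)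
          ((1 / (2 * √a)) • ContinuousLinearMap.fst ℝ ℝ P) (a, y) :=
        (Real.hasDerivAt_sqrt ha.ne').comp_hasFDerivAt (a, y) hasFDerivAt_fst
      have h2 := h1.pow (2 * (n + 1 + 1))
      have h3 := (hq.differentiable (by simp) (√a, y)).hasFDerivAt.comp (a, y)
        (h1.prodMk hasFDerivAt_snd)
      have h4 := h2.smul h3
      refine h4.congr_fderiv ?_
      refine ContinuousLinearMap.ext fun ⟨da, dy⟩ => ?_
      have e1 : ((da * (1 / (2 * √a)), dy) : ℝ × P)
          = (√a ^ 2)⁻¹ • ((√a / 2 * da, √a ^ 2 • dy) : ℝ × P) := by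
        ext
        · simp; field_simp
        · simp [smul_smul, hs0]
      have e2 : 2 * (n + 1 + 1) = 2 * (n + 1) + 2 := by ring
      simp only [sqrtDeriv, _root_.add_apply, ContinuousLinearMap.comp_apply,
        ContinuousLinearMap.prod_apply, ContinuousLinearMap.inl_apply,
        ContinuousLinearMap.inr_apply, Prod.smul_mk, Prod.mk_add_mk, smul_zero, mul_zero, add_zero, zero_add,
        _root_.smul_apply, ContinuousLinearMap.coe_fst',
        ContinuousLinearMap.coe_snd', ContinuousLinearMap.smulRight_apply, smul_eq_mul,
        Function.comp]
      rw [mul_comm (1 / (2 * √a)) da, e1, map_smul, smul_smul, smul_add, smul_smul, smul_smul, e2,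
        add_comm]
      congr 1
      · congr 1
        have e3 : 2 * (n + 1) + 2 - 1 = 2 * (n + 1) + 1 := by omega
        rw [e3]
        push_cast
        field_simp
        ring
      · congr 1
        rw [pow_add]
        field_simp

/-- Whitney's theorem: an even test function is a test function of the square. -/
theorem IsTest.exists_comp_sq [FiniteDimensional ℝ P] {g : ℝ × P → ℝ} (hg : IsTest g)
    (heven : ∀ u y, g (-u, y) = g (u, y)) :
    ∃ h : ℝ × P → ℝ, IsTest h ∧ ∀ u y, g (u, y) = h (u ^ 2, y) := by
  -- The Hadamard quotient of an even function is odd and vanishes at `0`, so dividing twice gives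
  -- `G k (u, y) = G k (0, y) + u² G (k+1) (u, y)` with `G (k+1)` even again. The values `G k (0,
  -- y)` are the Taylor coefficients in `u²`.
  set G : ℕ → ℝ × P → ℝ := fun k => (fun f => hadamard (hadamard f))^[k] g with hG
  have hGsucc : ∀ k, G (k + 1) = hadamard (hadamard (G k)) :=
    fun k => Function.iterate_succ_apply' _ _ _
  obtain ⟨S, hS1, hS⟩ := hg.exists_radius
  have step : ∀ f : ℝ × P → ℝ, ContDiff ℝ ∞ f → (∀ u y, f (-u, y) = f (u, y)) →
      ∀ u y, f (u, y) = f (0, y) + u ^ 2 * hadamard (hadamard f) (u, y) := by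
    intro f hf he u y
    have hc := contDiff_hadamard hf
    have hodd : ∀ u, u ≠ 0 → hadamard f (-u, y) = -hadamard f (u, y) := by
      intro u hu
      rw [hadamard_of_ne hf hu, hadamard_of_ne hf (neg_ne_zero.2 hu), he]
      simp [inv_neg]
    have h0 : hadamard f (0, y) = 0 := by
      have hcs := continuous_slice hc.continuous y
      have := eq_at_zero_of_eq_of_ne (f := fun u => hadamard f (-u, y)) (hcs.comp continuous_neg)
        hcs.neg hodd
      simp only [neg_zero, Pi.neg_apply] at this
      linarith
    have e1 := eq_add_smul_hadamard hf u y
    have e2 := eq_add_smul_hadamard hc u y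
    rw [e1, e2, h0]
    simp only [smul_eq_mul]
    ring
  have hGall : ∀ k, ContDiff ℝ ∞ (G k) ∧ (∀ u y, G k (-u, y) = G k (u, y)) ∧
      ∀ u y, S < ‖y‖ → G k (u, y) = 0 := by
    intro k
    induction k with
    | zero => exact ⟨hg.smooth, heven, fun u y hy => hS _ (hy.trans_le (norm_snd_le (u, y)))⟩
    | succ k ih =>
      obtain ⟨h1, h2, h3⟩ := ih
      have hs : ContDiff ℝ ∞ (G (k + 1)) := by
        rw [hGsucc]; exact contDiff_hadamard (contDiff_hadamard h1)
      have hst := step _ h1 h2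
      rw [← hGsucc] at hst
      refine ⟨hs, fun u y => ?_, fun u y hy => ?_⟩
      · rcases eq_or_ne u 0 with rfl | hu
        · rw [neg_zero]
        · have e1 := hst u y
          have e2 := hst (-u) y
          rw [h2, neg_sq, e1] at e2
          exact (mul_left_cancel₀ (pow_ne_zero 2 hu) (add_left_cancel e2)).symm
      · have hne : ∀ u, u ≠ 0 → G (k + 1) (u, y) = 0 := by
          intro u hu
          have e1 := hst u y
          rw [h3 u y hy, h3 0 y hy, zero_add, eq_comm] at e1
          exact (mul_eq_zero.1 e1).resolve_left (pow_ne_zero 2 hu)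
        rcases eq_or_ne u 0 with rfl | hu
        · exact eq_at_zero_of_eq_of_ne (continuous_slice hs.continuous y) continuous_const hne
        · exact hne u hu
  obtain ⟨E, hE, R, hRs, hR0, -, hR⟩ := exists_borel (c := fun k y => G k (0, y))
    (fun k => (hGall k).1.comp (contDiff_const.prodMk contDiff_id)) (S := S)
    (fun k y hy => (hGall k).2.2 0 y hy)
  have key : ∀ N u y, g (u, y) - E (u ^ 2, y) = u ^ (2 * N) * (G N (u, y) - R N (u ^ 2, y)) := by
    intro N u y
    have e1 := sum_form_of_rec (c := fun k => G k (0, y)) (r := fun k => G k (u, y)) (t := u ^ 2)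
      (fun k => by rw [hGsucc]; exact step _ (hGall k).1 (hGall k).2.1 u y) N
    have e2 := sum_form_of_rec (c := fun k => G k (0, y)) (r := fun k => R k (u ^ 2, y))
      (t := u ^ 2) (fun k => hR k _ y) N
    rw [hR0] at e2
    have e3 : g (u, y) = G 0 (u, y) := rfl
    rw [e3, e1, e2, pow_mul]
    ring
  -- With `E (√a ^ 2, y)` in place of `E (a, y)` the correction vanishes for `a ≤ 0`. By `key` it is
  -- `√a ^ (2(n+1))` times a smooth function of `(√a, y)` for every `n`, hence smooth.
  set h : ℝ × P → ℝ := fun p => E p + (g (√p.1, p.2) - E (√p.1 ^ 2, p.2)) with hh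
  have hval : ∀ u y, g (u, y) = h (u ^ 2, y) := by
    intro u y
    simp only [hh, Real.sqrt_sq_eq_abs, sq_abs, add_sub_cancel]
    rcases abs_choice u with hu | hu <;> rw [hu]
    rw [heven]
  refine ⟨h, ⟨hE.smooth.add (contDiff_infty.2 fun n => ?_), ?_⟩, hval⟩
  · have hq : ContDiff ℝ ∞ fun p : ℝ × P => G (n + 1) p - R (n + 1) (p.1 ^ 2, p.2) :=
      (hGall _).1.sub ((hRs _).comp ((contDiff_fst.pow 2).prodMk contDiff_snd))
    convert contDiff_sqrt_pow_smul n hq using 2 with p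
    rw [key (n + 1), smul_eq_mul]
  · obtain ⟨T, hT1, hT⟩ := hE.exists_radius
    refine ⟨max (S ^ 2) T, ?_⟩
    rintro ⟨a, y⟩ hp
    have hpT : T < ‖((a, y) : ℝ × P)‖ := (le_max_right _ _).trans_lt hp
    have hS2 : S ≤ S ^ 2 := by nlinarith
    have hpS : S ^ 2 < ‖((a, y) : ℝ × P)‖ := (le_max_left _ _).trans_lt hp
    rcases le_total 0 a with ha | ha
    · have hsqa := hval (√a) y
      have hz : S < ‖((√a, y) : ℝ × P)‖ := by
        rw [Prod.norm_def, lt_max_iff] at hpS ⊢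
        rcases hpS with h1 | h1
        · left
          simp only [Real.norm_eq_abs, abs_of_nonneg ha, abs_of_nonneg (Real.sqrt_nonneg a)] at h1 ⊢
          exact Real.lt_sqrt_of_sq_lt h1
        · exact Or.inr (hS2.trans_lt h1)
      rw [Real.sq_sqrt ha] at hsqa
      rw [← hsqa, hS _ hz]
    · simp only [hh, Real.sqrt_eq_zero_of_nonpos ha]
      rw [hT _ hpT, key 1]
      simp

end Even

end

end OrbitalMean


namespace OrbitalMean

noncomputable section

/-! ### Power measures on the half-line and beta integrals -/

section PowMeasure

/-- The measure with density `a ^ (α - 1)` on the positive half-line. -/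
def powMeasure (α : ℝ) : Measure ℝ :=
  (volume.restrict (Ioi 0)).withDensity fun a => ENNReal.ofReal (a ^ (α - 1))

instance (α : ℝ) : SFinite (powMeasure α) := by unfold powMeasure; infer_instance

theorem measurable_powDensity (α : ℝ) :
    Measurable fun a : ℝ => ENNReal.ofReal (a ^ (α - 1)) := by fun_prop

theorem integral_powMeasure (α : ℝ) (G : ℝ → ℝ) :
    ∫ a, G a ∂powMeasure α = ∫ a in Ioi 0, a ^ (α - 1) * G a := by
  rw [powMeasure, integral_withDensity_eq_integral_toReal_smul (measurable_powDensity α)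
    (Eventually.of_forall fun _ => ENNReal.ofReal_lt_top)]
  refine setIntegral_congr_fun measurableSet_Ioi fun a ha => ?_
  simp only [smul_eq_mul]
  rw [ENNReal.toReal_ofReal (Real.rpow_nonneg (le_of_lt ha) _)]

theorem isLocallyFiniteMeasure_powMeasure {α : ℝ} (hα : 0 < α) :
    IsLocallyFiniteMeasure (powMeasure α) := by
  refine ⟨fun x => ⟨Iio (|x| + 1), Iio_mem_nhds (by linarith [le_abs_self x]), ?_⟩⟩
  rw [powMeasure, withDensity_apply _ measurableSet_Iio, Measure.restrict_restrict measurableSet_Iio]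
  have h : IntegrableOn (fun a : ℝ => a ^ (α - 1)) (Ioc 0 (|x| + 1)) := by
    rw [← intervalIntegrable_iff_integrableOn_Ioc_of_le (by positivity)]
    exact intervalIntegral.intervalIntegrable_rpow' (by linarith)
  have h2 := h.mono_set (t := Ioc 0 (|x| + 1)) (s := Iio (|x| + 1) ∩ Ioi 0)
    fun a ha => ⟨ha.2, ha.1.le⟩
  have h3 := h2.2
  rw [hasFiniteIntegral_iff_ofReal] at h3
  · exact h3
  · filter_upwards [ae_restrict_mem (measurableSet_Iio.inter measurableSet_Ioi)] with a ha
    exact Real.rpow_nonneg (le_of_lt ha.2) _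

theorem integral_prod_powMeasure (α β : ℝ) (G : ℝ × ℝ → ℝ) :
    ∫ z, G z ∂(powMeasure α).prod (powMeasure β)
      = ∫ z in Ioi 0 ×ˢ Ioi 0, z.1 ^ (α - 1) * z.2 ^ (β - 1) * G z := by
  rw [powMeasure, powMeasure, prod_withDensity (measurable_powDensity α) (measurable_powDensity β),
    integral_withDensity_eq_integral_toReal_smul (by fun_prop)
      (Eventually.of_forall fun _ => ENNReal.mul_lt_top ENNReal.ofReal_lt_top ENNReal.ofReal_lt_top),
    Measure.prod_restrict, ← Measure.volume_eq_prod]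
  refine setIntegral_congr_fun (measurableSet_Ioi.prod measurableSet_Ioi) fun z hz => ?_
  simp only [smul_eq_mul]
  rw [ENNReal.toReal_mul, ENNReal.toReal_ofReal (Real.rpow_nonneg (le_of_lt hz.1) _),
    ENNReal.toReal_ofReal (Real.rpow_nonneg (le_of_lt hz.2) _)]

/-- The substitution `a = u²` on the half-line; the two signs of `u` cancel the factor `1/2`. -/
theorem integral_powMeasure_half (G : ℝ → ℝ) :
    ∫ u, G (u ^ 2) = ∫ a, G a ∂powMeasure (1 / 2) := by
  have h1 := integral_comp_abs (f := fun u => G (u ^ 2))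
  simp only [sq_abs] at h1
  have h2 := integral_comp_rpow_Ioi (fun a => a ^ ((1 / 2 : ℝ) - 1) * G a) (two_ne_zero (α := ℝ))
  rw [h1, integral_powMeasure, ← h2, ← integral_const_mul]
  refine setIntegral_congr_fun measurableSet_Ioi fun u hu => ?_
  have hu0 : (0 : ℝ) < u := hu
  have e1 : u ^ (2 : ℝ) = u ^ 2 := Real.rpow_two u
  have e2 : (u ^ (2 : ℝ)) ^ ((1 / 2 : ℝ) - 1) = u⁻¹ := by
    rw [← Real.rpow_mul hu0.le, ← Real.rpow_neg_one]; norm_num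
  simp only [smul_eq_mul]
  rw [e2, e1, show (2 : ℝ) - 1 = 1 by norm_num, Real.rpow_one, abs_of_pos two_pos]
  field_simp

/-- The density `w ^ (α - 1) (1 - w) ^ (β - 1)` on `(0, 1)`. -/
def betaMeasure (α β : ℝ) : Measure ℝ :=
  (volume.restrict (Ioo 0 1)).withDensity fun w =>
    ENNReal.ofReal (w ^ (α - 1) * (1 - w) ^ (β - 1))

theorem measurable_betaDensity (α β : ℝ) :
    Measurable fun w : ℝ => ENNReal.ofReal (w ^ (α - 1) * (1 - w) ^ (β - 1)) := by fun_prop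

/-- Convergence is taken from the complex beta integral by passing to norms. -/
theorem isFiniteMeasure_betaMeasure {α β : ℝ} (hα : 0 < α) (hβ : 0 < β) :
    IsFiniteMeasure (betaMeasure α β) := by
  refine ⟨?_⟩
  rw [betaMeasure, withDensity_apply _ MeasurableSet.univ, Measure.restrict_univ]
  have h := (Complex.betaIntegral_convergent (u := α) (v := β) (by simpa) (by simpa)).norm
  rw [intervalIntegrable_iff_integrableOn_Ioo_of_le zero_le_one] at h
  have h3 := h.2
  rw [hasFiniteIntegral_iff_ofReal (Eventually.of_forall fun _ => norm_nonneg _)] at h3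
  refine lt_of_le_of_lt (le_of_eq ?_) h3
  refine setLIntegral_congr_fun measurableSet_Ioo fun w hw => ?_
  have e1 : (1 - (w : ℂ)) = ((1 - w : ℝ) : ℂ) := by push_cast; ring
  rw [norm_mul, e1, Complex.norm_cpow_eq_rpow_re_of_pos hw.1,
    Complex.norm_cpow_eq_rpow_re_of_pos (by linarith [hw.2])]
  simp

/-- The density is strictly positive on `(0, 1)`. This is what makes the leading singular
coefficient nonzero when one exponent is an integer. -/
theorem betaMeasure_univ_pos (α β : ℝ) : betaMeasure α β univ ≠ 0 := by
  rw [betaMeasure, withDensity_apply _ MeasurableSet.univ, Measure.restrict_univ]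
  intro h
  rw [lintegral_eq_zero_iff (measurable_betaDensity α β)] at h
  have h2 : ∀ᵐ w ∂(volume.restrict (Ioo (0 : ℝ) 1)), False := by
    filter_upwards [h, ae_restrict_mem measurableSet_Ioo] with w hw hm
    have : (0 : ℝ) < w ^ (α - 1) * (1 - w) ^ (β - 1) :=
      mul_pos (Real.rpow_pos_of_pos hm.1 _) (Real.rpow_pos_of_pos (by linarith [hm.2]) _)
    have h4 : ENNReal.ofReal (w ^ (α - 1) * (1 - w) ^ (β - 1)) = 0 := hw
    rw [ENNReal.ofReal_eq_zero] at h4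
    linarith
  rw [ae_iff] at h2
  simp at h2

/-- The derivative of `(c, w) ↦ (c w, c (1 - w))`. -/
def segDeriv (z : ℝ × ℝ) : ℝ × ℝ →L[ℝ] ℝ × ℝ :=
  (z.1 • ContinuousLinearMap.snd ℝ ℝ ℝ + z.2 • ContinuousLinearMap.fst ℝ ℝ ℝ).prod
    (z.1 • (-ContinuousLinearMap.snd ℝ ℝ ℝ) + (1 - z.2) • ContinuousLinearMap.fst ℝ ℝ ℝ)

theorem det_prod_eq (a b c d : ℝ) :
    ((a • ContinuousLinearMap.fst ℝ ℝ ℝ + b • ContinuousLinearMap.snd ℝ ℝ ℝ).prod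
      (c • ContinuousLinearMap.fst ℝ ℝ ℝ + d • ContinuousLinearMap.snd ℝ ℝ ℝ)).det
      = a * d - b * c := by
  rw [ContinuousLinearMap.det, ← LinearMap.det_toMatrix (Module.Basis.finTwoProd ℝ)]
  rw [Matrix.det_fin_two]
  simp [LinearMap.toMatrix_apply]

theorem det_segDeriv (z : ℝ × ℝ) : (segDeriv z).det = -z.1 := by
  have h : segDeriv z = (z.2 • ContinuousLinearMap.fst ℝ ℝ ℝ + z.1 • ContinuousLinearMap.snd ℝ ℝ ℝ).prod
      ((1 - z.2) • ContinuousLinearMap.fst ℝ ℝ ℝ + (-z.1) • ContinuousLinearMap.snd ℝ ℝ ℝ) := by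
    ext <;> simp [segDeriv]
  rw [h, det_prod_eq]
  ring

theorem hasFDerivAt_seg (z : ℝ × ℝ) :
    HasFDerivAt (fun z : ℝ × ℝ => (z.1 * z.2, z.1 * (1 - z.2))) (segDeriv z) z :=
  (hasFDerivAt_fst.mul hasFDerivAt_snd).prodMk
    (hasFDerivAt_fst.mul (hasFDerivAt_snd.const_sub 1))

theorem image_seg : (fun z : ℝ × ℝ => (z.1 * z.2, z.1 * (1 - z.2))) '' (Ioi 0 ×ˢ Ioo 0 1)
    = Ioi 0 ×ˢ Ioi 0 := by
  ext ⟨a, b⟩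
  constructor
  · rintro ⟨⟨c, w⟩, ⟨hc, hw⟩, h⟩
    simp only [Prod.mk.injEq] at h
    simp only [mem_Ioi, mem_Ioo] at hc hw
    rw [← h.1, ← h.2]
    exact ⟨mul_pos hc hw.1, mul_pos hc (by linarith [hw.2])⟩
  · rintro ⟨ha, hb⟩
    simp only [mem_Ioi] at ha hb
    have hab : 0 < a + b := add_pos ha hb
    refine ⟨(a + b, a / (a + b)), ⟨hab, div_pos ha hab, ?_⟩, ?_⟩
    · rw [div_lt_one hab]; linarith
    · ext
      · simp; field_simp
      · simp; field_simp; ring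

theorem injOn_seg : InjOn (fun z : ℝ × ℝ => (z.1 * z.2, z.1 * (1 - z.2))) (Ioi 0 ×ˢ Ioo 0 1) := by
  rintro ⟨c, w⟩ ⟨hc, hw⟩ ⟨c', w'⟩ ⟨hc', hw'⟩ h
  simp only [Prod.mk.injEq] at h
  simp only [mem_Ioi] at hc hc'
  have h1 : c = c' := by linarith [h.1, h.2]
  subst h1
  rw [mul_left_cancel₀ hc.ne' h.1]

/-- Beta integrals: `powMeasure α × powMeasure β` in the coordinates `a = c w`, `b = c (1 - w)`. -/
theorem integral_prod_powMeasure_eq_beta (α β : ℝ) (G : ℝ × ℝ → ℝ) :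
    ∫ z, G z ∂(powMeasure α).prod (powMeasure β)
      = ∫ z, G (z.1 * z.2, z.1 * (1 - z.2)) ∂(powMeasure (α + β)).prod (betaMeasure α β) := by
  rw [integral_prod_powMeasure, ← image_seg,
    integral_image_eq_integral_abs_det_fderiv_smul volume (measurableSet_Ioi.prod measurableSet_Ioo)
      (fun z _ => (hasFDerivAt_seg z).hasFDerivWithinAt) injOn_seg,
    powMeasure, betaMeasure,
    prod_withDensity (measurable_powDensity _) (measurable_betaDensity α β),
    integral_withDensity_eq_integral_toReal_smul (by fun_prop)
      (Eventually.of_forall fun _ => ENNReal.mul_lt_top ENNReal.ofReal_lt_top ENNReal.ofReal_lt_top),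
    Measure.prod_restrict, ← Measure.volume_eq_prod]
  refine setIntegral_congr_fun (measurableSet_Ioi.prod measurableSet_Ioo) fun z hz => ?_
  have hc : 0 < z.1 := hz.1
  have hw : 0 < z.2 := hz.2.1
  have hw' : 0 < 1 - z.2 := by linarith [hz.2.2]
  simp only [smul_eq_mul]
  rw [ENNReal.toReal_mul, ENNReal.toReal_ofReal (Real.rpow_nonneg hc.le _),
    ENNReal.toReal_ofReal (mul_nonneg (Real.rpow_nonneg hw.le _) (Real.rpow_nonneg hw'.le _)),
    det_segDeriv, abs_neg, abs_of_pos hc, Real.mul_rpow hc.le hw.le, Real.mul_rpow hc.le hw'.le]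
  have : z.1 ^ (α + β - 1) = z.1 * (z.1 ^ (α - 1) * z.1 ^ (β - 1)) := by
    have h1 : z.1 = z.1 ^ (1 : ℝ) := (Real.rpow_one _).symm
    calc z.1 ^ (α + β - 1) = z.1 ^ (1 + ((α - 1) + (β - 1))) := by congr 1; ring
      _ = _ := by rw [Real.rpow_add hc, Real.rpow_add hc, Real.rpow_one]
  rw [this]
  ring

end PowMeasure

end

end OrbitalMean


namespace OrbitalMean

noncomputable section

/-! ### Reduction to squared radii -/

section Radial

variable {E E' P : Type} [NormedAddCommGroup E] [NormedSpace ℝ E] [NormedAddCommGroup E']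
  [NormedSpace ℝ E'] [NormedAddCommGroup P] [NormedSpace ℝ P]

theorem IsTest.swap {V : Type} [NormedAddCommGroup V] [NormedSpace ℝ V] {f : E × E' × P → V}
    (hf : IsTest f) : IsTest fun p : E' × E × P => f (p.2.1, p.1, p.2.2) := by
  refine hf.comp ((contDiff_fst.comp contDiff_snd).prodMk
    (contDiff_fst.prodMk (contDiff_snd.comp contDiff_snd))) fun R => ⟨R, fun p hp => ?_⟩
  simp only [Prod.norm_def] at hp ⊢
  rwa [max_left_comm]

theorem IsTest.slice {f : E × E' × P → ℝ} (hf : IsTest f) (y : P) :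
    IsTest fun p : E × E' => f (p.1, p.2, y) := by
  refine hf.comp (contDiff_fst.prodMk (contDiff_snd.prodMk contDiff_const)) fun R =>
    ⟨R, fun p hp => hp.trans_le ?_⟩
  simp only [Prod.norm_def]
  exact max_le (le_max_left _ _) (le_max_of_le_right (le_max_left _ _))

theorem IsTest.slice_fst {f : E × P → ℝ} (hf : IsTest f) (y : P) : IsTest fun a => f (a, y) :=
  hf.comp (contDiff_id.prodMk contDiff_const) fun R =>
    ⟨R, fun p hp => hp.trans_le (norm_fst_le (p, y))⟩

theorem IsTest.slice_snd {f : E × P → ℝ} (hf : IsTest f) (a : E) : IsTest fun y => f (a, y) :=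
  hf.comp (contDiff_const.prodMk contDiff_id) fun R =>
    ⟨R, fun p hp => hp.trans_le (norm_snd_le (a, p))⟩

theorem integrable_mul_of_isTest [ProperSpace E] [MeasurableSpace E] [OpensMeasurableSpace E]
    (μ : Measure E) [IsFiniteMeasureOnCompacts μ] {f : E → ℝ} (hf : IsTest f) {F : E → ℝ}
    (hF : Continuous F) : Integrable (fun x => F x * f x) μ :=
  (hF.mul hf.smooth.continuous).integrable_of_hasCompactSupport hf.hasCompactSupport.mul_left

theorem integral_integral_swap_of_isTest [FiniteDimensional ℝ E] [FiniteDimensional ℝ E']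
    [MeasurableSpace E] [BorelSpace E] [MeasurableSpace E'] [BorelSpace E'] (μ : Measure E)
    (ν : Measure E') [IsLocallyFiniteMeasure μ] [SFinite μ] [IsLocallyFiniteMeasure ν] [SFinite ν]
    {f : E × E' → ℝ} (hf : IsTest f) {F : E × E' → ℝ} (hF : Continuous F) :
    ∫ a, ∫ b, F (a, b) * f (a, b) ∂ν ∂μ = ∫ b, ∫ a, F (a, b) * f (a, b) ∂μ ∂ν := by
  have : ProperSpace E := FiniteDimensional.proper ℝ E
  have : ProperSpace E' := FiniteDimensional.proper ℝ E'
  exact integral_integral_swap (f := fun a b => F (a, b) * f (a, b))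
    (integrable_mul_of_isTest (μ.prod ν) hf hF)

theorem integral_prod_of_isTest [FiniteDimensional ℝ E] [FiniteDimensional ℝ E']
    [MeasurableSpace E] [BorelSpace E] [MeasurableSpace E'] [BorelSpace E'] (μ : Measure E)
    (ν : Measure E') [IsLocallyFiniteMeasure μ] [SFinite μ] [IsLocallyFiniteMeasure ν] [SFinite ν]
    {f : E × E' → ℝ} (hf : IsTest f) {F : E × E' → ℝ} (hF : Continuous F) :
    ∫ z, F z * f z ∂μ.prod ν = ∫ a, ∫ b, F (a, b) * f (a, b) ∂ν ∂μ := by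
  have : ProperSpace E := FiniteDimensional.proper ℝ E
  have : ProperSpace E' := FiniteDimensional.proper ℝ E'
  exact integral_prod _ (integrable_mul_of_isTest (μ.prod ν) hf hF)

theorem betaMeasure_compl (α β : ℝ) : ∀ᵐ w ∂betaMeasure α β, w ∈ Ioo (0 : ℝ) 1 :=
  (withDensity_absolutelyContinuous _ _).ae_le (ae_restrict_mem measurableSet_Ioo)

/-- The convolution of `powMeasure α` and `powMeasure β`, with smooth densities. -/
theorem exists_beta_density [FiniteDimensional ℝ P] {α β : ℝ} (hα : 0 < α) (hβ : 0 < β)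
    {k : ℝ × ℝ × P → ℝ} (hk : IsTest k) :
    ∃ g : ℝ × P → ℝ, IsTest g ∧ (∀ y, g (0, y) = (betaMeasure α β).real univ * k (0, 0, y)) ∧
      ∀ F : ℝ → ℝ, Continuous F → ∀ y,
        ∫ a, ∫ b, F (a + b) * k (a, b, y) ∂powMeasure β ∂powMeasure α
          = ∫ c, F c * g (c, y) ∂powMeasure (α + β) := by
  have := isLocallyFiniteMeasure_powMeasure hα
  have := isLocallyFiniteMeasure_powMeasure hβ
  have := isLocallyFiniteMeasure_powMeasure (add_pos hα hβ)
  have := isFiniteMeasure_betaMeasure hα hβ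
  obtain ⟨R, hR1, hR⟩ := hk.exists_radius
  have hae : (betaMeasure α β).restrict (Icc 0 1) = betaMeasure α β :=
    Measure.restrict_eq_self_of_ae_mem
      ((betaMeasure_compl α β).mono fun w hw => Ioo_subset_Icc_self hw)
  have hseg : ContDiff ℝ ∞ fun q : ℝ × ℝ × P => (q.2.1 * q.1, q.2.1 * (1 - q.1), q.2.2) := by
    have h1 : ContDiff ℝ ∞ fun q : ℝ × ℝ × P => q.2.1 := contDiff_fst.comp contDiff_snd
    exact (h1.mul contDiff_fst).prodMk ((h1.mul (contDiff_const.sub contDiff_fst)).prodMk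
      (contDiff_snd.comp contDiff_snd))
  have hzero : ∀ c y w, 2 * R < ‖((c, y) : ℝ × P)‖ → k (c * w, c * (1 - w), y) = 0 := by
    intro c y w h
    refine hR _ ?_
    simp only [Prod.norm_def, lt_max_iff, Real.norm_eq_abs] at h ⊢
    rcases h with h | h
    · have h1 : |c| ≤ |c * w| + |c * (1 - w)| := by
        calc |c| = |c * w + c * (1 - w)| := by congr 1; ring
          _ ≤ _ := abs_add_le _ _
      by_contra! hcon
      linarith [hcon.1, hcon.2.1]
    · exact Or.inr (Or.inr (by linarith))
  refine ⟨fun p => ∫ w in Icc (0 : ℝ) 1, k (p.1 * w, p.1 * (1 - w), p.2) ∂betaMeasure α β,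
    ⟨contDiff_setIntegral_param (E := ℝ × P) (betaMeasure α β) isCompact_Icc
      (hk.smooth.comp hseg), 2 * R, fun p hp => ?_⟩, fun y => ?_, fun F hF y => ?_⟩
  · simp only [hzero p.1 p.2 _ hp, integral_zero]
  · simp [hae]
  · rw [← integral_prod_of_isTest (powMeasure α) (powMeasure β) (hk.slice y)
      (F := fun z => F (z.1 + z.2)) (hF.comp (continuous_fst.add continuous_snd)),
      integral_prod_powMeasure_eq_beta]
    -- The integrand has no compact support in `w` by itself. The bump supplies one, and equals `1`
    -- on `(0, 1)`, where the beta measure lives.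
    have hG : IsTest fun z : ℝ × ℝ => bump z.2 * k (z.1 * z.2, z.1 * (1 - z.2), y) := by
      refine ⟨(contDiff_bump.comp contDiff_snd).mul (hk.smooth.comp
        (hseg.comp (contDiff_snd.prodMk (contDiff_fst.prodMk contDiff_const)))),
        max 2 (2 * R), fun z hz => ?_⟩
      rw [Prod.norm_def, lt_max_iff] at hz
      rcases hz with h | h
      · rw [hzero z.1 y z.2, mul_zero]
        exact (le_max_right _ _).trans_lt (h.trans_le (norm_fst_le (z.1, y)))
      · rw [bump_of_ge ((le_max_left _ _).trans h.le), zero_mul]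
    have e1 : ∀ᵐ z ∂(powMeasure (α + β)).prod (betaMeasure α β),
        F (z.1 * z.2 + z.1 * (1 - z.2)) * k (z.1 * z.2, z.1 * (1 - z.2), y)
          = F z.1 * (bump z.2 * k (z.1 * z.2, z.1 * (1 - z.2), y)) := by
      have h := Measure.ae_prod_iff_ae_ae
        (μ := powMeasure (α + β)) (ν := betaMeasure α β) (p := fun z => z.2 ∈ Ioo (0 : ℝ) 1)
        (measurable_snd measurableSet_Ioo)
      filter_upwards [h.2 (Eventually.of_forall fun _ => betaMeasure_compl α β)] with z hz
      rw [bump_of_le (by rw [abs_le]; constructor <;> linarith [hz.1, hz.2])]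
      congr 2
      · ring
      · ring
    rw [integral_congr_ae e1, integral_prod_of_isTest _ _ hG (F := fun z => F z.1)
      (hF.comp continuous_fst)]
    refine integral_congr_ae (Eventually.of_forall fun c => ?_)
    simp only [hae]
    rw [integral_const_mul]
    congr 1
    refine integral_congr_ae ?_
    filter_upwards [betaMeasure_compl α β] with w hw
    rw [bump_of_le (by rw [abs_le]; constructor <;> linarith [hw.1, hw.2]), one_mul]

/-- Only the even part of `f` in `u` contributes, and by Whitney's theorem it is a test function of
`u²`. -/
theorem exists_radial_one [FiniteDimensional ℝ P] {f : ℝ × P → ℝ} (hf : IsTest f) :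
    ∃ h : ℝ × P → ℝ, IsTest h ∧ ∀ F : ℝ → ℝ, Continuous F → ∀ y,
      ∫ u, F (u ^ 2) * f (u, y) = ∫ a, F a * h (a, y) ∂powMeasure (1 / 2) := by
  have hneg : IsTest fun p : ℝ × P => f (-p.1, p.2) :=
    hf.comp (contDiff_fst.neg.prodMk contDiff_snd) fun R => ⟨R, fun p hp => by
      simpa [Prod.norm_def] using hp⟩
  have hg : IsTest fun p : ℝ × P => (1 / 2 : ℝ) * (f p + f (-p.1, p.2)) :=
    IsTest.mul contDiff_const (hf.add hneg)
  obtain ⟨h, hh, hval⟩ := hg.exists_comp_sq (fun u y => by simp; ring)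
  refine ⟨h, hh, fun F hF y => ?_⟩
  have hi : Integrable fun u => F (u ^ 2) * f (u, y) :=
    integrable_mul_of_isTest volume (hf.slice_fst y) (F := fun u => F (u ^ 2))
      (hF.comp (continuous_pow 2))
  rw [← integral_powMeasure_half (fun a => F a * h (a, y))]
  have e1 : ∀ u, F (u ^ 2) * h (u ^ 2, y)
      = (1 / 2) * (F (u ^ 2) * f (u, y) + F ((-u) ^ 2) * f (-u, y)) := by
    intro u
    rw [← hval, neg_sq]
    ring
  simp only [e1]
  rw [integral_const_mul, integral_add hi (hi.comp_neg),
    integral_neg_eq_self (fun u => F (u ^ 2) * f (u, y)) volume]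
  ring

/-- Induction on the dimension by splitting off one coordinate. The other coordinates are radialised
with that one as an extra parameter, the single coordinate is treated by `exists_radial_one`, and
the two squared radii are merged by `exists_beta_density`. The parameter space grows by a factor
`ℝ`, so it is quantified inside the induction. -/
theorem exists_radial {p : ℕ} (hp : 1 ≤ p) :
    ∀ {P : Type} [NormedAddCommGroup P] [NormedSpace ℝ P] [FiniteDimensional ℝ P]
      {f : (Fin p → ℝ) × P → ℝ}, IsTest f →
    ∃ h : ℝ × P → ℝ, IsTest h ∧ ∀ F : ℝ → ℝ, Continuous F → ∀ y,
      ∫ u, F (∑ i, u i ^ 2) * f (u, y) = ∫ a, F a * h (a, y) ∂powMeasure ((p : ℝ) / 2) := by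
  induction p, hp using Nat.le_induction with
  | base =>
    intro P _ _ _ f hf
    obtain ⟨h, hh, hval⟩ := exists_radial_one (f := fun p : ℝ × P => f (fun _ => p.1, p.2))
      (hf.comp_equiv ((ContinuousLinearEquiv.funUnique (Fin 1) ℝ ℝ).symm.prodCongr
        (ContinuousLinearEquiv.refl ℝ P)))
    refine ⟨h, hh, fun F hF y => ?_⟩
    rw [Nat.cast_one, ← hval F hF y]
    have hmp := ((volume_preserving_funUnique (Fin 1) ℝ).symm _).integral_comp
        (MeasurableEquiv.measurableEmbedding _) fun u : Fin 1 → ℝ => F (∑ i, u i ^ 2) * f (u, y)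
    refine hmp.symm.trans (integral_congr_ae (Eventually.of_forall fun u => ?_))
    have hu : (MeasurableEquiv.funUnique (Fin 1) ℝ).symm u = fun _ => u := rfl
    simp [hu]
  | succ p hp ih =>
    intro P _ _ _ f hf
    have hα : (0 : ℝ) < (p : ℝ) / 2 := by
      have : (1 : ℝ) ≤ p := by exact_mod_cast hp
      linarith
    have hβ : (0 : ℝ) < 1 / 2 := by norm_num
    have := isLocallyFiniteMeasure_powMeasure hα
    have := isLocallyFiniteMeasure_powMeasure hβ
    set e : ((Fin p → ℝ) × ℝ × P) ≃L[ℝ] (Fin (p + 1) → ℝ) × P :=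
      ((ContinuousLinearEquiv.prodAssoc ℝ (Fin p → ℝ) ℝ P).symm.trans
        ((ContinuousLinearEquiv.prodComm ℝ (Fin p → ℝ) ℝ).prodCongr
          (ContinuousLinearEquiv.refl ℝ P))).trans
        ((Fin.consEquivL ℝ fun _ : Fin (p + 1) => ℝ).prodCongr
          (ContinuousLinearEquiv.refl ℝ P)) with he
    have hev : ∀ u s y, e (u, s, y) = (Fin.cons s u, y) := fun u s y => rfl
    have hfe := hf.comp_equiv e
    obtain ⟨h₁, hh₁, hv₁⟩ := ih hfe
    obtain ⟨h₂, hh₂, hv₂⟩ := exists_radial_one hh₁.swap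
    obtain ⟨h, hh, -, hv⟩ := exists_beta_density hα hβ hh₂.swap
    refine ⟨h, hh, fun F hF y => ?_⟩
    have e1 : ((p + 1 : ℕ) : ℝ) / 2 = (p : ℝ) / 2 + 1 / 2 := by push_cast; ring
    rw [e1, ← hv F hF y]
    have hmp := (volume_preserving_piFinSuccAbove (fun _ : Fin (p + 1) => ℝ) 0).symm
    rw [← hmp.integral_comp (MeasurableEquiv.measurableEmbedding _)]
    have hval : ∀ s (u : Fin p → ℝ),
        (MeasurableEquiv.piFinSuccAbove (fun _ : Fin (p + 1) => ℝ) 0).symm (s, u)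
          = (Fin.cons s u : Fin (p + 1) → ℝ) := fun s u => by
      simp [MeasurableEquiv.piFinSuccAbove]
      rfl
    have hint : ∀ z : ℝ × (Fin p → ℝ),
        F (∑ i, (MeasurableEquiv.piFinSuccAbove (fun _ : Fin (p + 1) => ℝ) 0).symm z i ^ 2)
          * f ((MeasurableEquiv.piFinSuccAbove (fun _ : Fin (p + 1) => ℝ) 0).symm z, y)
        = F (z.1 ^ 2 + ∑ i, z.2 i ^ 2) * f (e (z.2, z.1, y)) := by
      rintro ⟨s, u⟩
      rw [hval, hev, Fin.sum_univ_succ]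
      simp
    have hst : IsTest fun z : ℝ × (Fin p → ℝ) => f (e (z.2, z.1, y)) := hfe.swap.slice y
    have hc2 : Continuous fun u : Fin p → ℝ => ∑ i, u i ^ 2 := by fun_prop
    simp only [hint]
    rw [Measure.volume_eq_prod, integral_prod_of_isTest _ _ hst
      (F := fun z => F (z.1 ^ 2 + ∑ i, z.2 i ^ 2))
      (hF.comp ((continuous_fst.pow 2).add (hc2.comp continuous_snd)))]
    have s1 : ∀ s : ℝ, ∫ u : Fin p → ℝ, F (s ^ 2 + ∑ i, u i ^ 2) * f (e (u, s, y))
        = ∫ a, F (s ^ 2 + a) * h₁ (a, s, y) ∂powMeasure ((p : ℝ) / 2) := fun s =>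
      hv₁ (fun a => F (s ^ 2 + a)) (hF.comp (continuous_const.add continuous_id)) (s, y)
    simp only [s1]
    rw [integral_integral_swap_of_isTest volume _ (hh₁.swap.slice y)
      (F := fun z => F (z.1 ^ 2 + z.2)) (hF.comp ((continuous_fst.pow 2).add continuous_snd))]
    refine integral_congr_ae (Eventually.of_forall fun a => ?_)
    have s2 := hv₂ (fun b => F (b + a)) (hF.comp (continuous_id.add continuous_const)) (a, y)
    simp only at s2 ⊢
    rw [s2]
    simp only [add_comm]

end Radial

end

end OrbitalMean


namespace OrbitalMean

noncomputable section

/-! ### Quadratic forms in the two squared radii -/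

section Split

variable {P : Type} [NormedAddCommGroup P] [NormedSpace ℝ P]

/-- The identification of `ℝ^p × ℝ^q` with `Space p q`. -/
def splitEquiv (p q : ℕ) : ((Fin p → ℝ) × (Fin q → ℝ)) ≃L[ℝ] Space p q :=
  LinearEquiv.toContinuousLinearEquiv
    { toFun := fun w => WithLp.toLp 2 (Fin.append w.1 w.2)
      invFun := fun x => (fun i => x (Fin.castAdd q i), fun j => x (Fin.natAdd p j))
      map_add' := fun w w' => by
        ext i
        refine Fin.addCases (fun i => ?_) (fun i => ?_) i <;> simp
      map_smul' := fun c w => by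
        ext i
        refine Fin.addCases (fun i => ?_) (fun i => ?_) i <;> simp
      left_inv := fun w => by ext i <;> simp
      right_inv := fun x => by
        ext i
        refine Fin.addCases (fun i => ?_) (fun i => ?_) i <;> simp }

theorem splitEquiv_castAdd {p q : ℕ} (w : (Fin p → ℝ) × (Fin q → ℝ)) (i : Fin p) :
    splitEquiv p q w (Fin.castAdd q i) = w.1 i := by
  simp [splitEquiv]

theorem splitEquiv_natAdd {p q : ℕ} (w : (Fin p → ℝ) × (Fin q → ℝ)) (j : Fin q) :
    splitEquiv p q w (Fin.natAdd p j) = w.2 j := by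
  simp [splitEquiv]

theorem measurePreserving_splitEquiv (p q : ℕ) :
    MeasurePreserving (splitEquiv p q) volume volume := by
  have h1 := (volume_measurePreserving_sumPiEquivProdPi fun _ : Fin p ⊕ Fin q => ℝ).symm
  have h2 := volume_measurePreserving_piCongrLeft (fun _ : Fin (p + q) => ℝ)
    (finSumFinEquiv (m := p) (n := q))
  have h3 := (EuclideanSpace.volume_preserving_symm_measurableEquiv_toLp (Fin (p + q))).symm
  have h4 := (h3.comp h2).comp h1
  suffices hfun : (splitEquiv p q : (Fin p → ℝ) × (Fin q → ℝ) → Space p q) =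
      (⇑(MeasurableEquiv.toLp 2 (Fin (p + q) → ℝ)).symm.symm ∘
        ⇑(MeasurableEquiv.piCongrLeft (fun _ => ℝ) finSumFinEquiv)) ∘
      ⇑(MeasurableEquiv.sumPiEquivProdPi fun _ => ℝ).symm by
    rw [hfun]
    exact h4
  funext w
  ext i
  refine Fin.addCases (fun i => ?_) (fun i => ?_) i
  · rw [splitEquiv_castAdd]
    have e1 : Fin.castAdd q i = finSumFinEquiv (Sum.inl i) := rfl
    simp only [Function.comp, MeasurableEquiv.symm_symm, MeasurableEquiv.coe_toLp, e1]
    rw [MeasurableEquiv.piCongrLeft_apply_apply]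
    rfl
  · rw [splitEquiv_natAdd]
    have e1 : Fin.natAdd p i = finSumFinEquiv (Sum.inr i) := rfl
    simp only [Function.comp, MeasurableEquiv.symm_symm, MeasurableEquiv.coe_toLp, e1]
    rw [MeasurableEquiv.piCongrLeft_apply_apply]
    rfl

theorem integral_splitEquiv {p q : ℕ} (G : Space p q → ℝ) :
    ∫ x, G x = ∫ w, G (splitEquiv p q w) :=
  ((measurePreserving_splitEquiv p q).integral_comp
    (splitEquiv p q).toHomeomorph.measurableEmbedding G).symm

theorem quadForm_splitEquiv {p q : ℕ} (w : (Fin p → ℝ) × (Fin q → ℝ)) :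
    quadForm p q (splitEquiv p q w) = ∑ i, w.1 i ^ 2 - ∑ j, w.2 j ^ 2 := by
  simp only [quadForm, splitEquiv_castAdd, splitEquiv_natAdd]

theorem contDiff_quadForm (p q : ℕ) : ContDiff ℝ ∞ (quadForm p q) := by
  unfold quadForm
  fun_prop

theorem half_pos_of_one_le {p : ℕ} (hp : 1 ≤ p) : (0 : ℝ) < (p : ℝ) / 2 := by
  have : (1 : ℝ) ≤ p := by exact_mod_cast hp
  linarith

/-- Means relative to a quadratic form reduce to functions of two variables. -/
theorem exists_radial_pair [FiniteDimensional ℝ P] {p q : ℕ} (hp : 1 ≤ p) (hq : 1 ≤ q)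
    {f : Space p q × P → ℝ} (hf : IsTest f) :
    ∃ h : ℝ × ℝ × P → ℝ, IsTest h ∧ ∀ F : ℝ → ℝ, Continuous F → ∀ y,
      ∫ x, F (quadForm p q x) * f (x, y)
        = ∫ a, ∫ b, F (a - b) * h (a, b, y) ∂powMeasure ((q : ℝ) / 2)
            ∂powMeasure ((p : ℝ) / 2) := by
  have := isLocallyFiniteMeasure_powMeasure (half_pos_of_one_le hp)
  have := isLocallyFiniteMeasure_powMeasure (half_pos_of_one_le hq)
  have hf1 : IsTest fun z : (Fin p → ℝ) × (Fin q → ℝ) × P => f (splitEquiv p q (z.1, z.2.1), z.2.2) :=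
    hf.comp_equiv ((ContinuousLinearEquiv.prodAssoc ℝ (Fin p → ℝ) (Fin q → ℝ) P).symm.trans
      ((splitEquiv p q).prodCongr (ContinuousLinearEquiv.refl ℝ P)))
  obtain ⟨h₁, hh₁, hv₁⟩ := exists_radial hp hf1
  obtain ⟨h₂, hh₂, hv₂⟩ := exists_radial hq hh₁.swap
  refine ⟨_, hh₂.swap, fun F hF y => ?_⟩
  have hcp : ∀ n : ℕ, Continuous fun u : Fin n → ℝ => ∑ i, u i ^ 2 := fun n => by fun_prop
  rw [integral_splitEquiv, Measure.volume_eq_prod]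
  simp only [quadForm_splitEquiv]
  rw [integral_prod_of_isTest _ _ (hf1.slice y)
    (F := fun w => F (∑ i, w.1 i ^ 2 - ∑ j, w.2 j ^ 2))
    (hF.comp (((hcp p).comp continuous_fst).sub ((hcp q).comp continuous_snd))),
    integral_integral_swap_of_isTest _ _ (hf1.slice y)
    (F := fun w => F (∑ i, w.1 i ^ 2 - ∑ j, w.2 j ^ 2))
    (hF.comp (((hcp p).comp continuous_fst).sub ((hcp q).comp continuous_snd)))]
  have s1 : ∀ v : Fin q → ℝ, ∫ u : Fin p → ℝ, F (∑ i, u i ^ 2 - ∑ j, v j ^ 2)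
      * f (splitEquiv p q (u, v), y)
      = ∫ a, F (a - ∑ j, v j ^ 2) * h₁ (a, v, y) ∂powMeasure ((p : ℝ) / 2) := fun v =>
    hv₁ (fun a => F (a - ∑ j, v j ^ 2)) (hF.comp (continuous_id.sub continuous_const)) (v, y)
  simp only [s1]
  rw [← integral_integral_swap_of_isTest _ volume (hh₁.slice y)
    (F := fun w => F (w.1 - ∑ j, w.2 j ^ 2))
    (hF.comp (continuous_fst.sub ((hcp q).comp continuous_snd)))]
  refine integral_congr_ae (Eventually.of_forall fun a => ?_)
  exact hv₂ (fun b => F (a - b)) (hF.comp (continuous_const.sub continuous_id)) (a, y)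

/-- Polar coordinates: the constant is `p` times the volume of the unit ball, halved because `a =
r²` turns `r^(p-1) dr` into `½ a^(p/2-1) da`. -/
theorem exists_integral_sq_eq {p : ℕ} (hp : 1 ≤ p) : ∃ c : ℝ, 0 < c ∧ ∀ G : ℝ → ℝ,
    ∫ u : Fin p → ℝ, G (∑ i, u i ^ 2) = c * ∫ a, G a ∂powMeasure ((p : ℝ) / 2) := by
  have : Nonempty (Fin p) := ⟨⟨0, hp⟩⟩
  have : Nontrivial (EuclideanSpace ℝ (Fin p)) := inferInstance
  have hp0 : (0 : ℝ) < p := by exact_mod_cast hp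
  have hball : 0 < (volume : Measure (EuclideanSpace ℝ (Fin p))).real (Metric.ball 0 1) :=
    ENNReal.toReal_pos (Metric.measure_ball_pos volume _ one_pos).ne' measure_ball_lt_top.ne
  refine ⟨(p : ℝ) * (volume : Measure (EuclideanSpace ℝ (Fin p))).real (Metric.ball 0 1) / 2,
    by positivity, fun G => ?_⟩
  have h1 := (EuclideanSpace.volume_preserving_symm_measurableEquiv_toLp (Fin p)).integral_comp
    (MeasurableEquiv.measurableEmbedding _) fun u : Fin p → ℝ => G (∑ i, u i ^ 2)
  have h2 := integral_fun_norm_addHaar (volume : Measure (EuclideanSpace ℝ (Fin p)))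
    fun r => G (r ^ 2)
  have h3 : ∀ x : EuclideanSpace ℝ (Fin p),
      G (∑ i, ((MeasurableEquiv.toLp 2 (Fin p → ℝ)).symm x) i ^ 2) = G (‖x‖ ^ 2) := by
    intro x
    rw [EuclideanSpace.norm_sq_eq]
    simp
  rw [← h1]
  simp only [h3]
  rw [h2, integral_powMeasure,
    ← integral_comp_rpow_Ioi (fun a => a ^ ((p : ℝ) / 2 - 1) * G a) (two_ne_zero (α := ℝ)),
    finrank_euclideanSpace, Fintype.card_fin]
  have h4 : ∫ x in Ioi (0 : ℝ), (|(2 : ℝ)| * x ^ ((2 : ℝ) - 1)) •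
      ((x ^ (2 : ℝ)) ^ ((p : ℝ) / 2 - 1) * G (x ^ (2 : ℝ)))
      = ∫ x in Ioi (0 : ℝ), 2 * (x ^ (p - 1) • G (x ^ 2)) := by
    refine setIntegral_congr_fun measurableSet_Ioi fun x hx => ?_
    have hx0 : (0 : ℝ) < x := hx
    have e1 : x * (x ^ (2 : ℝ)) ^ ((p : ℝ) / 2 - 1) = x ^ (p - 1) := by
      rw [← Real.rpow_mul hx0.le, ← Real.rpow_natCast, Nat.cast_sub hp]
      calc x * x ^ (2 * ((p : ℝ) / 2 - 1)) = x ^ (1 : ℝ) * x ^ (2 * ((p : ℝ) / 2 - 1)) := by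
            rw [Real.rpow_one]
        _ = _ := by
            rw [← Real.rpow_add hx0]
            congr 1
            push_cast
            ring
    simp only [smul_eq_mul]
    rw [← e1, show (2 : ℝ) - 1 = 1 by norm_num, Real.rpow_one, Real.rpow_two,
      abs_of_pos two_pos]
    ring
  rw [h4, integral_const_mul]
  simp only [nsmul_eq_mul, smul_eq_mul]
  ring

/-- The converse of `exists_radial_pair`: pull `h` back along the two squared norms, which are
polynomials, and divide by the constants of `exists_integral_sq_eq`. -/
theorem exists_of_radial_pair {p q : ℕ} (hp : 1 ≤ p) (hq : 1 ≤ q)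
    {h : ℝ × ℝ × P → ℝ} (hh : IsTest h) :
    ∃ f : Space p q × P → ℝ, IsTest f ∧ ∀ F : ℝ → ℝ, Continuous F → ∀ y,
      ∫ x, F (quadForm p q x) * f (x, y)
        = ∫ a, ∫ b, F (a - b) * h (a, b, y) ∂powMeasure ((q : ℝ) / 2)
            ∂powMeasure ((p : ℝ) / 2) := by
  have := isLocallyFiniteMeasure_powMeasure (half_pos_of_one_le hp)
  have := isLocallyFiniteMeasure_powMeasure (half_pos_of_one_le hq)
  obtain ⟨c, hc, hcv⟩ := exists_integral_sq_eq hp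
  obtain ⟨d, hd, hdv⟩ := exists_integral_sq_eq hq
  have hcp : ∀ n : ℕ, ContDiff ℝ ∞ fun u : Fin n → ℝ => ∑ i, u i ^ 2 := fun n => by fun_prop
  have hsq : ∀ {n : ℕ} (u : Fin n → ℝ) {R : ℝ}, 1 ≤ R → R < ‖u‖ → R < |∑ i, u i ^ 2| := by
    intro n u R hR hu
    by_contra! hle
    have h0 : ‖u‖ ≤ R := (pi_norm_le_iff_of_nonneg (by linarith)).2 fun i => by
      have h1 : u i ^ 2 ≤ ∑ i, u i ^ 2 :=
        Finset.single_le_sum (f := fun i => u i ^ 2) (fun i _ => sq_nonneg _) (Finset.mem_univ i)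
      have h2 : u i ^ 2 ≤ R := h1.trans ((le_abs_self _).trans hle)
      rw [Real.norm_eq_abs]
      by_contra! h3
      nlinarith [sq_abs (u i), abs_nonneg (u i)]
    linarith
  have hg : IsTest fun z : (Fin p → ℝ) × (Fin q → ℝ) × P =>
      h (∑ i, z.1 i ^ 2, ∑ j, z.2.1 j ^ 2, z.2.2) := by
    refine hh.comp (((hcp p).comp contDiff_fst).prodMk
      (((hcp q).comp (contDiff_fst.comp contDiff_snd)).prodMk (contDiff_snd.comp contDiff_snd)))
      fun R => ⟨max 1 R, fun z hz => ?_⟩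
    have hR : R ≤ max 1 R := le_max_right _ _
    simp only [Prod.norm_def, lt_max_iff, Real.norm_eq_abs] at hz ⊢
    rcases hz with h1 | h1 | h1
    · exact Or.inl (hR.trans_lt (hsq _ (le_max_left _ _) h1))
    · exact Or.inr (Or.inl (hR.trans_lt (hsq _ (le_max_left _ _) h1)))
    · exact Or.inr (Or.inr (hR.trans_lt h1))
  have hf := (IsTest.mul (contDiff_const (c := (c * d)⁻¹)) hg).comp_equiv
    (((splitEquiv p q).symm.prodCongr (ContinuousLinearEquiv.refl ℝ P)).trans
      (ContinuousLinearEquiv.prodAssoc ℝ (Fin p → ℝ) (Fin q → ℝ) P))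
  refine ⟨_, hf, fun F hF y => ?_⟩
  rw [integral_splitEquiv, Measure.volume_eq_prod]
  have e1 : ∀ w : (Fin p → ℝ) × (Fin q → ℝ), (((splitEquiv p q).symm.prodCongr
      (ContinuousLinearEquiv.refl ℝ P)).trans
      (ContinuousLinearEquiv.prodAssoc ℝ (Fin p → ℝ) (Fin q → ℝ) P)) (splitEquiv p q w, y)
      = (w.1, w.2, y) := by
    intro w
    simp
  simp only [quadForm_splitEquiv, e1]
  have hFc : Continuous fun w : (Fin p → ℝ) × (Fin q → ℝ) => F (∑ i, w.1 i ^ 2 - ∑ j, w.2 j ^ 2) :=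
    hF.comp (((hcp p).continuous.comp continuous_fst).sub
      ((hcp q).continuous.comp continuous_snd))
  have hint : ∀ w : (Fin p → ℝ) × (Fin q → ℝ), F (∑ i, w.1 i ^ 2 - ∑ j, w.2 j ^ 2)
      * ((c * d)⁻¹ * h (∑ i, w.1 i ^ 2, ∑ j, w.2 j ^ 2, y))
      = (c * d)⁻¹ * (F (∑ i, w.1 i ^ 2 - ∑ j, w.2 j ^ 2)
        * h (∑ i, w.1 i ^ 2, ∑ j, w.2 j ^ 2, y)) := fun w => by ring
  simp only [hint]
  rw [integral_const_mul, integral_prod_of_isTest _ _ (hg.slice y) hFc]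
  simp only
  have e2 : ∀ u : Fin p → ℝ, ∫ v : Fin q → ℝ, F (∑ i, u i ^ 2 - ∑ j, v j ^ 2)
      * h (∑ i, u i ^ 2, ∑ j, v j ^ 2, y)
      = d * ∫ b, F (∑ i, u i ^ 2 - b) * h (∑ i, u i ^ 2, b, y) ∂powMeasure ((q : ℝ) / 2) :=
    fun u => hdv fun b => F (∑ i, u i ^ 2 - b) * h (∑ i, u i ^ 2, b, y)
  simp only [e2]
  rw [integral_const_mul,
    hcv fun a => ∫ b, F (a - b) * h (a, b, y) ∂powMeasure ((q : ℝ) / 2)]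
  field_simp

end Split

end

end OrbitalMean


namespace OrbitalMean

noncomputable section

/-! ### One exponent an integer -/

section EvenExponent

variable {E P V : Type} [NormedAddCommGroup E] [NormedSpace ℝ E] [NormedAddCommGroup P]
  [NormedSpace ℝ P] [NormedAddCommGroup V] [NormedSpace ℝ V]

theorem IsTest.integral_fst [FiniteDimensional ℝ E] (μ : Measure ℝ) [IsLocallyFiniteMeasure μ]
    {k : ℝ × E → V} (hk : IsTest k) : IsTest fun e => ∫ a, k (a, e) ∂μ := by
  obtain ⟨R, hR⟩ := hk.bounded
  have h1 : ∀ e, ∫ a, k (a, e) ∂μ = ∫ a in Icc (-R) R, k (a, e) ∂μ := by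
    intro e
    rw [setIntegral_eq_integral_of_forall_compl_eq_zero]
    intro a ha
    refine hR _ (lt_of_lt_of_le ?_ (norm_fst_le (a, e)))
    by_contra! h
    exact ha (abs_le.1 h)
  refine ⟨?_, R, fun e he => ?_⟩
  · simp only [h1]
    exact contDiff_setIntegral_param μ isCompact_Icc hk.smooth
  · simp only [fun a => hR (a, e) (he.trans_le (norm_snd_le (a, e))), integral_zero]

/-- The integral of `F (a - b) h (a, b, y)` against `powMeasure α × powMeasure β`. -/
def pairIntegral (α β : ℝ) (F : ℝ → ℝ) (h : ℝ × ℝ × P → ℝ) (y : P) : ℝ :=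
  ∫ a, ∫ b, F (a - b) * h (a, b, y) ∂powMeasure β ∂powMeasure α

/-- For integral `m` the weight `b^(m-1)` is a polynomial on the whole line, so the half-line
integral is the full one minus the integral over the opposite half-line. This separates the smooth
part of the density from its singular part. -/
theorem integral_powMeasure_nat {m : ℕ} (hm : 1 ≤ m) {G : ℝ → ℝ} (hG : Continuous G)
    (hs : HasCompactSupport G) :
    ∫ b, G b ∂powMeasure m = (∫ b, b ^ (m - 1) * G b)
      - (-1) ^ (m - 1) * ∫ b, G (-b) ∂powMeasure m := by
  have hpow : ∀ H : ℝ → ℝ, ∫ b, H b ∂powMeasure m = ∫ b in Ioi (0 : ℝ), b ^ (m - 1) * H b := by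
    intro H
    rw [integral_powMeasure]
    refine setIntegral_congr_fun measurableSet_Ioi fun b hb => ?_
    rw [← Real.rpow_natCast, Nat.cast_sub hm, Nat.cast_one]
  have hi : Integrable fun b : ℝ => b ^ (m - 1) * G b :=
    ((continuous_pow _).mul hG).integrable_of_hasCompactSupport hs.mul_left
  have h1 := integral_add_compl (measurableSet_Ioi (a := (0 : ℝ))) hi
  rw [compl_Ioi] at h1
  have h2 := integral_comp_neg_Ioi (0 : ℝ) fun b => b ^ (m - 1) * G b
  rw [neg_zero] at h2
  rw [hpow, hpow, ← h1, ← h2, ← integral_const_mul]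
  have h3 : ∀ b : ℝ, (-b) ^ (m - 1) * G (-b) = (-1) ^ (m - 1) * (b ^ (m - 1) * G (-b)) := by
    intro b
    rw [neg_pow]
    ring
  simp only [h3]
  ring

/-- If the second exponent is an integer, the singular part of the mean is a power of `t`
supported on the half-line. -/
theorem pairIntegral_of_nat [FiniteDimensional ℝ P] {α : ℝ} (hα : 0 < α) {m : ℕ} (hm : 1 ≤ m)
    {h : ℝ × ℝ × P → ℝ} (hh : IsTest h) :
    ∃ ψ₀ ψ₁ : ℝ × P → ℝ, IsTest ψ₀ ∧ IsTest ψ₁ ∧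
      (∀ y, ψ₁ (0, y) = -(-1) ^ (m - 1) * (betaMeasure α m).real univ * h (0, 0, y)) ∧
      ∀ F : ℝ → ℝ, Continuous F → ∀ y, pairIntegral α m F h y
        = (∫ t, F t * ψ₀ (t, y)) + ∫ t, F t * ψ₁ (t, y) ∂powMeasure (α + m) := by
  have hm0 : (0 : ℝ) < m := by exact_mod_cast hm
  have := isLocallyFiniteMeasure_powMeasure hα
  have := isLocallyFiniteMeasure_powMeasure hm0
  have hk : IsTest fun z : ℝ × ℝ × P => (z.1 - z.2.1) ^ (m - 1) * h (z.1, z.1 - z.2.1, z.2.2) := by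
    have hs : ContDiff ℝ ∞ fun z : ℝ × ℝ × P => z.1 - z.2.1 :=
      contDiff_fst.sub (contDiff_fst.comp contDiff_snd)
    refine IsTest.mul (hs.pow _) (hh.comp (contDiff_fst.prodMk (hs.prodMk
      (contDiff_snd.comp contDiff_snd))) fun R => ⟨2 * R, fun z hz => ?_⟩)
    simp only [Prod.norm_def, lt_max_iff, Real.norm_eq_abs] at hz ⊢
    by_contra! hcon
    have h0 := (abs_nonneg z.1).trans hcon.1
    rcases hz with h1 | h1 | h1
    · linarith [hcon.1]
    · have h2 : |z.2.1| ≤ |z.1| + |z.1 - z.2.1| := by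
        calc |z.2.1| = |z.1 - (z.1 - z.2.1)| := by congr 1; ring
          _ ≤ _ := abs_sub _ _
      linarith [hcon.1, hcon.2.1]
    · linarith [hcon.2.2]
  have hneg : IsTest fun z : ℝ × ℝ × P => -(-1) ^ (m - 1) * h (z.1, -z.2.1, z.2.2) :=
    IsTest.mul contDiff_const (hh.comp (contDiff_fst.prodMk
      ((contDiff_fst.comp contDiff_snd).neg.prodMk (contDiff_snd.comp contDiff_snd)))
      fun R => ⟨R, fun z hz => by simpa [Prod.norm_def] using hz⟩)
  obtain ⟨g, hg, hg0, hgv⟩ := exists_beta_density hα hm0 hneg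
  -- On the full line `t = a - b` can be taken as variable and the remaining integral over `a` is
  -- smooth in `t`. On the opposite half-line the argument of `F` becomes `a + b`, and the
  -- convolution `g` of the two power measures appears, with exponent `α + m`.
  refine ⟨fun p => ∫ a, (a - p.1) ^ (m - 1) * h (a, a - p.1, p.2) ∂powMeasure α, g,
    hk.integral_fst (E := ℝ × P) (powMeasure α), hg, fun y => ?_, fun F hF y => ?_⟩
  · rw [hg0]
    simp only [neg_zero]
    ring
  have hFadd : Continuous fun z : ℝ × ℝ => F (z.1 + z.2) :=
    hF.comp (continuous_fst.add continuous_snd)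
  have hin : ∀ a, ∫ b, F (a - b) * h (a, b, y) ∂powMeasure m
      = (∫ t, F t * ((a - t) ^ (m - 1) * h (a, a - t, y)))
        + ∫ b, F (a + b) * (-(-1) ^ (m - 1) * h (a, -b, y)) ∂powMeasure m := by
    intro a
    have hsl : IsTest fun b => h (a, b, y) := (hh.slice y).slice_snd a
    have hFa : Continuous fun b => F (a - b) := hF.comp (continuous_const.sub continuous_id)
    rw [integral_powMeasure_nat hm (G := fun b => F (a - b) * h (a, b, y))
      (hFa.mul hsl.smooth.continuous) hsl.hasCompactSupport.mul_left, sub_eq_add_neg, ← neg_mul, ← integral_const_mul,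
      ← integral_sub_left_eq_self _ volume a]
    congr 1
    · refine integral_congr_ae (Eventually.of_forall fun t => ?_)
      simp only [sub_sub_cancel]
      ring
    · refine integral_congr_ae (Eventually.of_forall fun t => ?_)
      simp only [sub_neg_eq_add]
      ring
  have hFt : Continuous fun z : ℝ × ℝ => F z.2 := hF.comp continuous_snd
  have hi1 := (integrable_mul_of_isTest ((powMeasure α).prod volume) (hk.slice y)
    hFt).integral_prod_left
  have hi2 := (integrable_mul_of_isTest ((powMeasure α).prod (powMeasure m)) (hneg.slice y)
    hFadd).integral_prod_left
  rw [pairIntegral]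
  simp only [hin]
  rw [integral_add hi1 hi2, ← hgv F hF y,
    integral_integral_swap_of_isTest _ volume (hk.slice y) hFt]
  congr 1
  refine integral_congr_ae (Eventually.of_forall fun t => ?_)
  simp only
  rw [integral_const_mul]

end EvenExponent

end

end OrbitalMean


namespace OrbitalMean

noncomputable section

/-! ### Integrals over hyperbolas: finite smoothness -/

section HyperbolicMean

set_option linter.unusedSectionVars false

variable {P V : Type} [NormedAddCommGroup P] [NormedSpace ℝ P] [NormedAddCommGroup V]
  [NormedSpace ℝ V]

/-- The integral of `f (x, z, y)` over the branch `x > 0` of the hyperbola `x z = t`, against the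
invariant measure `dx / x`. -/
def hypMean (f : ℝ × ℝ × P → V) (p : ℝ × P) : V :=
  ∫ θ, f (Real.exp θ, p.1 * Real.exp (-θ), p.2)

/-- On the support `exp θ ≤ R` and `|t| exp (-θ) ≤ R`. For `|t| ≥ δ` this confines `θ` to an
interval independent of `t`. -/
theorem hyp_eq_zero {f : ℝ × ℝ × P → V} {R δ : ℝ} (hR1 : 1 ≤ R)
    (hR : ∀ x, R < ‖x‖ → f x = 0) (hδ : 0 < δ) {p : ℝ × P} (hp : δ ≤ |p.1|) {θ : ℝ}
    (hθ : θ ∉ Icc (Real.log (δ / R)) (Real.log R)) :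
    f (Real.exp θ, p.1 * Real.exp (-θ), p.2) = 0 := by
  have hR0 : 0 < R := by linarith
  refine hR _ ?_
  simp only [Prod.norm_def, lt_max_iff, Real.norm_eq_abs, Real.abs_exp, abs_mul]
  rw [mem_Icc, not_and_or, not_le, not_le] at hθ
  rcases hθ with h | h
  · right; left
    rw [Real.lt_log_iff_exp_lt (by positivity)] at h
    rw [Real.exp_neg, ← div_eq_mul_inv, lt_div_iff₀ (Real.exp_pos _)]
    rw [lt_div_iff₀ hR0] at h
    linarith
  · left
    rwa [Real.log_lt_iff_lt_exp hR0] at h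

theorem hypMean_eq_setIntegral {f : ℝ × ℝ × P → V} {R δ : ℝ} (hR1 : 1 ≤ R)
    (hR : ∀ x, R < ‖x‖ → f x = 0) (hδ : 0 < δ) {p : ℝ × P} (hp : δ ≤ |p.1|) :
    hypMean f p = ∫ θ in Icc (Real.log (δ / R)) (Real.log R),
      f (Real.exp θ, p.1 * Real.exp (-θ), p.2) :=
  (setIntegral_eq_integral_of_forall_compl_eq_zero
    fun _ hθ => hyp_eq_zero hR1 hR hδ hp hθ).symm

theorem contDiff_hypCurve :
    ContDiff ℝ ∞ fun q : ℝ × ℝ × P => (Real.exp q.1, q.2.1 * Real.exp (-q.1), q.2.2) :=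
  (Real.contDiff_exp.comp contDiff_fst).prodMk
    (((contDiff_fst.comp contDiff_snd).mul (Real.contDiff_exp.comp contDiff_fst.neg)).prodMk
      (contDiff_snd.comp contDiff_snd))

theorem integrable_hyp {f : ℝ × ℝ × P → V} (hf : IsTest f) {p : ℝ × P} (hp : p.1 ≠ 0) :
    Integrable fun θ => f (Real.exp θ, p.1 * Real.exp (-θ), p.2) := by
  obtain ⟨R, hR1, hR⟩ := hf.exists_radius
  have hc : Continuous fun θ : ℝ => f (Real.exp θ, p.1 * Real.exp (-θ), p.2) :=
    (hf.smooth.continuous.comp contDiff_hypCurve.continuous).comp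
      (continuous_id.prodMk (continuous_const (y := p)))
  exact hc.integrable_of_hasCompactSupport (HasCompactSupport.intro
    (isCompact_Icc (a := Real.log (|p.1| / R)) (b := Real.log R))
    fun θ hθ => hyp_eq_zero hR1 hR (abs_pos.2 hp) le_rfl hθ)

theorem hypMean_add {f g : ℝ × ℝ × P → V} (hf : IsTest f) (hg : IsTest g) {p : ℝ × P}
    (hp : p.1 ≠ 0) : hypMean (fun q => f q + g q) p = hypMean f p + hypMean g p :=
  integral_add (integrable_hyp hf hp) (integrable_hyp hg hp)

theorem hypMean_sub {f g : ℝ × ℝ × P → V} (hf : IsTest f) (hg : IsTest g) {p : ℝ × P}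
    (hp : p.1 ≠ 0) : hypMean (fun q => f q - g q) p = hypMean f p - hypMean g p :=
  integral_sub (integrable_hyp hf hp) (integrable_hyp hg hp)

theorem hypMean_sum {ι : Type} {s : Finset ι} {f : ι → ℝ × ℝ × P → V}
    (hf : ∀ i ∈ s, IsTest (f i)) {p : ℝ × P} (hp : p.1 ≠ 0) :
    hypMean (fun q => ∑ i ∈ s, f i q) p = ∑ i ∈ s, hypMean (f i) p :=
  integral_finsetSum _ fun i hi => integrable_hyp (hf i hi) hp

theorem exp_mul_mul_exp_neg (θ t : ℝ) : Real.exp θ * (t * Real.exp (-θ)) = t := by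
  rw [mul_left_comm, ← Real.exp_add, add_neg_cancel, Real.exp_zero, mul_one]

/-- Functions of `x z` and `y` factor out. -/
theorem hypMean_mul (G : ℝ × P → ℝ) (f : ℝ × ℝ × P → ℝ) (p : ℝ × P) :
    hypMean (fun q => G (q.1 * q.2.1, q.2.2) * f q) p = G p * hypMean f p := by
  simp only [hypMean, exp_mul_mul_exp_neg, integral_const_mul]

/-- Near a point with `t ≠ 0` the integral runs over a fixed compact interval. -/
theorem contDiffAt_hypMean [FiniteDimensional ℝ P] {f : ℝ × ℝ × P → V} (hf : IsTest f)
    {p : ℝ × P} (hp : p.1 ≠ 0) : ContDiffAt ℝ ∞ (hypMean f) p := by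
  obtain ⟨R, hR1, hR⟩ := hf.exists_radius
  have hδ : 0 < |p.1| / 2 := by positivity
  have h1 := contDiff_setIntegral_param (E := ℝ × P) volume
    (isCompact_Icc (a := Real.log (|p.1| / 2 / R)) (b := Real.log R))
    (hf.smooth.comp contDiff_hypCurve)
  refine h1.contDiffAt.congr_of_eventuallyEq ?_
  have h2 : ∀ᶠ q : ℝ × P in 𝓝 p, |p.1| / 2 < |q.1| :=
    (continuous_abs.comp continuous_fst).continuousAt.eventually_const_lt
      (show |p.1| / 2 < |p.1| by linarith)
  filter_upwards [h2] with q hq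
  exact hypMean_eq_setIntegral hR1 hR hδ hq.le

/-- The interval of integration has length `log (R² / |t|)`. The crude bound of this logarithm by
`R² / |t|` suffices, because the powers of `t` in front are plentiful. -/
theorem exists_bound_hypMean [FiniteDimensional ℝ P] {f : ℝ × ℝ × P → V} (hf : IsTest f) :
    ∃ C : ℝ, 0 ≤ C ∧ ∀ p, |p.1| * ‖hypMean f p‖ ≤ C := by
  have : ProperSpace P := FiniteDimensional.proper ℝ P
  obtain ⟨R, hR1, hR⟩ := hf.exists_radius
  obtain ⟨M, hM0, hM⟩ := hf.exists_norm_le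
  have hR0 : 0 < R := by linarith
  refine ⟨M * R ^ 2, by positivity, fun p => ?_⟩
  rcases eq_or_ne p.1 0 with h0 | h0
  · rw [h0, abs_zero, zero_mul]; positivity
  have hp := abs_pos.2 h0
  rw [hypMean_eq_setIntegral hR1 hR hp le_rfl]
  have h1 := norm_setIntegral_le_of_norm_le_const (μ := volume)
    (s := Icc (Real.log (|p.1| / R)) (Real.log R))
    (f := fun θ => f (Real.exp θ, p.1 * Real.exp (-θ), p.2)) isCompact_Icc.measure_lt_top
    (C := M) fun θ _ => hM _
  have h2 : (volume : Measure ℝ).real (Icc (Real.log (|p.1| / R)) (Real.log R)) ≤ R ^ 2 / |p.1| := by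
    rw [Measure.real, Real.volume_Icc, ENNReal.toReal_ofReal']
    refine max_le ?_ (by positivity)
    rw [Real.log_div hp.ne' hR0.ne']
    have := Real.log_le_self (show 0 ≤ R ^ 2 / |p.1| by positivity)
    rw [Real.log_div (by positivity) hp.ne', Real.log_pow] at this
    push_cast at this
    linarith
  calc |p.1| * _ ≤ |p.1| * (M * (R ^ 2 / |p.1|)) := by
        refine mul_le_mul_of_nonneg_left (h1.trans ?_) hp.le
        exact mul_le_mul_of_nonneg_left h2 hM0
    _ = M * R ^ 2 := by field_simp

/-- The function whose hyperbolic mean is the derivative of `t ^ (n + 3) • hypMean f`, divided by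
`t ^ (n + 2)`. -/
def hypDeriv (n : ℕ) (f : ℝ × ℝ × P → V) (q : ℝ × ℝ × P) : ℝ × P →L[ℝ] V :=
  (ContinuousLinearMap.fst ℝ ℝ P).smulRight ((n + 3 : ℝ) • f q) +
    (fderiv ℝ f q).comp ((ContinuousLinearMap.inr ℝ ℝ (ℝ × P)).comp
      (q.2.1 • (ContinuousLinearMap.inl ℝ ℝ P).comp (ContinuousLinearMap.fst ℝ ℝ P) +
        (q.1 * q.2.1) • (ContinuousLinearMap.inr ℝ ℝ P).comp (ContinuousLinearMap.snd ℝ ℝ P)))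

theorem isTest_hypDeriv (n : ℕ) {f : ℝ × ℝ × P → V} (hf : IsTest f) :
    IsTest (hypDeriv n f) := by
  obtain ⟨R, hR⟩ := hf.bounded
  refine ⟨?_, R, fun q hq => ?_⟩
  · refine (contDiff_const.smulRight (hf.smooth.const_smul _)).add
      ((hf.smooth.fderiv_right (m := ∞) (by simp)).clm_comp (contDiff_const.clm_comp ?_))
    exact ((contDiff_fst.comp contDiff_snd).smul contDiff_const).add
      ((contDiff_fst.mul (contDiff_fst.comp contDiff_snd)).smul contDiff_const)
  · have h0 : f =ᶠ[𝓝 q] fun _ => 0 := by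
      filter_upwards [continuous_norm.continuousAt.eventually_const_lt hq] with x hx using hR x hx
    rw [hypDeriv, hR q hq, h0.fderiv_eq]
    simp

/-- One factor `t` is spent on making the derivative a function on the hyperbola again: `t exp (-θ)`
is `z` in the derivative along `t`, and `t` is `x z` in the derivative along the parameter. -/
theorem hasFDerivAt_hyp_integrand (n : ℕ) {f : ℝ × ℝ × P → V} (hf : IsTest f) (θ : ℝ)
    (p : ℝ × P) :
    HasFDerivAt (fun p : ℝ × P => p.1 ^ (n + 3) • f (Real.exp θ, p.1 * Real.exp (-θ), p.2))
      (p.1 ^ (n + 2) • hypDeriv n f (Real.exp θ, p.1 * Real.exp (-θ), p.2)) p := by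
  have h1 := (hf.smooth.differentiable (by simp)
    (Real.exp θ, p.1 * Real.exp (-θ), p.2)).hasFDerivAt
  have h2 : HasFDerivAt (fun p : ℝ × P => (Real.exp θ, p.1 * Real.exp (-θ), p.2))
      ((0 : ℝ × P →L[ℝ] ℝ).prod ((Real.exp (-θ) • ContinuousLinearMap.fst ℝ ℝ P).prod
        (ContinuousLinearMap.snd ℝ ℝ P))) p :=
    (hasFDerivAt_const _ _).prodMk ((hasFDerivAt_fst.mul_const _).prodMk hasFDerivAt_snd)
  have h3 : HasFDerivAt (fun p : ℝ × P => p.1 ^ (n + 3))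
      (((n + 3 : ℕ) * p.1 ^ (n + 2)) • ContinuousLinearMap.fst ℝ ℝ P) p := by
    simpa using (hasFDerivAt_fst (𝕜 := ℝ) (p := p)).pow (n + 3)
  refine (h3.smul (h1.comp p h2)).congr_fderiv ?_
  refine ContinuousLinearMap.ext fun v => ?_
  simp only [hypDeriv, exp_mul_mul_exp_neg, _root_.add_apply, _root_.smul_apply,
    ContinuousLinearMap.smulRight_apply, ContinuousLinearMap.comp_apply,
    ContinuousLinearMap.prod_apply, ContinuousLinearMap.coe_fst', ContinuousLinearMap.coe_snd',
    ContinuousLinearMap.inl_apply, ContinuousLinearMap.inr_apply, smul_add, smul_smul, smul_eq_mul,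
    _root_.zero_apply]
  rw [add_comm, ← map_smul, ← map_smul]
  congr 1
  · congr 1
    push_cast
    ring
  · congr 1
    simp only [Prod.smul_mk, Prod.mk_add_mk, smul_eq_mul, smul_zero, mul_zero, zero_add, add_zero,
      smul_smul]
    refine Prod.ext rfl (Prod.ext ?_ ?_)
    · simp only; ring
    · simp only; rw [← pow_succ]

/-- Induction through `hypDeriv`, which keeps the shape and lowers the power of `t` by one. At `t =
0` the bound of `exists_bound_hypMean` costs one power, and the others give continuity or a zero
derivative. -/
theorem contDiff_pow_smul_hypMean [FiniteDimensional ℝ P] (n : ℕ) :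
    ∀ {V : Type} [NormedAddCommGroup V] [NormedSpace ℝ V] [CompleteSpace V]
      {f : ℝ × ℝ × P → V}, IsTest f → ContDiff ℝ n fun p => p.1 ^ (n + 2) • hypMean f p := by
  have hO : ∀ {V : Type} [NormedAddCommGroup V] [NormedSpace ℝ V] {f : ℝ × ℝ × P → V},
      IsTest f → ∀ k : ℕ, ∀ x : ℝ × P, x.1 = 0 →
        (fun p : ℝ × P => p.1 ^ (k + 2) • hypMean f p) =O[𝓝 x] fun p => ‖p - x‖ ^ (k + 1) := by
    intro V _ _ f hf k x hx
    obtain ⟨C, hC0, hC⟩ := exists_bound_hypMean hf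
    refine Asymptotics.IsBigO.of_bound C (Eventually.of_forall fun p => ?_)
    rw [norm_smul, norm_pow, norm_pow, norm_norm, Real.norm_eq_abs]
    have h1 : |p.1| ≤ ‖p - x‖ := by
      simpa [hx] using norm_fst_le (p - x)
    calc |p.1| ^ (k + 2) * ‖hypMean f p‖ = |p.1| ^ (k + 1) * (|p.1| * ‖hypMean f p‖) := by ring
      _ ≤ ‖p - x‖ ^ (k + 1) * C :=
        mul_le_mul (pow_le_pow_left₀ (abs_nonneg _) h1 _) (hC p) (by positivity) (by positivity)
      _ = _ := mul_comm _ _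
  induction n with
  | zero =>
    intro V _ _ _ f hf
    rw [Nat.cast_zero, contDiff_zero, continuous_iff_continuousAt]
    intro x
    rcases eq_or_ne x.1 0 with h0 | h0
    · have h2 : Tendsto (fun p : ℝ × P => ‖p - x‖ ^ (0 + 1)) (𝓝 x) (𝓝 0) := by
        have : Continuous fun p : ℝ × P => ‖p - x‖ ^ (0 + 1) := by fun_prop
        simpa using this.tendsto x
      have h1 := (hO hf 0 x h0).trans_tendsto h2
      rw [ContinuousAt]
      convert h1 using 2
      simp [h0]
    · exact ((continuous_fst.pow _).continuousAt).smul (contDiffAt_hypMean hf h0).continuousAt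
  | succ n ih =>
    intro V _ _ _ f hf
    rw [Nat.cast_add, Nat.cast_one]
    refine (contDiff_succ_iff_hasFDerivAt (𝕜 := ℝ)).2 ⟨fun p => p.1 ^ (n + 2) • hypMean (hypDeriv n f) p,
      ih (isTest_hypDeriv n hf), fun x => ?_⟩
    rcases eq_or_ne x.1 0 with h0 | h0
    · have h1 := Asymptotics.IsBigO.hasFDerivAt (𝕜 := ℝ) (hO hf (n + 1) x h0)
        (show 1 < n + 1 + 1 by omega)
      refine h1.congr_fderiv ?_
      simp [h0]
    · obtain ⟨R, hR1, hR⟩ := hf.exists_radius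
      obtain ⟨S, hS1, hS⟩ := (isTest_hypDeriv n hf).exists_radius
      have hKR : ∀ z, max R S < ‖z‖ → f z = 0 := fun z hz => hR z ((le_max_left _ _).trans_lt hz)
      have hKS : ∀ z, max R S < ‖z‖ → hypDeriv n f z = 0 :=
        fun z hz => hS z ((le_max_right _ _).trans_lt hz)
      have hK1 : 1 ≤ max R S := hR1.trans (le_max_left _ _)
      have hδ : 0 < |x.1| / 2 := by positivity
      have hs : ContDiff ℝ ∞ fun q : ℝ × ℝ × P =>
          q.2.1 ^ (n + 3) • f (Real.exp q.1, q.2.1 * Real.exp (-q.1), q.2.2) :=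
        ((contDiff_fst.comp contDiff_snd).pow _).smul (hf.smooth.comp contDiff_hypCurve)
      have h1 := hasFDerivAt_setIntegral_param (E := ℝ × P) volume
        (isCompact_Icc (a := Real.log (|x.1| / 2 / max R S)) (b := Real.log (max R S))) hs x
      have h2 : ∀ θ, (fderiv ℝ (fun q : ℝ × ℝ × P =>
          q.2.1 ^ (n + 3) • f (Real.exp q.1, q.2.1 * Real.exp (-q.1), q.2.2)) (θ, x)).comp
            (ContinuousLinearMap.inr ℝ ℝ (ℝ × P))
          = x.1 ^ (n + 2) • hypDeriv n f (Real.exp θ, x.1 * Real.exp (-θ), x.2) := fun θ =>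
        (((hs.differentiable (by simp) (θ, x)).hasFDerivAt).comp x
          (hasFDerivAt_prodMk_right θ x)).unique (hasFDerivAt_hyp_integrand n hf θ x)
      simp only [h2, integral_smul] at h1
      rw [← hypMean_eq_setIntegral hK1 hKS hδ (by linarith)] at h1
      refine h1.congr_of_eventuallyEq ?_
      have h3 : ∀ᶠ q : ℝ × P in 𝓝 x, |x.1| / 2 < |q.1| :=
        (continuous_abs.comp continuous_fst).continuousAt.eventually_const_lt
          (show |x.1| / 2 < |x.1| by linarith)
      filter_upwards [h3] with q hq
      rw [hypMean_eq_setIntegral hK1 hKR hδ hq.le]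

end HyperbolicMean

end

end OrbitalMean


namespace OrbitalMean

noncomputable section

/-! ### Model hyperbolic integrals: a smooth case and the logarithm -/

section HyperbolicSmooth

set_option linter.unusedSectionVars false

variable {P : Type} [NormedAddCommGroup P] [NormedSpace ℝ P]

theorem integral_comp_exp (F : ℝ → ℝ) :
    ∫ θ, F (Real.exp θ) = ∫ x in Ioi (0 : ℝ), x⁻¹ * F x := by
  rw [← Real.range_exp, ← image_univ, integral_image_eq_integral_abs_deriv_smul MeasurableSet.univ
    (fun x _ => (Real.hasDerivAt_exp x).hasDerivWithinAt) Real.exp_injective.injOn,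
    Measure.restrict_univ]
  refine integral_congr_ae (Eventually.of_forall fun θ => ?_)
  simp only [Real.abs_exp, smul_eq_mul]
  rw [← mul_assoc, mul_inv_cancel₀ (Real.exp_pos θ).ne', one_mul]

theorem ext_of_mul_ne_zero {V : Type} [NormedAddCommGroup V] [NormedSpace ℝ V]
    {f g : ℝ × ℝ × P → V} (hf : Continuous f) (hg : Continuous g)
    (h : ∀ x z y, x ≠ 0 → z ≠ 0 → f (x, z, y) = g (x, z, y)) : f = g := by
  refine eq_of_eq_of_ne hf hg fun x e hx => ?_
  exact congrFun (eq_of_eq_of_ne (f := fun e => f (x, e)) (g := fun e => g (x, e))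
    (hf.comp (continuous_const.prodMk continuous_id))
    (hg.comp (continuous_const.prodMk continuous_id)) fun z y hz => h x z y hx hz) e

/-- Expansions are identities for `t ≠ 0` only; continuity extends the resulting support bounds to
`t = 0`. -/
theorem isTest_of_ne {V : Type} [NormedAddCommGroup V] [NormedSpace ℝ V] {g : ℝ × P → V}
    (hg : ContDiff ℝ ∞ g) {R : ℝ} (h : ∀ t y, t ≠ 0 → R < ‖((t, y) : ℝ × P)‖ → g (t, y) = 0) :
    IsTest g := by
  refine ⟨hg, max R 0, ?_⟩
  rintro ⟨t, y⟩ hty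
  rcases eq_or_ne t 0 with rfl | ht
  · rw [Prod.norm_def, norm_zero, max_eq_right (norm_nonneg y)] at hty
    refine eq_at_zero_of_eq_of_ne (continuous_slice hg.continuous y) continuous_const fun t ht => ?_
    exact h t y ht (((le_max_left _ _).trans_lt hty).trans_le (norm_snd_le (t, y)))
  · exact h t y ht ((le_max_left _ _).trans_lt hty)

theorem isTest_mul_bump {g : ℝ × P → ℝ} (hg : IsTest g) :
    IsTest fun q : ℝ × ℝ × P => g (q.1, q.2.2) * bump q.2.1 := by
  obtain ⟨R, hR⟩ := hg.bounded
  refine ⟨(hg.smooth.comp (contDiff_fst.prodMk (contDiff_snd.comp contDiff_snd))).mul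
    (contDiff_bump.comp (contDiff_fst.comp contDiff_snd)), max R 2, fun q hq => ?_⟩
  simp only [Prod.norm_def, lt_max_iff, Real.norm_eq_abs] at hq
  rcases hq with h | h | h
  · rw [hR _ (by rw [Prod.norm_def]; exact lt_max_of_lt_left ((le_max_left _ _).trans_lt h)),
      zero_mul]
  · rw [bump_of_ge ((le_max_right _ _).trans h.le), mul_zero]
  · rw [hR _ (by rw [Prod.norm_def]; exact lt_max_of_lt_right ((le_max_left _ _).trans_lt h)),
      zero_mul]

/-- The measure with density `1 - bump (1 / s)`. -/
def tailMeasure : Measure ℝ := volume.withDensity fun s => ENNReal.ofReal (1 - bump s⁻¹)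

theorem tailMeasure_le : tailMeasure ≤ volume := by
  conv_rhs => rw [← withDensity_one (μ := (volume : Measure ℝ))]
  refine withDensity_mono (Eventually.of_forall fun s => ?_)
  exact ENNReal.ofReal_le_one.2 (by linarith [bump_nonneg s⁻¹])

instance : IsLocallyFiniteMeasure tailMeasure :=
  MeasureTheory.Measure.isLocallyFiniteMeasure_of_le tailMeasure_le

theorem measurable_tail : Measurable fun s : ℝ => ENNReal.ofReal (1 - bump s⁻¹) :=
  (measurable_const.sub (contDiff_bump.continuous.measurable.comp measurable_inv)).ennreal_ofReal

/-- For `s > 1` the value `bump s⁻¹` is `1`, so the density vanishes and only the compact interval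
`[0, 1]` matters. -/
theorem integral_tailMeasure (F : ℝ → ℝ) :
    ∫ s in Icc (0 : ℝ) 1, F s ∂tailMeasure = ∫ s in Ioi (0 : ℝ), F s * (1 - bump s⁻¹) := by
  rw [tailMeasure, setIntegral_withDensity_eq_setIntegral_toReal_smul measurable_tail
    (Eventually.of_forall fun _ => ENNReal.ofReal_lt_top) _ measurableSet_Icc]
  have h1 : ∀ s : ℝ, (ENNReal.ofReal (1 - bump s⁻¹)).toReal • F s = F s * (1 - bump s⁻¹) := by
    intro s
    rw [ENNReal.toReal_ofReal (by linarith [bump_le_one s⁻¹]), smul_eq_mul, mul_comm]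
  simp only [h1]
  rw [integral_Icc_eq_integral_Ioc]
  refine (setIntegral_eq_of_subset_of_forall_sdiff_eq_zero measurableSet_Ioi Ioc_subset_Ioi_self
    fun s hs => ?_).symm
  have hs1 : 1 < s := by
    by_contra! h
    exact hs.2 ⟨hs.1, h⟩
  rw [bump_of_le, sub_self, mul_zero]
  rw [abs_inv, abs_of_pos (by linarith)]
  exact inv_le_one_of_one_le₀ hs1.le

/-- The hyperbolic mean of an even function of `x` vanishing at the origin is smooth. -/
theorem exists_hypMean_mul_bump [FiniteDimensional ℝ P] {g : ℝ × P → ℝ} (hg : IsTest g)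
    (heven : ∀ x y, g (-x, y) = g (x, y)) (h0 : ∀ y, g (0, y) = 0) :
    ∃ A : ℝ × P → ℝ, ContDiff ℝ ∞ A ∧ ∀ t y, t ≠ 0 →
      hypMean (fun q : ℝ × ℝ × P => g (q.1, q.2.2) * bump q.2.1) (t, y) = A (t, y) := by
  have hk := isTest_hadamard hg h0
  set k := hadamard g with hkdef
  have hgk : ∀ x y, g (x, y) = x * k (x, y) := fun x y => by
    rw [eq_add_smul_hadamard hg.smooth x y, h0, zero_add, smul_eq_mul]
  have hodd : ∀ x y, x ≠ 0 → k (-x, y) = -k (x, y) := fun x y hx => by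
    have h1 := heven x y
    rw [hgk, hgk] at h1
    have h2 : x * (k (-x, y) + k (x, y)) = 0 := by linarith
    linarith [(mul_eq_zero.1 h2).resolve_left hx]
  -- With `g = x k` the mean is `∫ k(x) bump (t/x) dx` over `x > 0`. Replacing the bump by `1` gives
  -- a function of the parameter alone, and the substitution `x = |t| s` shows that the defect is
  -- `t` times a smooth function.
  refine ⟨fun p => (∫ x, k (x, p.2) ∂(volume.restrict (Ioi 0)))
    - p.1 * ∫ s in Icc (0 : ℝ) 1, k (p.1 * s, p.2) ∂tailMeasure, ?_, fun t y ht => ?_⟩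
  · refine ((IsTest.integral_fst (volume.restrict (Ioi 0)) hk).smooth.comp contDiff_snd).sub
      (contDiff_fst.mul ?_)
    refine contDiff_setIntegral_param (E := ℝ × P) tailMeasure isCompact_Icc
      (f := fun q : ℝ × ℝ × P => k (q.2.1 * q.1, q.2.2)) (hk.smooth.comp ?_)
    fun_prop
  · have hki : Integrable fun x => k (x, y) :=
      (hk.slice_fst y).smooth.continuous.integrable_of_hasCompactSupport
        (hk.slice_fst y).hasCompactSupport
    have hbc : Measurable fun x : ℝ => bump (t * x⁻¹) :=
      contDiff_bump.continuous.measurable.comp (measurable_inv.const_mul t)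
    have hki2 : Integrable fun x => k (x, y) * (1 - bump (t * x⁻¹)) := by
      refine hki.mul_bdd (c := 1) (measurable_const.sub hbc).aestronglyMeasurable
        (Eventually.of_forall fun x => ?_)
      rw [Real.norm_eq_abs, abs_le]
      constructor <;> linarith [bump_nonneg (t * x⁻¹), bump_le_one (t * x⁻¹)]
    have h1 : hypMean (fun q : ℝ × ℝ × P => g (q.1, q.2.2) * bump q.2.1) (t, y)
        = ∫ x in Ioi (0 : ℝ), (k (x, y) - k (x, y) * (1 - bump (t * x⁻¹))) := by
      have := integral_comp_exp fun x => g (x, y) * bump (t * x⁻¹)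
      simp only [← Real.exp_neg] at this
      refine this.trans (setIntegral_congr_fun measurableSet_Ioi fun x hx => ?_)
      simp only [mem_Ioi] at hx
      simp only [hgk]
      field_simp
      ring
    rw [h1, integral_sub hki.integrableOn hki2.integrableOn]
    congr 1
    rw [integral_tailMeasure]
    have h2 := integral_comp_mul_left_Ioi (fun x => k (x, y) * (1 - bump (t * x⁻¹))) 0
      (abs_pos.2 ht)
    rw [mul_zero, smul_eq_mul] at h2
    have h3 : ∫ x in Ioi (0 : ℝ), k (x, y) * (1 - bump (t * x⁻¹))
        = |t| * ∫ s in Ioi (0 : ℝ), k (|t| * s, y) * (1 - bump (t * (|t| * s)⁻¹)) := by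
      rw [h2, ← mul_assoc, mul_inv_cancel₀ (abs_pos.2 ht).ne', one_mul]
    rw [h3, ← integral_const_mul, ← integral_const_mul]
    refine setIntegral_congr_fun measurableSet_Ioi fun s hs => ?_
    simp only [mem_Ioi] at hs
    rcases abs_choice t with h | h
    · simp only [h, mul_inv, ← mul_assoc]
      rw [mul_inv_cancel₀ ht, one_mul]
    · simp only [h, mul_inv, ← mul_assoc]
      -- For negative `t`, oddness of `k` turns `|t| k (|t| s)` into `t k (t s)`. This is where
      -- evenness of `g` enters, and without it the two sides of `t = 0` would not match.
      rw [neg_mul t s, hodd _ _ (by positivity), inv_neg, mul_neg, mul_neg, mul_inv_cancel₀ ht, neg_mul 1, one_mul,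
        bump_neg]
      ring

/-- The hyperbolic mean of a symmetric function is unchanged by exchanging the variables. -/
theorem hypMean_swap {f : ℝ × ℝ × P → ℝ} (hs : ∀ x z y, f (-x, -z, y) = f (x, z, y)) {t : ℝ}
    (ht : t ≠ 0) (y : P) :
    hypMean (fun q => f (q.2.1, q.1, q.2.2)) (t, y) = hypMean f (t, y) := by
  rw [hypMean, hypMean, ← integral_sub_left_eq_self _ volume (Real.log |t|)]
  refine integral_congr_ae (Eventually.of_forall fun θ => ?_)
  simp only [neg_sub]
  rw [Real.exp_sub, Real.exp_sub, Real.exp_log (abs_pos.2 ht), Real.exp_neg]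
  have := Real.exp_pos θ
  rcases abs_choice t with h | h
  · rw [h, mul_div_cancel₀ _ ht]
    simp [div_eq_mul_inv]
  · rw [h, ← hs]
    congr 2
    · field_simp
    · congr 1
      field_simp

/-- The hyperbolic mean of `bump x * bump z`. -/
def hypLog (t : ℝ) : ℝ := ∫ θ, bump (Real.exp θ) * bump (t * Real.exp (-θ))

theorem hypMean_mul_bump_mul_bump (G : ℝ × P → ℝ) (p : ℝ × P) :
    hypMean (fun q => G (q.1 * q.2.1, q.2.2) * (bump q.1 * bump q.2.1)) p = G p * hypLog p.1 := by
  rw [hypMean_mul]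
  rfl

/-- Put `φ θ = bump (exp θ)` and `s = log |t| ≤ 0`. The integrand is `φ(θ) φ(s - θ)`. Centred at `s
/ 2`, one factor is always `1`, so the integral is twice that of `φ` over `(s/2, ∞)`. Since `φ = 1`
on `(-∞, 0]`, this is `-s` plus a constant. -/
theorem exists_hypLog_eq : ∃ C : ℝ, ∀ t : ℝ, t ≠ 0 → |t| ≤ 1 → hypLog t = C - Real.log t := by
  have hφc : Continuous fun θ => bump (Real.exp θ) :=
    contDiff_bump.continuous.comp Real.continuous_exp
  have hφ1 : ∀ θ, θ ≤ 0 → bump (Real.exp θ) = 1 := fun θ hθ =>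
    bump_of_le (by rw [Real.abs_exp]; exact Real.exp_le_one_iff.2 hθ)
  have hφ0 : ∀ θ, 2 ≤ θ → bump (Real.exp θ) = 0 := fun θ hθ =>
    bump_of_ge (by rw [Real.abs_exp]; linarith [Real.add_one_le_exp θ])
  have hint : ∀ a, IntegrableOn (fun θ => bump (Real.exp θ)) (Ioi a) := by
    intro a
    have h1 : IntegrableOn (fun θ => bump (Real.exp θ)) (Icc a (max a 2)) :=
      hφc.integrableOn_Icc
    refine h1.of_forall_sdiff_eq_zero measurableSet_Ioi fun θ hθ => hφ0 θ ?_
    by_contra! h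
    exact hθ.2 ⟨(mem_Ioi.1 hθ.1).le, h.le.trans (le_max_right _ _)⟩
  refine ⟨2 * ∫ θ in Ioi (0 : ℝ), bump (Real.exp θ), fun t ht ht1 => ?_⟩
  set s := Real.log t with hsdef
  have hs0 : s ≤ 0 := by
    rw [hsdef, ← Real.log_abs]
    exact Real.log_nonpos (abs_nonneg t) ht1
  have h1 : ∀ θ, bump (t * Real.exp (-θ)) = bump (Real.exp (s - θ)) := by
    intro θ
    rw [← bump_abs, abs_mul, Real.abs_exp, Real.exp_sub, hsdef, Real.exp_log_eq_abs ht, Real.exp_neg,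
      div_eq_mul_inv]
  have h2 : hypLog t = ∫ τ, bump (Real.exp (s / 2 + |τ|)) := by
    rw [hypLog, ← integral_add_left_eq_self _ (s / 2)]
    refine integral_congr_ae (Eventually.of_forall fun τ => ?_)
    simp only [h1]
    rw [show s - (s / 2 + τ) = s / 2 - τ by ring]
    rcases abs_cases τ with ⟨h, h'⟩ | ⟨h, h'⟩
    · rw [h, hφ1 (s / 2 - τ) (by linarith), mul_one]
    · rw [h, hφ1 (s / 2 + τ) (by linarith), one_mul, sub_eq_add_neg]
  rw [h2, integral_comp_abs (f := fun τ => bump (Real.exp (s / 2 + τ)))]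
  have h3 : ∫ τ in Ioi (0 : ℝ), bump (Real.exp (s / 2 + τ))
      = ∫ θ in Ioi (s / 2), bump (Real.exp θ) := by
    have := (measurePreserving_add_left volume (s / 2)).setIntegral_preimage_emb
      (measurableEmbedding_addLeft _) (fun θ => bump (Real.exp θ)) (Ioi (s / 2))
    simpa using this
  have h4 : ∫ θ in Ioi (s / 2), bump (Real.exp θ)
      = (∫ θ in Ioc (s / 2) 0, bump (Real.exp θ)) + ∫ θ in Ioi (0 : ℝ), bump (Real.exp θ) := by
    rw [← setIntegral_union (Ioc_disjoint_Ioi le_rfl) measurableSet_Ioi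
      ((hint _).mono_set Ioc_subset_Ioi_self) (hint 0), Ioc_union_Ioi_eq_Ioi (by linarith)]
  have h5 : ∫ θ in Ioc (s / 2) 0, bump (Real.exp θ) = -(s / 2) := by
    rw [setIntegral_congr_fun measurableSet_Ioc fun θ hθ => hφ1 θ hθ.2]
    simp
    linarith
  rw [h3, h4, h5]
  ring

/-- A third bump in a dummy real parameter makes the integrand a test function; evaluation at
parameter `0` recovers `hypLog`. -/
theorem contDiffAt_hypLog {t : ℝ} (ht : t ≠ 0) : ContDiffAt ℝ ∞ hypLog t := by
  have h1 : IsTest fun q : ℝ × ℝ × ℝ => (bump q.1 * bump q.2.2) * bump q.2.1 := by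
    refine isTest_mul_bump (g := fun p : ℝ × ℝ => bump p.1 * bump p.2) ?_
    refine ⟨(contDiff_bump.comp contDiff_fst).mul (contDiff_bump.comp contDiff_snd), 2,
      fun p hp => ?_⟩
    simp only [Prod.norm_def, lt_max_iff, Real.norm_eq_abs] at hp
    rcases hp with h | h
    · rw [bump_of_ge h.le, zero_mul]
    · rw [bump_of_ge h.le, mul_zero]
  have h2 := (contDiffAt_hypMean h1 (p := (t, 0)) ht).comp t
    (contDiffAt_id.prodMk contDiffAt_const)
  refine h2.congr_of_eventuallyEq (Eventually.of_forall fun s => ?_)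
  simp only [hypLog, hypMean, Function.comp, id, bump_of_le (t := 0) (by simp), mul_one]

/-- The regular part of `hypLog`. -/
theorem exists_hypLog_add_log : ∃ l : ℝ → ℝ, ContDiff ℝ ∞ l ∧
    ∀ t, t ≠ 0 → hypLog t = l t - Real.log |t| := by
  obtain ⟨C, hC⟩ := exists_hypLog_eq
  refine ⟨fun t => if t = 0 then C else hypLog t + Real.log t, ?_, fun t ht => ?_⟩
  · rw [contDiff_iff_contDiffAt]
    intro t
    rcases eq_or_ne t 0 with rfl | ht
    · refine (contDiffAt_const (c := C)).congr_of_eventuallyEq ?_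
      filter_upwards [Metric.ball_mem_nhds (0 : ℝ) one_pos] with s hs
      split_ifs with h
      · rfl
      · rw [hC s h (by simpa using (mem_ball_zero_iff.1 hs).le)]
        ring
    · refine ((contDiffAt_hypLog ht).add (Real.contDiffAt_log.2 ht)).congr_of_eventuallyEq ?_
      filter_upwards [eventually_ne_nhds ht] with s hs
      rw [if_neg hs]
  · simp only [if_neg ht, Real.log_abs]
    ring

end HyperbolicSmooth

end

end OrbitalMean


namespace OrbitalMean

noncomputable section

/-! ### Logarithmic expansion of hyperbolic integrals -/

section HyperbolicExpansion

set_option linter.unusedSectionVars false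

variable {P : Type} [NormedAddCommGroup P] [NormedSpace ℝ P]

/-- Test functions invariant under `(x, z) ↦ (-x, -z)`, with parameter of norm at most `S`. -/
structure IsHypTest (S : ℝ) (f : ℝ × ℝ × P → ℝ) : Prop where
  isTest : IsTest f
  symm : ∀ x z y, f (-x, -z, y) = f (x, z, y)
  support : ∀ x z y, S < ‖y‖ → f (x, z, y) = 0

theorem IsHypTest.sub {S : ℝ} {f g : ℝ × ℝ × P → ℝ} (hf : IsHypTest S f) (hg : IsHypTest S g) :
    IsHypTest S fun q => f q - g q :=
  ⟨hf.isTest.sub hg.isTest, fun x z y => by rw [hf.symm, hg.symm],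
    fun x z y h => by rw [hf.support x z y h, hg.support x z y h, sub_zero]⟩

theorem IsHypTest.add {S : ℝ} {f g : ℝ × ℝ × P → ℝ} (hf : IsHypTest S f) (hg : IsHypTest S g) :
    IsHypTest S fun q => f q + g q :=
  ⟨hf.isTest.add hg.isTest, fun x z y => by rw [hf.symm, hg.symm],
    fun x z y h => by rw [hf.support x z y h, hg.support x z y h, add_zero]⟩

theorem IsHypTest.swap {S : ℝ} {f : ℝ × ℝ × P → ℝ} (hf : IsHypTest S f) :
    IsHypTest S fun q => f (q.2.1, q.1, q.2.2) :=
  ⟨IsTest.swap hf.isTest, fun x z y => hf.symm z x y, fun x z y h => hf.support z x y h⟩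

/-- Take Hadamard quotients in `x` and in `z`. Symmetry and support pass to the quotient where `x z
≠ 0`, hence everywhere by continuity. -/
theorem IsHypTest.exists_eq_mul_mul [FiniteDimensional ℝ P] {S : ℝ} {f : ℝ × ℝ × P → ℝ}
    (hf : IsHypTest S f) (h1 : ∀ z y, f (0, z, y) = 0) (h2 : ∀ x y, f (x, 0, y) = 0) :
    ∃ g, IsHypTest S g ∧ ∀ x z y, f (x, z, y) = x * z * g (x, z, y) := by
  have ht1 : IsTest (hadamard f) := isTest_hadamard hf.isTest fun e => h1 e.1 e.2
  have hd1 : ∀ x z y, f (x, z, y) = x * hadamard f (x, z, y) := fun x z y => by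
    rw [eq_add_smul_hadamard hf.isTest.smooth x (z, y), h1, zero_add, smul_eq_mul]
  have ht1' := IsTest.swap ht1
  have h0 : ∀ e : ℝ × P, hadamard f (e.1, 0, e.2) = 0 := fun e => by
    have hc : Continuous fun p : ℝ × P => hadamard f (p.1, 0, p.2) :=
      ht1.smooth.continuous.comp
        (continuous_fst.prodMk (continuous_const.prodMk continuous_snd))
    have := eq_of_eq_of_ne hc (continuous_const (y := (0 : ℝ))) fun x y hx => by
      have h3 := hd1 x 0 y
      rw [h2] at h3
      exact (mul_eq_zero.1 h3.symm).resolve_left hx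
    exact congrFun this e
  have ht2 := isTest_hadamard ht1' h0
  have hd2 : ∀ x z y, f (x, z, y) = x * z * hadamard
      (fun q : ℝ × ℝ × P => hadamard f (q.2.1, q.1, q.2.2)) (z, x, y) := fun x z y => by
    rw [hd1, eq_add_smul_hadamard ht1'.smooth z (x, y), h0 (x, y), zero_add, smul_eq_mul, mul_assoc]
  set g := fun q : ℝ × ℝ × P => hadamard
    (fun q : ℝ × ℝ × P => hadamard f (q.2.1, q.1, q.2.2)) (q.2.1, q.1, q.2.2) with hg
  have htg : IsTest g := IsTest.swap ht2
  refine ⟨g, ⟨htg, fun x z y => ?_, fun x z y hy => ?_⟩, hd2⟩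
  · have hc : Continuous fun q : ℝ × ℝ × P => g (-q.1, -q.2.1, q.2.2) :=
      htg.smooth.continuous.comp (by fun_prop)
    refine congrFun (ext_of_mul_ne_zero hc htg.smooth.continuous fun x z y hx hz => ?_) (x, z, y)
    have h3 := hf.symm x z y
    rw [hd2 (-x), hd2 x, neg_mul_neg] at h3
    exact mul_left_cancel₀ (mul_ne_zero hx hz) h3
  · have hc : Continuous fun q : ℝ × ℝ => g (q.1, q.2, y) :=
      htg.smooth.continuous.comp (by fun_prop)
    have hc' : ∀ x, Continuous fun z => g (x, z, y) := fun x => 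
      htg.smooth.continuous.comp (by fun_prop)
    have h3 : ∀ x z, x ≠ 0 → z ≠ 0 → g (x, z, y) = 0 := fun x z hx hz => by
      have h3 := hd2 x z y
      rw [hf.support x z y hy] at h3
      exact (mul_eq_zero.1 h3.symm).resolve_left (mul_ne_zero hx hz)
    refine congrFun (eq_of_eq_of_ne hc (continuous_const (y := (0 : ℝ))) fun x z hx => ?_) (x, z)
    rcases eq_or_ne z 0 with rfl | hz
    · exact eq_at_zero_of_eq_of_ne (hc' x) continuous_const fun z hz => h3 x z hx hz
    · exact h3 x z hx hz

theorem isHypTest_mul_bump {S : ℝ} {g : ℝ × P → ℝ} (hg : IsTest g)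
    (heven : ∀ x y, g (-x, y) = g (x, y)) (hS : ∀ x y, S < ‖y‖ → g (x, y) = 0) :
    IsHypTest S fun q : ℝ × ℝ × P => g (q.1, q.2.2) * bump q.2.1 :=
  ⟨isTest_mul_bump hg, fun x z y => by simp only [heven, bump_neg],
    fun x z y h => by simp only [hS x y h, zero_mul]⟩

theorem isTest_bump_mul {c : P → ℝ} (hc : IsTest c) : IsTest fun p : ℝ × P => bump p.1 * c p.2 := by
  have h : borelTerm c 0 1 = fun p : ℝ × P => bump p.1 * c p.2 := by
    funext p
    simp [borelTerm]
  exact h ▸ isTest_borelTerm hc 0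

/-- Extraction of the leading singularity of a hyperbolic mean. -/
theorem IsHypTest.exists_hypMean_eq [FiniteDimensional ℝ P] {S : ℝ} {f : ℝ × ℝ × P → ℝ}
    (hf : IsHypTest S f) :
    ∃ (A : ℝ × P → ℝ) (g : ℝ × ℝ × P → ℝ), ContDiff ℝ ∞ A ∧ IsHypTest S g ∧ ∀ t y, t ≠ 0 →
      hypMean f (t, y) = f (0, 0, y) * hypLog t + A (t, y) + t * hypMean g (t, y) := by
  set c : P → ℝ := fun y => f (0, 0, y) with hcdef
  have hc : IsTest c := (hf.isTest.slice_snd 0).slice_snd 0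
  have hcS : ∀ y, S < ‖y‖ → c y = 0 := fun y hy => hf.support 0 0 y hy
  -- The restriction of `k` to the axis `z = 0`, corrected to vanish at the origin. Applied to `f`
  -- and to its swap it gives `gx` and `gz`. Subtracting `gx bump(z) + gz bump(x) + c bump(x)
  -- bump(z)` makes `f` vanish on both axes, leaving a multiple of `x z = t`.
  have key : ∀ k : ℝ × ℝ × P → ℝ, IsHypTest S k → (∀ y, k (0, 0, y) = c y) →
      ∃ gx : ℝ × P → ℝ, IsTest gx ∧ (∀ x y, gx (-x, y) = gx (x, y)) ∧ (∀ y, gx (0, y) = 0) ∧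
        (∀ x y, S < ‖y‖ → gx (x, y) = 0) ∧ ∀ x y, k (x, 0, y) = gx (x, y) + bump x * c y := by
    intro k hk hkc
    refine ⟨fun p => k (p.1, 0, p.2) - bump p.1 * c p.2, ?_, fun x y => ?_, fun y => ?_,
      fun x y hy => ?_, fun x y => ?_⟩
    · refine IsTest.sub (IsTest.slice_snd (f := fun q : ℝ × ℝ × P => k (q.2.1, q.1, q.2.2))
        (IsTest.swap hk.isTest) 0) (isTest_bump_mul hc)
    · have := hk.symm x 0 y
      rw [neg_zero] at this
      simp only [this, bump_neg]
    · simp only [hkc, bump_of_le (t := 0) (by simp), one_mul, sub_self]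
    · simp only [hk.support _ _ _ hy, hcS y hy, mul_zero, sub_self]
    · simp only [sub_add_cancel]
  obtain ⟨gx, hgx, hgxe, hgx0, hgxS, hgxk⟩ := key f hf fun y => rfl
  obtain ⟨gz, hgz, hgze, hgz0, hgzS, hgzk⟩ := key _ hf.swap fun y => rfl
  simp only at hgzk
  have hB : IsHypTest S fun q : ℝ × ℝ × P => c q.2.2 * (bump q.1 * bump q.2.1) := by
    have := isHypTest_mul_bump (S := S) (isTest_bump_mul hc) (fun x y => by simp only [bump_neg])
      (fun x y hy => by simp only [hcS y hy, mul_zero])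
    refine Eq.mp ?_ this
    congr 1
    funext q
    ring
  have hX := isHypTest_mul_bump hgx hgxe hgxS
  have hZ := (isHypTest_mul_bump hgz hgze hgzS).swap
  have hE := (hX.add hZ).add hB
  obtain ⟨g, hg, hgD⟩ := (hf.sub hE).exists_eq_mul_mul
    (fun z y => by
      simp only [hgx0, hgzk, bump_of_le (t := 0) (by simp)]
      ring)
    (fun x y => by
      simp only [hgz0, hgxk, bump_of_le (t := 0) (by simp)]
      ring)
  obtain ⟨A, hA, hAe⟩ := exists_hypMean_mul_bump hgx hgxe hgx0
  obtain ⟨A', hA', hAe'⟩ := exists_hypMean_mul_bump hgz hgze hgz0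
  refine ⟨fun p => A p + A' p, g, hA.add hA', hg, fun t y ht => ?_⟩
  have h1 : f = fun q => (gx (q.1, q.2.2) * bump q.2.1 + gz (q.2.1, q.2.2) * bump q.1
      + c q.2.2 * (bump q.1 * bump q.2.1)) + q.1 * q.2.1 * g q := by
    funext ⟨x, z, y⟩
    have := hgD x z y
    simp only at this
    linarith
  have hxz : IsTest fun q : ℝ × ℝ × P => q.1 * q.2.1 * g q :=
    IsTest.mul (contDiff_fst.mul (contDiff_fst.comp contDiff_snd)) hg.isTest
  refine (congrArg (fun k => hypMean k (t, y)) h1).trans ?_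
  simp only
  rw [hypMean_add hE.isTest hxz ht, hypMean_add (hX.add hZ).isTest hB.isTest ht,
    hypMean_add hX.isTest hZ.isTest ht, hAe t y ht,
    hypMean_swap (f := fun q : ℝ × ℝ × P => gz (q.1, q.2.2) * bump q.2.1)
      (isHypTest_mul_bump hgz hgze hgzS).symm ht, hAe' t y ht,
    hypMean_mul_bump_mul_bump (fun p => c p.2), hypMean_mul (fun p => p.1)]
  ring

theorem isTest_mul_bump_mul_bump {G : ℝ × P → ℝ} (hG : ContDiff ℝ ∞ G) {S : ℝ}
    (hS : ∀ t y, S < ‖y‖ → G (t, y) = 0) :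
    IsTest fun q : ℝ × ℝ × P => G (q.1 * q.2.1, q.2.2) * (bump q.1 * bump q.2.1) := by
  refine ⟨(hG.comp (by fun_prop)).mul ((contDiff_bump.comp contDiff_fst).mul
    (contDiff_bump.comp (contDiff_fst.comp contDiff_snd))), max S 2, fun q hq => ?_⟩
  simp only [Prod.norm_def, lt_max_iff, Real.norm_eq_abs] at hq
  rcases hq with h | h | h
  · rw [bump_of_ge ((le_max_right _ _).trans h.le)]; ring
  · rw [bump_of_ge (t := q.2.1) ((le_max_right _ _).trans h.le)]; ring
  · rw [hS _ _ ((le_max_left _ _).trans_lt h), zero_mul]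

theorem IsTest.hypMean_eq_zero {f : ℝ × ℝ × P → ℝ} (hf : IsTest f) :
    ∃ R : ℝ, ∀ t y, t ≠ 0 → R < ‖((t, y) : ℝ × P)‖ → hypMean f (t, y) = 0 := by
  obtain ⟨R, hR1, hR⟩ := hf.exists_radius
  refine ⟨R ^ 2, fun t y _ h => ?_⟩
  have h0 : ∀ θ, f (Real.exp θ, t * Real.exp (-θ), y) = 0 := by
    intro θ
    refine hR _ ?_
    by_contra! hcon
    simp only [Prod.norm_def, max_le_iff, lt_max_iff, Real.norm_eq_abs] at hcon h
    rcases h with h | h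
    · have : |t| ≤ R * R := by
        rw [← exp_mul_mul_exp_neg θ t, abs_mul]
        exact mul_le_mul hcon.1 hcon.2.1 (abs_nonneg _) (by linarith)
      nlinarith
    · nlinarith [hcon.2.2]
  simp only [hypMean, h0, integral_zero]

/-- The expansion of a hyperbolic mean. -/
theorem IsHypTest.exists_expansion [FiniteDimensional ℝ P] {S : ℝ} {f : ℝ × ℝ × P → ℝ}
    (hf : IsHypTest S f) :
    ∃ ψ₀ ψ₁ : ℝ × P → ℝ, IsTest ψ₀ ∧ IsTest ψ₁ ∧ (∀ y, ψ₁ (0, y) = -f (0, 0, y)) ∧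
      ∀ t y, t ≠ 0 → hypMean f (t, y) = ψ₀ (t, y) + Real.log |t| * ψ₁ (t, y) := by
  choose! A g hA hg hAg using fun (k : ℝ × ℝ × P → ℝ) (hk : IsHypTest S k) => hk.exists_hypMean_eq
  set fs : ℕ → ℝ × ℝ × P → ℝ := fun k => g^[k] f with hfs
  have hsucc : ∀ k, fs (k + 1) = g (fs k) := fun k => Function.iterate_succ_apply' _ _ _
  have hfk : ∀ k, IsHypTest S (fs k) := by
    intro k
    induction k with
    | zero => exact hf
    | succ k ih => rw [hsucc]; exact hg _ ih
  -- `E` is a Borel sum of the successive leading coefficients, so `E * hypLog` carries the entire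
  -- logarithmic singularity; `R N` is the exact `N`-th tail of `E`.
  obtain ⟨E, hE, R, hR, hR0, hRS, hRr⟩ := exists_borel (c := fun k y => fs k (0, 0, y)) (S := S)
    (fun k => (((hfk k).isTest.slice_snd 0).slice_snd 0).smooth)
    (fun k y hy => (hfk k).support 0 0 y hy)
  have hB : ∀ N, IsTest fun q : ℝ × ℝ × P => R N (q.1 * q.2.1, q.2.2) * (bump q.1 * bump q.2.1) :=
    fun N => isTest_mul_bump_mul_bump (hR N) (hRS N)
  set k : ℕ → ℝ × ℝ × P → ℝ := fun N q =>
    fs N q - R N (q.1 * q.2.1, q.2.2) * (bump q.1 * bump q.2.1) with hk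
  have hkt : ∀ N, IsTest (k N) := fun N => (hfk N).isTest.sub (hB N)
  have hkm : ∀ N t y, t ≠ 0 → hypMean (k N) (t, y) = hypMean (fs N) (t, y) - R N (t, y) * hypLog t :=
    fun N t y ht => by
      rw [hk, hypMean_sub (hfk N).isTest (hB N) ht, hypMean_mul_bump_mul_bump]
  -- For `t ≠ 0` every `G N` equals `hypMean f - E * hypLog`. The last term is `t ^ (N + 2)` times
  -- the hyperbolic mean of a test function, so `G N` is of class `C^N`. By continuity all the `G N`
  -- coincide, and `G 0` is smooth.
  set G : ℕ → ℝ × P → ℝ := fun N p =>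
    ∑ j ∈ Finset.range (N + 2), p.1 ^ j * A (fs j) p + p.1 ^ (N + 2) • hypMean (k (N + 2)) p with hG
  have hGN : ∀ N : ℕ, ContDiff ℝ N (G N) := fun N => by
    have h1 : ∀ j, ContDiff ℝ N fun p : ℝ × P => p.1 ^ j * A (fs j) p := fun j =>
      (((contDiff_fst (𝕜 := ℝ)).pow j).mul (hA _ (hfk j))).of_le (by exact_mod_cast le_top)
    exact (ContDiff.sum fun j _ => h1 j).add (contDiff_pow_smul_hypMean N (hkt (N + 2)))
  have hGe : ∀ N t y, t ≠ 0 → hypMean f (t, y) - E (t, y) * hypLog t = G N (t, y) := by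
    intro N t y ht
    have h1 := sum_form_of_rec (c := fun j => A (fs j) (t, y))
      (r := fun j => hypMean (fs j) (t, y) - R j (t, y) * hypLog t) (t := t) (fun j => by
        simp only [hAg _ (hfk j) t y ht, hRr j t y, hsucc]
        ring) (N + 2)
    simp only [hR0] at h1
    rw [show fs 0 = f from rfl] at h1
    rw [h1, hG]
    simp only [hkm (N + 2) t y ht, smul_eq_mul]
  have hG0 : ContDiff ℝ ∞ (G 0) := by
    refine contDiff_infty.2 fun N => ?_
    rw [eq_of_eq_of_ne (V := ℝ) (hGN 0).continuous (hGN N).continuous fun t y ht => by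
      rw [← hGe 0 t y ht, ← hGe N t y ht]]
    exact hGN N
  obtain ⟨l, hl, hle⟩ := exists_hypLog_add_log
  have hψ : ∀ t y, t ≠ 0 →
      hypMean f (t, y) = (G 0 (t, y) + l t * E (t, y)) + Real.log |t| * (-E (t, y)) := by
    intro t y ht
    have := hGe 0 t y ht
    rw [hle t ht] at this
    linarith
  refine ⟨fun p => G 0 p + l p.1 * E p, fun p => -E p, ?_, hE.neg, fun y => ?_, hψ⟩
  · obtain ⟨r, hr⟩ := hf.isTest.hypMean_eq_zero
    obtain ⟨r', hr'⟩ := hE.bounded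
    refine isTest_of_ne (R := max r r') (hG0.add ((hl.comp contDiff_fst).mul hE.smooth))
      fun t y ht h => ?_
    have h1 := hψ t y ht
    rw [hr t y ht ((le_max_left _ _).trans_lt h), hr' _ ((le_max_right _ _).trans_lt h)] at h1
    simp only [hr' _ ((le_max_right _ _).trans_lt h)]
    linarith
  · simp only [← hR0, hRr 0 0 y, zero_mul, add_zero]
    rfl

end HyperbolicExpansion

end

end OrbitalMean


namespace OrbitalMean

noncomputable section

/-! ### Hyperbolic integrals with monomial weights -/

section HyperbolicMonomial

set_option linter.unusedSectionVars false

variable {P : Type} [NormedAddCommGroup P] [NormedSpace ℝ P]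

theorem isTest_of_hypMean_eq {f : ℝ × ℝ × P → ℝ} (hf : IsTest f) {ψ₀ ψ₁ : ℝ × P → ℝ} {c : ℝ → ℝ}
    (h0 : ContDiff ℝ ∞ ψ₀) (h1 : IsTest ψ₁)
    (h : ∀ t y, t ≠ 0 → hypMean f (t, y) = ψ₀ (t, y) + c t * ψ₁ (t, y)) : IsTest ψ₀ := by
  obtain ⟨r, hr⟩ := hf.hypMean_eq_zero
  obtain ⟨r', hr'⟩ := h1.bounded
  refine isTest_of_ne (R := max r r') h0 fun t y ht hty => ?_
  have h2 := h t y ht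
  rw [hr t y ht ((le_max_left _ _).trans_lt hty), hr' _ ((le_max_right _ _).trans_lt hty)] at h2
  linarith

theorem hypMean_congr {f g : ℝ × ℝ × P → ℝ} (h : ∀ x z y, x ≠ 0 → z ≠ 0 → f (x, z, y) = g (x, z, y))
    {t : ℝ} (ht : t ≠ 0) (y : P) : hypMean f (t, y) = hypMean g (t, y) :=
  integral_congr_ae (Eventually.of_forall fun _ =>
    h _ _ _ (Real.exp_pos _).ne' (mul_ne_zero ht (Real.exp_pos _).ne'))

/-- The parity hypothesis makes `z ^ n * h` symmetric. In the induction the value of `h` at `x = 0`,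
cut off by a bump, contributes a smooth term, since its weight `z ^ (n + 1)` vanishes at `0`. The
rest of `h` is `x k` with the opposite parity, and `x z = t` factors out. Thus each power of `z`
costs a power of `t` in front of the logarithm. -/
theorem exists_expansion_pow_mul [FiniteDimensional ℝ P] (n : ℕ) :
    ∀ {h : ℝ × ℝ × P → ℝ}, IsTest h →
      (∀ x z y, h (-x, -z, y) = (-1) ^ n * h (x, z, y)) →
      ∃ ψ₀ ψ₁ : ℝ × P → ℝ, IsTest ψ₀ ∧ IsTest ψ₁ ∧ (n = 0 → ∀ y, ψ₁ (0, y) = -h (0, 0, y)) ∧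
        ∀ t y, t ≠ 0 → hypMean (fun q => q.2.1 ^ n * h q) (t, y)
          = ψ₀ (t, y) + t ^ n * Real.log |t| * ψ₁ (t, y) := by
  induction n with
  | zero =>
    intro h hh hs
    obtain ⟨S, hS⟩ := hh.bounded
    have hH : IsHypTest S h := ⟨hh, by simpa using hs, fun x z y hy => hS _ (hy.trans_le
      ((norm_snd_le (z, y)).trans (norm_snd_le (x, z, y))))⟩
    obtain ⟨ψ₀, ψ₁, h0, h1, h2, h3⟩ := hH.exists_expansion
    exact ⟨ψ₀, ψ₁, h0, h1, fun _ => h2, by simpa using h3⟩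
  | succ n ih =>
    intro h hh hs
    have hh0 : IsTest fun p : ℝ × P => h (0, p) := hh.slice_snd 0
    have hg : IsTest fun p : ℝ × P => p.1 ^ (n + 1) * h (0, p) := IsTest.mul (contDiff_fst.pow _) hh0
    have hge : ∀ (z : ℝ) (y : P), (-z) ^ (n + 1) * h (0, -z, y) = z ^ (n + 1) * h (0, z, y) := by
      intro z y
      have := hs 0 z y
      rw [neg_zero] at this
      rw [this, neg_pow, mul_mul_mul_comm, ← mul_pow]
      norm_num
    obtain ⟨A, hA, hAe⟩ := exists_hypMean_mul_bump hg (fun z y => hge z y) (fun y => by simp)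
    have hb : IsTest fun q : ℝ × ℝ × P => h (0, q.2.1, q.2.2) * bump q.1 := (isTest_mul_bump hh0).swap
    have hD : IsTest fun q : ℝ × ℝ × P => h q - h (0, q.2.1, q.2.2) * bump q.1 := hh.sub hb
    have hD0 : ∀ e : ℝ × P, h (0, e) - h (0, e.1, e.2) * bump 0 = 0 := fun e => by
      rw [bump_of_le (by simp), mul_one, sub_self]
    have hk := isTest_hadamard hD hD0
    have hkD := fun x e => eq_add_smul_hadamard hD.smooth x e
    set k := hadamard fun q : ℝ × ℝ × P => h q - h (0, q.2.1, q.2.2) * bump q.1 with hkdef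
    have hks : ∀ x z y, k (-x, -z, y) = (-1) ^ n * k (x, z, y) := by
      intro x z y
      have hc : Continuous fun q : ℝ × ℝ × P => k (-q.1, -q.2.1, q.2.2) :=
        hk.smooth.continuous.comp (by fun_prop)
      have hc' : Continuous fun q : ℝ × ℝ × P => (-1) ^ n * k q :=
        continuous_const.mul hk.smooth.continuous
      refine congrFun (ext_of_mul_ne_zero hc hc' fun x z y hx _ => ?_) (x, z, y)
      have h1 := hkD x (z, y)
      have h2 := hkD (-x) (-z, y)
      simp only [hD0 (z, y), hD0 (-z, y)] at h1 h2
      have h3 := hs x z y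
      have h4 := hs 0 z y
      rw [neg_zero] at h4
      rw [h3, h4, bump_neg] at h2
      simp only [smul_eq_mul, zero_add, pow_succ] at h1 h2
      have : x * (k (-x, -z, y) - (-1) ^ n * k (x, z, y)) = 0 := by
        linear_combination (-1 : ℝ) ^ n * h1 + h2
      linarith [(mul_eq_zero.1 this).resolve_left hx]
    obtain ⟨ψ₀, ψ₁, h0, h1, -, h3⟩ := ih hk hks
    have hmain : ∀ t y, t ≠ 0 → hypMean (fun q => q.2.1 ^ (n + 1) * h q) (t, y)
          = (A (t, y) + t * ψ₀ (t, y)) + t ^ (n + 1) * Real.log |t| * ψ₁ (t, y) := by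
      intro t y ht
      have hz : ContDiff ℝ ∞ fun q : ℝ × ℝ × P => q.2.1 ^ n := by fun_prop
      have hxz : ContDiff ℝ ∞ fun q : ℝ × ℝ × P => q.1 * q.2.1 := by fun_prop
      have e1 : (fun q : ℝ × ℝ × P => q.2.1 ^ (n + 1) * h q)
          = fun q => q.2.1 ^ (n + 1) * h (0, q.2.1, q.2.2) * bump q.1
            + q.1 * q.2.1 * (q.2.1 ^ n * k q) := by
        funext ⟨x, z, y⟩
        have h4 := hkD x (z, y)
        simp only [hD0 (z, y), zero_add, smul_eq_mul] at h4
        simp only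
        linear_combination z ^ (n + 1) * h4
      rw [e1, hypMean_add (isTest_mul_bump hg).swap (IsTest.mul hxz (IsTest.mul hz hk)) ht,
        hypMean_mul (fun p => p.1), h3 t y ht]
      rw [hypMean_swap (f := fun q : ℝ × ℝ × P => q.1 ^ (n + 1) * h (0, q.1, q.2.2) * bump q.2.1)
        (fun x z y => by simp only [hge, bump_neg]) ht, hAe t y ht]
      ring
    have hz : ContDiff ℝ ∞ fun q : ℝ × ℝ × P => q.2.1 ^ (n + 1) := by fun_prop
    exact ⟨fun p => A p + p.1 * ψ₀ p, ψ₁,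
      isTest_of_hypMean_eq (IsTest.mul hz hh) (hA.add (contDiff_fst.mul h0.smooth)) h1 hmain,
      h1, fun h => absurd h (by omega), hmain⟩

/-- Factor out `(x z) ^ r = t ^ r`. The surplus `z ^ (2 d)` gives `t ^ (2 d) log |t|`, of which `t ^
d` is moved into the coefficient; so the coefficient vanishes at `0` unless `d = 0`. -/
theorem exists_expansion_pow_mul_pow_of_le [FiniteDimensional ℝ P] {S : ℝ} {h : ℝ × ℝ × P → ℝ}
    (hh : IsHypTest S h) (r d : ℕ) :
    ∃ ψ₀ ψ₁ : ℝ × P → ℝ, IsTest ψ₀ ∧ IsTest ψ₁ ∧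
      (∀ y, ψ₁ (0, y) = if d = 0 then -h (0, 0, y) else 0) ∧
      ∀ t y, t ≠ 0 → hypMean (fun q => q.1 ^ r * q.2.1 ^ (r + 2 * d) * h q) (t, y)
        = ψ₀ (t, y) + t ^ (r + d) * Real.log |t| * ψ₁ (t, y) := by
  obtain ⟨ψ₀, ψ₁, h0, h1, h2, h3⟩ := exists_expansion_pow_mul (2 * d) hh.isTest fun x z y => by
    rw [hh.symm, pow_mul]; norm_num
  refine ⟨fun p => p.1 ^ r * ψ₀ p, fun p => p.1 ^ d * ψ₁ p, IsTest.mul (contDiff_fst.pow _) h0,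
    IsTest.mul (contDiff_fst.pow _) h1, fun y => ?_, fun t y ht => ?_⟩
  · split_ifs with hd
    · subst hd
      simp [h2]
    · simp [hd]
  · have e1 : (fun q : ℝ × ℝ × P => q.1 ^ r * q.2.1 ^ (r + 2 * d) * h q)
        = fun q => (q.1 * q.2.1) ^ r * (q.2.1 ^ (2 * d) * h q) := by
      funext q
      rw [mul_pow, pow_add]
      ring
    rw [e1, hypMean_mul (fun p => p.1 ^ r), h3 t y ht]
    ring

/-- Only the balanced monomial `r = s = m` has a logarithmic coefficient that survives at `t = 0`.
The case `r > s` follows by exchanging `x` and `z`. -/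
theorem exists_expansion_pow_mul_pow [FiniteDimensional ℝ P] {S : ℝ} {h : ℝ × ℝ × P → ℝ}
    (hh : IsHypTest S h) {r s m : ℕ} (hrs : r + s = 2 * m) :
    ∃ ψ₀ ψ₁ : ℝ × P → ℝ, IsTest ψ₀ ∧ IsTest ψ₁ ∧
      (∀ y, ψ₁ (0, y) = if r = m then -h (0, 0, y) else 0) ∧
      ∀ t y, t ≠ 0 → hypMean (fun q => q.1 ^ r * q.2.1 ^ s * h q) (t, y)
        = ψ₀ (t, y) + t ^ m * Real.log |t| * ψ₁ (t, y) := by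
  rcases le_total r m with hle | hle
  · obtain ⟨d, rfl⟩ := Nat.exists_eq_add_of_le hle
    obtain rfl : s = r + 2 * d := by omega
    simpa using exists_expansion_pow_mul_pow_of_le hh r d
  · obtain ⟨d, rfl⟩ : ∃ d, m = s + d := Nat.exists_eq_add_of_le (by omega)
    obtain rfl : r = s + 2 * d := by omega
    obtain ⟨ψ₀, ψ₁, h0, h1, h2, h3⟩ := exists_expansion_pow_mul_pow_of_le hh.swap s d
    refine ⟨ψ₀, ψ₁, h0, h1, fun y => ?_, fun t y ht => ?_⟩
    · rw [h2]
      congr 1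
      simp
      omega
    · rw [← h3 t y ht, ← hypMean_swap _ ht]
      · congr 1
        funext q
        ring
      · intro x z y
        simp only
        rw [hh.symm, neg_pow x, neg_pow z, pow_add, pow_mul]
        have : ((-1 : ℝ) ^ s) * (-1) ^ s = 1 := by rw [← mul_pow]; norm_num
        linear_combination (x ^ (s + 2 * d) * z ^ s * h (x, z, y)) * this

open Polynomial in
/-- The polynomial `(X + 1) ^ (2 i) (X - 1) ^ (2 j)`. -/
def binomPoly (i j : ℕ) : ℝ[X] := (X + 1) ^ (2 * i) * (X - 1) ^ (2 * j)

open Polynomial in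
-- Induction from two relations between central coefficients. The identity `(X+1)² - (X-1)² = 4X`
-- gives their difference (`hA`). With `Q = (X+1)^(2i+1) (X-1)^(2j+1)`, the coefficient of degree `d
-- = i+j+1` in `X Q' - d Q` is zero, which gives a vanishing combination with positive weights
-- (`hB`). If one of the two vanished, both would, contradicting a nonzero difference.
theorem binomPoly_coeff_ne_zero (i j : ℕ) : (binomPoly i j).coeff (i + j) ≠ 0 := by
  have hA : ∀ i j : ℕ, (binomPoly (i + 1) j).coeff (i + j + 1) - (binomPoly i (j + 1)).coeff (i + j + 1)
      = 4 * (binomPoly i j).coeff (i + j) := by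
    intro i j
    have : binomPoly (i + 1) j - binomPoly i (j + 1) = C 4 * (binomPoly i j * X) := by
      simp only [binomPoly, map_ofNat]
      ring
    rw [← coeff_sub, this, coeff_C_mul, coeff_mul_X]
  have hB : ∀ i j : ℕ, (2 * i + 1 : ℝ) * (binomPoly i (j + 1)).coeff (i + j + 1)
      + (2 * j + 1) * (binomPoly (i + 1) j).coeff (i + j + 1) = 0 := by
    intro i j
    set Q : ℝ[X] := (X + 1) ^ (2 * i + 1) * (X - 1) ^ (2 * j + 1) with hQ
    have h1 : C (2 * i + 1 : ℝ) * binomPoly i (j + 1) + C (2 * j + 1 : ℝ) * binomPoly (i + 1) j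
        = C 2 * (derivative Q * X) - C (2 * (i + j + 1) : ℝ) * Q := by
      simp only [hQ, binomPoly, derivative_mul, derivative_pow, derivative_sub,
        derivative_X, derivative_one, map_add, map_mul, map_ofNat, map_natCast, map_one,
        add_tsub_cancel_right]
      push_cast
      ring
    have h2 := congrArg (fun p => coeff p (i + j + 1)) h1
    simp only [coeff_add, coeff_sub, coeff_C_mul, coeff_mul_X, coeff_derivative] at h2
    rw [h2]
    push_cast
    ring
  have hstep : ∀ i j : ℕ, (binomPoly i j).coeff (i + j) ≠ 0 →
      (binomPoly (i + 1) j).coeff (i + j + 1) ≠ 0 ∧ (binomPoly i (j + 1)).coeff (i + j + 1) ≠ 0 := by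
    intro i j h
    have h1 := hA i j
    have h2 := hB i j
    have hi : (0 : ℝ) < 2 * i + 1 := by positivity
    have hj : (0 : ℝ) < 2 * j + 1 := by positivity
    constructor
    · intro h0
      rw [h0, mul_zero, add_zero] at h2
      rw [h0, (mul_eq_zero.1 h2).resolve_left hi.ne'] at h1
      exact h (by linarith)
    · intro h0
      rw [h0, mul_zero, zero_add] at h2
      rw [h0, (mul_eq_zero.1 h2).resolve_left hj.ne'] at h1
      exact h (by linarith)
  have hi0 : ∀ i, (binomPoly i 0).coeff (i + 0) ≠ 0 := by
    intro i
    induction i with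
    | zero => simp [binomPoly]
    | succ i ih => exact (hstep i 0 ih).1
  induction j with
  | zero => exact hi0 i
  | succ j ih => exact (hstep i j ih).2

/-- Homogenisation: evaluate at `x / z` and multiply by the top power of `z`. -/
theorem binomPoly_eval (i j : ℕ) {x z : ℝ} (hz : z ≠ 0) :
    (x + z) ^ (2 * i) * (x - z) ^ (2 * j) = ∑ r ∈ Finset.range (2 * (i + j) + 1),
      (binomPoly i j).coeff r * (x ^ r * z ^ (2 * (i + j) - r)) := by
  have hdeg : (binomPoly i j).natDegree < 2 * (i + j) + 1 := by
    rw [Nat.lt_succ_iff, binomPoly]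
    refine Polynomial.natDegree_mul_le.trans ?_
    have h1 : ((Polynomial.X + 1 : Polynomial ℝ) ^ (2 * i)).natDegree ≤ 2 * i * 1 :=
      Polynomial.natDegree_pow_le_of_le _ (by compute_degree)
    have h2 : ((Polynomial.X - 1 : Polynomial ℝ) ^ (2 * j)).natDegree ≤ 2 * j * 1 :=
      Polynomial.natDegree_pow_le_of_le _ (by compute_degree)
    omega
  have h1 := Polynomial.eval_eq_sum_range' hdeg (x / z)
  have h2 : (binomPoly i j).eval (x / z) = (x / z + 1) ^ (2 * i) * (x / z - 1) ^ (2 * j) := by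
    simp [binomPoly]
  have h3 : (x + z) ^ (2 * i) * (x - z) ^ (2 * j)
      = z ^ (2 * (i + j)) * (binomPoly i j).eval (x / z) := by
    rw [h2, mul_add, pow_add, mul_mul_mul_comm, ← mul_pow, ← mul_pow]
    congr 2 <;> field_simp
  rw [h3, h1, Finset.mul_sum]
  refine Finset.sum_congr rfl fun r hr => ?_
  have hr' : r ≤ 2 * (i + j) := by simpa [Nat.lt_succ_iff] using hr
  have h4 : z ^ (2 * (i + j)) = z ^ (2 * (i + j) - r) * z ^ r := by
    rw [← pow_add, Nat.sub_add_cancel hr']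
  rw [h4, div_pow]
  field_simp

end HyperbolicMonomial

end

end OrbitalMean


namespace OrbitalMean

noncomputable section

/-! ### Both indices odd -/

section OddOdd

set_option linter.unusedSectionVars false

variable {P : Type} [NormedAddCommGroup P] [NormedSpace ℝ P]

theorem integral_powMeasure_add_half (i : ℕ) (g : ℝ → ℝ) :
    ∫ a, g a ∂powMeasure (i + 1 / 2) = ∫ u, u ^ (2 * i) * g (u ^ 2) := by
  have h := integral_powMeasure_half fun a => a ^ i * g a
  simp only [← pow_mul] at h
  rw [h, integral_powMeasure, integral_powMeasure]
  refine setIntegral_congr_fun measurableSet_Ioi fun a ha => ?_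
  rw [← mul_assoc, ← Real.rpow_natCast, ← Real.rpow_add ha]
  congr 2
  ring

/-- The derivative of `(θ, t) ↦ (exp θ, t exp (-θ))`. -/
def hypCurveDeriv (w : ℝ × ℝ) : ℝ × ℝ →L[ℝ] ℝ × ℝ :=
  (Real.exp w.1 • ContinuousLinearMap.fst ℝ ℝ ℝ + (0 : ℝ) • ContinuousLinearMap.snd ℝ ℝ ℝ).prod
    ((-(w.2 * Real.exp (-w.1))) • ContinuousLinearMap.fst ℝ ℝ ℝ
      + Real.exp (-w.1) • ContinuousLinearMap.snd ℝ ℝ ℝ)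

theorem hasFDerivAt_hypCurve (w : ℝ × ℝ) :
    HasFDerivAt (fun w : ℝ × ℝ => (Real.exp w.1, w.2 * Real.exp (-w.1))) (hypCurveDeriv w) w := by
  have h1 : HasFDerivAt (fun w : ℝ × ℝ => Real.exp w.1) _ w := hasFDerivAt_fst.exp
  have h2 : HasFDerivAt (fun w : ℝ × ℝ => Real.exp (-w.1)) _ w := hasFDerivAt_fst.neg.exp
  refine (h1.prodMk (hasFDerivAt_snd.mul h2)).congr_fderiv ?_
  ext <;> simp [hypCurveDeriv]

theorem abs_det_hypCurveDeriv (w : ℝ × ℝ) : |(hypCurveDeriv w).det| = 1 := by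
  rw [hypCurveDeriv, det_prod_eq, zero_mul, sub_zero, ← Real.exp_add, add_neg_cancel, Real.exp_zero,
    abs_one]

theorem image_hypCurve :
    (fun w : ℝ × ℝ => (Real.exp w.1, w.2 * Real.exp (-w.1))) '' univ = Ioi 0 ×ˢ univ := by
  ext ⟨x, z⟩
  simp only [image_univ, mem_range, Prod.mk.injEq, Prod.exists, mem_prod, mem_Ioi, mem_univ, and_true]
  constructor
  · rintro ⟨θ, t, rfl, -⟩
    exact Real.exp_pos θ
  · intro hx
    refine ⟨Real.log x, z * x, Real.exp_log hx, ?_⟩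
    rw [Real.exp_neg, Real.exp_log hx, mul_assoc, mul_inv_cancel₀ hx.ne', mul_one]

theorem injOn_hypCurve :
    InjOn (fun w : ℝ × ℝ => (Real.exp w.1, w.2 * Real.exp (-w.1))) univ := by
  rintro ⟨θ, t⟩ - ⟨θ', t'⟩ - h
  simp only [Prod.mk.injEq] at h
  obtain rfl := Real.exp_injective h.1
  rw [mul_right_cancel₀ (Real.exp_pos _).ne' h.2]

/-- The coordinates `x = exp θ`, `z = t exp (-θ)` on the half-plane `x > 0` have Jacobian `1`. -/
theorem integral_Ioi_hyp {F : ℝ → ℝ} (hF : Continuous F) {k : ℝ × ℝ → ℝ} (hk : IsTest k) :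
    ∫ x in Ioi (0 : ℝ), ∫ z, F (x * z) * k (x, z)
      = ∫ t, F t * ∫ θ, k (Real.exp θ, t * Real.exp (-θ)) := by
  have hi : Integrable fun w : ℝ × ℝ => F (w.1 * w.2) * k w :=
    integrable_mul_of_isTest volume hk (hF.comp (continuous_fst.mul continuous_snd))
  have h1 : Integrable fun w : ℝ × ℝ => F w.2 * k (Real.exp w.1, w.2 * Real.exp (-w.1)) := by
    have := (integrableOn_image_iff_integrableOn_abs_det_fderiv_smul volume MeasurableSet.univ
      (fun w _ => (hasFDerivAt_hypCurve w).hasFDerivWithinAt) injOn_hypCurve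
      fun w : ℝ × ℝ => F (w.1 * w.2) * k w).1 hi.integrableOn
    simpa only [abs_det_hypCurveDeriv, one_smul, exp_mul_mul_exp_neg, integrableOn_univ] using this
  have h2 := integral_image_eq_integral_abs_det_fderiv_smul volume MeasurableSet.univ
    (fun w _ => (hasFDerivAt_hypCurve w).hasFDerivWithinAt) injOn_hypCurve
    fun w : ℝ × ℝ => F (w.1 * w.2) * k w
  simp only [abs_det_hypCurveDeriv, one_smul, exp_mul_mul_exp_neg, Measure.restrict_univ,
    image_hypCurve] at h2
  rw [Measure.volume_eq_prod, setIntegral_prod _ hi.integrableOn] at h2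
  simp only [Measure.restrict_univ] at h2
  rw [h2, integral_prod_symm _ h1]
  simp only [integral_const_mul]

/-- In the coordinates `x = u + v`, `z = u - v` the form is `x z`. The Jacobian `1/2` cancels
against the two halves `x > 0` and `x < 0`, which contribute equally by symmetry. -/
theorem integral_sq_sub_sq {F : ℝ → ℝ} (hF : Continuous F) {k : ℝ × ℝ → ℝ} (hk : IsTest k)
    (hs : ∀ u v, k (-u, -v) = k (u, v)) :
    ∫ u, ∫ v, F (u ^ 2 - v ^ 2) * k (u, v)
      = ∫ t, F t * ∫ θ, k ((Real.exp θ + t * Real.exp (-θ)) / 2,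
          (Real.exp θ - t * Real.exp (-θ)) / 2) := by
  have hk1 : IsTest fun p : ℝ × ℝ => k (p.1, p.1 - p.2) := by
    refine hk.comp (by fun_prop) fun R => ⟨2 * R, fun p hp => ?_⟩
    simp only [Prod.norm_def, Real.norm_eq_abs] at hp ⊢
    by_contra! h
    rw [max_le_iff, abs_le, abs_le] at h
    rw [lt_max_iff, lt_abs, lt_abs] at hp
    rcases hp with (h1 | h1) | (h1 | h1) <;> linarith
  have hk2 : IsTest fun p : ℝ × ℝ => k ((p.1 + p.2) / 2, (p.1 - p.2) / 2) := by
    refine hk.comp (by fun_prop) fun R => ⟨2 * R, fun p hp => ?_⟩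
    simp only [Prod.norm_def, Real.norm_eq_abs] at hp ⊢
    by_contra! h
    rw [max_le_iff, abs_le, abs_le] at h
    rw [lt_max_iff, lt_abs, lt_abs] at hp
    rcases hp with (h1 | h1) | (h1 | h1) <;> linarith
  have hFc : Continuous fun p : ℝ × ℝ => F (p.1 ^ 2 - (p.1 - p.2) ^ 2) := by fun_prop
  have e1 : ∀ u, ∫ v, F (u ^ 2 - v ^ 2) * k (u, v)
      = ∫ z, F (u ^ 2 - (u - z) ^ 2) * k (u, u - z) := fun u =>
    (integral_sub_left_eq_self (fun v => F (u ^ 2 - v ^ 2) * k (u, v)) volume u).symm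
  have e2 : ∀ z : ℝ, ∫ u, F (u ^ 2 - (u - z) ^ 2) * k (u, u - z)
      = 2⁻¹ * ∫ x, F (x * z) * k ((x + z) / 2, (x - z) / 2) := by
    intro z
    have h1 := integral_add_right_eq_self (μ := volume)
      (fun u => F (u ^ 2 - (u - z) ^ 2) * k (u, u - z)) (z / 2)
    have h2 := Measure.integral_comp_mul_right
      (fun u => F ((u + z / 2) ^ 2 - (u + z / 2 - z) ^ 2) * k (u + z / 2, u + z / 2 - z)) (2⁻¹)
    rw [h1, inv_inv, abs_two, smul_eq_mul] at h2
    have h3 : ∫ x, F (x * z) * k ((x + z) / 2, (x - z) / 2)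
        = 2 * ∫ u, F (u ^ 2 - (u - z) ^ 2) * k (u, u - z) := by
      rw [← h2]
      refine integral_congr_ae (Eventually.of_forall fun x => ?_)
      simp only
      congr 2 <;> [skip; congr 1] <;> ring
    rw [h3]
    ring
  have hsw := integral_integral_swap_of_isTest volume volume hk1 hFc
  have hG : ∀ x, (fun x : ℝ => ∫ z, F (x * z) * k ((x + z) / 2, (x - z) / 2)) |x|
      = ∫ z, F (x * z) * k ((x + z) / 2, (x - z) / 2) := by
    intro x
    rcases abs_choice x with h | h
    · simp only [h]
    · simp only [h]
      rw [← integral_neg_eq_self]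
      refine integral_congr_ae (Eventually.of_forall fun z => ?_)
      simp only
      rw [← hs]
      congr 2 <;> [skip; congr 1] <;> ring
  calc ∫ u, ∫ v, F (u ^ 2 - v ^ 2) * k (u, v)
      = ∫ z, ∫ u, F (u ^ 2 - (u - z) ^ 2) * k (u, u - z) := by simp only [e1]; exact hsw
    _ = 2⁻¹ * ∫ z, ∫ x, F (x * z) * k ((x + z) / 2, (x - z) / 2) := by
        simp only [e2, integral_const_mul]
    _ = 2⁻¹ * ∫ x, ∫ z, F (x * z) * k ((x + z) / 2, (x - z) / 2) := by
        rw [integral_integral_swap_of_isTest volume volume hk2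
          (F := fun p : ℝ × ℝ => F (p.1 * p.2)) (hF.comp (continuous_fst.mul continuous_snd))]
    _ = ∫ x in Ioi (0 : ℝ), ∫ z, F (x * z) * k ((x + z) / 2, (x - z) / 2) := by
        have h := integral_comp_abs
          (f := fun x : ℝ => ∫ z, F (x * z) * k ((x + z) / 2, (x - z) / 2))
        simp only [hG] at h
        rw [h]
        ring
    _ = _ := integral_Ioi_hyp hF hk2

/-- The mean relative to a form of odd-odd signature. -/
theorem pairIntegral_of_half (i j : ℕ) :
    ∃ κ : ℝ, κ ≠ 0 ∧ ∀ {P : Type} [NormedAddCommGroup P] [NormedSpace ℝ P] [FiniteDimensional ℝ P]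
      {h : ℝ × ℝ × P → ℝ}, IsTest h →
    ∃ ψ₀ ψ₁ : ℝ × P → ℝ, IsTest ψ₀ ∧ IsTest ψ₁ ∧ (∀ y, ψ₁ (0, y) = κ * h (0, 0, y)) ∧
      ∀ F : ℝ → ℝ, Continuous F → ∀ y, pairIntegral (i + 1 / 2) (j + 1 / 2) F h y
        = ∫ t, F t * (ψ₀ (t, y) + t ^ (i + j) * Real.log |t| * ψ₁ (t, y)) := by
  -- The weight `u^(2i) v^(2j)` at `u = (x + z)/2`, `v = (x - z)/2` is a combination of monomials
  -- `x^r z^(2(i+j)-r)`. Only `r = i + j` has a logarithmic coefficient that does not vanish at `t =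
  -- 0`, so the central coefficient alone enters; the sign is that of `-log |t|` in `hypLog`.
  refine ⟨-(2⁻¹ ^ (2 * (i + j)) * (binomPoly i j).coeff (i + j)), ?_, fun {P} _ _ _ {h} hh => ?_⟩
  · have := binomPoly_coeff_ne_zero i j
    simpa using this
  set H : ℝ × ℝ × P → ℝ := fun q =>
    h (((q.1 + q.2.1) / 2) ^ 2, ((q.1 - q.2.1) / 2) ^ 2, q.2.2) with hHdef
  have hH : IsTest H := by
    refine hh.comp (by fun_prop) fun R => ⟨2 + 2 * |R|, fun q hq => ?_⟩
    simp only [Prod.norm_def, Real.norm_eq_abs] at hq ⊢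
    by_contra! hcon
    simp only [max_le_iff] at hcon
    obtain ⟨h1, h2, h3⟩ := hcon
    replace h1 := (le_abs_self _).trans h1
    replace h2 := (le_abs_self _).trans h2
    have hR := le_abs_self R
    have hR0 := abs_nonneg R
    rw [lt_max_iff, lt_max_iff, lt_abs, lt_abs] at hq
    rcases hq with (h4 | h4) | (h4 | h4) | h4
    · nlinarith [sq_nonneg (q.1 - 2), sq_nonneg (q.2.1), sq_nonneg (q.1+ 2)]
    · nlinarith [sq_nonneg (q.1 - 2), sq_nonneg (q.2.1), sq_nonneg (q.1+ 2)]
    · nlinarith [sq_nonneg (q.2.1 - 2), sq_nonneg (q.1), sq_nonneg (q.2.1+ 2)]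
    · nlinarith [sq_nonneg (q.2.1 - 2), sq_nonneg (q.1), sq_nonneg (q.2.1+ 2)]
    · linarith
  obtain ⟨S, hS⟩ := hH.bounded
  have hHs : IsHypTest S H := by
    refine ⟨hH, fun x z y => ?_, fun x z y hy => hS _ (hy.trans_le
      ((norm_snd_le (z, y)).trans (norm_snd_le (x, z, y))))⟩
    simp only [hHdef]
    congr 2 <;> [skip; congr 1] <;> ring
  -- Zero functions are supplied for `r` out of range, so that the choice can be made for all `r`.
  have hexp : ∀ r : ℕ, ∃ ψ₀ ψ₁ : ℝ × P → ℝ, IsTest ψ₀ ∧ IsTest ψ₁ ∧ (r ≤ 2 * (i + j) →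
      (∀ y, ψ₁ (0, y) = if r = i + j then -H (0, 0, y) else 0) ∧
      ∀ t y, t ≠ 0 → hypMean (fun q => q.1 ^ r * q.2.1 ^ (2 * (i + j) - r) * H q) (t, y)
        = ψ₀ (t, y) + t ^ (i + j) * Real.log |t| * ψ₁ (t, y)) := by
    intro r
    by_cases hr : r ≤ 2 * (i + j)
    · obtain ⟨ψ₀, ψ₁, h0, h1, h2, h3⟩ := exists_expansion_pow_mul_pow hHs (r := r)
        (s := 2 * (i + j) - r) (m := i + j) (by omega)
      exact ⟨ψ₀, ψ₁, h0, h1, fun _ => ⟨h2, h3⟩⟩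
    · exact ⟨fun _ => 0, fun _ => 0, isTest_zero, isTest_zero, fun h => absurd h hr⟩
  choose ψ₀ ψ₁ h0 h1 h2 using hexp
  set c : ℕ → ℝ := fun r => 2⁻¹ ^ (2 * (i + j)) * (binomPoly i j).coeff r with hc
  have hmem : ∀ r ∈ Finset.range (2 * (i + j) + 1), r ≤ 2 * (i + j) := fun r hr => by
    simpa [Nat.lt_succ_iff] using hr
  refine ⟨fun p => ∑ r ∈ Finset.range (2 * (i + j) + 1), c r * ψ₀ r p,
    fun p => ∑ r ∈ Finset.range (2 * (i + j) + 1), c r * ψ₁ r p,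
    IsTest.sum fun r _ => IsTest.mul contDiff_const (h0 r),
    IsTest.sum fun r _ => IsTest.mul contDiff_const (h1 r), fun y => ?_, fun F hF y => ?_⟩
  · simp only
    rw [Finset.sum_eq_single (i + j)]
    · rw [(h2 (i + j) (by omega)).1, if_pos rfl]
      simp [hHdef, hc]
    · intro r hr hne
      rw [(h2 r (hmem r hr)).1, if_neg hne, mul_zero]
    · intro hne
      exact absurd (Finset.mem_range.2 (by omega)) hne
  · have hmean : ∀ t, t ≠ 0 → hypMean (fun q : ℝ × ℝ × P => ((q.1 + q.2.1) / 2) ^ (2 * i)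
        * ((q.1 - q.2.1) / 2) ^ (2 * j) * H q) (t, y)
        = (∑ r ∈ Finset.range (2 * (i + j) + 1), c r * ψ₀ r (t, y)) + t ^ (i + j) * Real.log |t|
          * ∑ r ∈ Finset.range (2 * (i + j) + 1), c r * ψ₁ r (t, y) := by
      intro t ht
      rw [hypMean_congr (g := fun q => ∑ r ∈ Finset.range (2 * (i + j) + 1),
        c r * (q.1 ^ r * q.2.1 ^ (2 * (i + j) - r) * H q)) (fun x z y _ hz => ?_) ht,
        hypMean_sum (fun r _ => IsTest.mul contDiff_const (IsTest.mul (by fun_prop) hH)) ht,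
        Finset.mul_sum, ← Finset.sum_add_distrib]
      · refine Finset.sum_congr rfl fun r hr => ?_
        rw [hypMean_mul (fun _ => c r), (h2 r (hmem r hr)).2 t y ht]
        ring
      · simp only
        rw [div_pow, div_pow, div_mul_div_comm, binomPoly_eval i j hz, Finset.sum_div, Finset.sum_mul]
        refine Finset.sum_congr rfl fun r _ => ?_
        rw [hc]
        simp only
        rw [inv_pow, mul_add, pow_add]
        field_simp
    have hk : IsTest fun p : ℝ × ℝ => p.1 ^ (2 * i) * p.2 ^ (2 * j) * h (p.1 ^ 2, p.2 ^ 2, y) := by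
      refine IsTest.mul (by fun_prop) ((hh.slice y).comp (g := fun p : ℝ × ℝ => (p.1 ^ 2, p.2 ^ 2))
        (by fun_prop) fun R => ⟨1 + |R|, fun q hq => ?_⟩)
      simp only [Prod.norm_def, Real.norm_eq_abs] at hq ⊢
      by_contra! hcon
      simp only [max_le_iff, abs_pow] at hcon
      have hR := le_abs_self R
      have hR0 := abs_nonneg R
      rcases lt_max_iff.1 hq with h4 | h4
      · nlinarith [hcon.1]
      · nlinarith [hcon.2]
    have e1 : pairIntegral (i + 1 / 2) (j + 1 / 2) F h y = ∫ u, ∫ v, F (u ^ 2 - v ^ 2) *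
        (u ^ (2 * i) * v ^ (2 * j) * h (u ^ 2, v ^ 2, y)) := by
      rw [pairIntegral, integral_powMeasure_add_half]
      simp only [integral_powMeasure_add_half, ← integral_const_mul]
      refine integral_congr_ae (Eventually.of_forall fun u => integral_congr_ae
        (Eventually.of_forall fun v => ?_))
      simp only
      ring
    rw [e1, integral_sq_sub_sq hF hk fun u v => by simp [pow_mul]]
    refine integral_congr_ae ?_
    filter_upwards [compl_mem_ae_iff.2 (measure_singleton (0 : ℝ))] with t ht
    rw [← hmean t ht]
    rfl

end OddOdd

end

end OrbitalMean


namespace OrbitalMean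

noncomputable section

/-! ### The singularity functions -/

section Singularity

theorem locallyIntegrable_of_intervalIntegrable {f : ℝ → ℝ}
    (h : ∀ a b, IntervalIntegrable f volume a b) : LocallyIntegrable f := by
  rw [locallyIntegrable_iff]
  intro K hK
  obtain ⟨R, hR⟩ := hK.isBounded.exists_norm_le
  have h1 := (h (-(R + 1)) R)
  rw [intervalIntegrable_iff] at h1
  refine h1.mono_set fun x hx => ?_
  have h2 := abs_le.1 (hR x hx)
  rw [uIoc_of_le (by linarith [h2.1])]
  exact ⟨by linarith [h2.1], h2.2⟩

/-- The function `Y(t) t ^ s`. -/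
def halfPow (s t : ℝ) : ℝ := if 0 < t then t ^ s else 0

theorem halfPow_eq_indicator (s : ℝ) : halfPow s = (Ioi 0).indicator fun t => t ^ s := by
  funext t
  simp only [halfPow, indicator, mem_Ioi]

theorem intervalIntegrable_halfPow {s : ℝ} (hs : -1 < s) (a b : ℝ) :
    IntervalIntegrable (halfPow s) volume a b := by
  have h := intervalIntegral.intervalIntegrable_rpow' (a := a) (b := b) hs
  rw [intervalIntegrable_iff] at h ⊢
  rw [halfPow_eq_indicator]
  exact h.indicator measurableSet_Ioi

theorem contDiffAt_halfPow (s : ℝ) {t : ℝ} (ht : t ≠ 0) : ContDiffAt ℝ ∞ (halfPow s) t := by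
  rcases lt_or_gt_of_ne ht with h | h
  · refine (contDiffAt_const (c := (0 : ℝ))).congr_of_eventuallyEq ?_
    filter_upwards [gt_mem_nhds h] with x hx
    rw [halfPow, if_neg (not_lt.2 hx.le)]
  · refine (Real.contDiffAt_rpow_const_of_ne (p := s) ht).congr_of_eventuallyEq ?_
    filter_upwards [lt_mem_nhds h] with x hx
    rw [halfPow, if_pos hx]

theorem integral_powMeasure_eq_halfPow (α : ℝ) (G : ℝ → ℝ) :
    ∫ t, G t ∂powMeasure α = ∫ t, halfPow (α - 1) t * G t := by
  rw [integral_powMeasure, ← integral_indicator measurableSet_Ioi]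
  refine integral_congr_ae (Eventually.of_forall fun t => ?_)
  simp only [halfPow, indicator, mem_Ioi]
  split_ifs <;> simp

theorem singularity_odd_even {p q : ℕ} (hp : ¬Even p) (hq : Even q) :
    singularity p q = halfPow (((p + q : ℕ) : ℝ) / 2 - 1) := by
  funext t
  simp only [singularity, hp, hq, if_true, if_false, halfPow]

theorem singularity_even_odd {p q : ℕ} (hp : Even p) (hq : ¬Even q) :
    singularity p q = fun t => halfPow (((p + q : ℕ) : ℝ) / 2 - 1) (-t) := by
  funext t
  simp only [singularity, hp, hq, if_true, if_false, halfPow, Left.neg_pos_iff]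

/-- The symmetric normalisation `½ sgn(t) t^k` differs from the half-line power `Y(t) t^k` by a
polynomial, which can be absorbed into the smooth part. -/
theorem singularity_even_even {p q : ℕ} (hp : Even p) (hq : Even q) (h : 2 ≤ p + q) {t : ℝ}
    (ht : t ≠ 0) :
    singularity p q t = halfPow (((p + q : ℕ) : ℝ) / 2 - 1) t - 1 / 2 * t ^ ((p + q) / 2 - 1) := by
  have h1 : ((p + q : ℕ) : ℝ) / 2 - 1 = (((p + q) / 2 - 1 : ℕ) : ℝ) := by
    rw [Nat.cast_sub (by omega), Nat.cast_div (hp.add hq).two_dvd (by norm_num)]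
    norm_num
  simp only [singularity, hp, hq, if_true, halfPow]
  rcases lt_or_gt_of_ne ht with h' | h'
  · rw [Real.sign_of_neg h', if_neg (not_lt.2 h'.le)]
    ring
  · rw [Real.sign_of_pos h', if_pos h', h1, Real.rpow_natCast]
    ring

theorem singularity_odd_odd {p q : ℕ} (hp : ¬Even p) (hq : ¬Even q) :
    singularity p q = fun t => t ^ ((p + q) / 2 - 1) * Real.log |t| := by
  funext t
  simp only [singularity, hp, hq, if_false]

theorem half_sub_one_gt {p q : ℕ} (h : 2 ≤ p + q) : -1 < ((p + q : ℕ) : ℝ) / 2 - 1 := by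
  have : (2 : ℝ) ≤ (p + q : ℕ) := by exact_mod_cast h
  linarith

/-- The exponent `n/2 - 1` exceeds `-1`, and in the odd-odd case the logarithm is integrable near
`0`. -/
theorem intervalIntegrable_singularity {p q : ℕ} (h : 2 ≤ p + q) (a b : ℝ) :
    IntervalIntegrable (singularity p q) volume a b := by
  have hs := half_sub_one_gt h
  by_cases hp : Even p <;> by_cases hq : Even q
  · have hc : Continuous fun t : ℝ => 1 / 2 * t ^ ((p + q) / 2 - 1) := by fun_prop
    have h1 := (intervalIntegrable_halfPow hs a b).sub (hc.intervalIntegrable a b)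
    refine h1.congr_ae (ae_restrict_of_ae ?_)
    filter_upwards [compl_mem_ae_iff.2 (measure_singleton (0 : ℝ))] with t ht
    exact (singularity_even_even hp hq h ht).symm
  · rw [singularity_even_odd hp hq]
    simpa using (intervalIntegrable_halfPow hs (-a) (-b)).comp_sub_left 0
  · rw [singularity_odd_even hp hq]
    exact intervalIntegrable_halfPow hs a b
  · rw [singularity_odd_odd hp hq]
    simp only [Real.log_abs]
    exact intervalIntegral.intervalIntegrable_log'.continuousOn_mul (continuous_pow _).continuousOn

theorem locallyIntegrable_singularity {p q : ℕ} (h : 2 ≤ p + q) :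
    LocallyIntegrable (singularity p q) :=
  locallyIntegrable_of_intervalIntegrable (intervalIntegrable_singularity h)

theorem contDiffAt_singularity {p q : ℕ} (h : 2 ≤ p + q) {t : ℝ} (ht : t ≠ 0) :
    ContDiffAt ℝ ∞ (singularity p q) t := by
  by_cases hp : Even p <;> by_cases hq : Even q
  · have hc : ContDiff ℝ ∞ fun t : ℝ => 1 / 2 * t ^ ((p + q) / 2 - 1) := by fun_prop
    refine ((contDiffAt_halfPow (((p + q : ℕ) : ℝ) / 2 - 1) ht).sub
      hc.contDiffAt).congr_of_eventuallyEq ?_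
    filter_upwards [eventually_ne_nhds ht] with s hs
    exact singularity_even_even hp hq h hs
  · rw [singularity_even_odd hp hq]
    exact (contDiffAt_halfPow _ (neg_ne_zero.2 ht)).comp t contDiffAt_id.neg
  · rw [singularity_odd_even hp hq]
    exact contDiffAt_halfPow _ ht
  · rw [singularity_odd_odd hp hq]
    simp only [Real.log_abs]
    exact (contDiffAt_id.pow _).mul (Real.contDiffAt_log.2 ht)

theorem integrable_singularity_mul {p q : ℕ} (h : 2 ≤ p + q) {g : ℝ → ℝ} (hg : Continuous g)
    (hs : HasCompactSupport g) : Integrable fun t => singularity p q t * g t := by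
  simpa [mul_comm] using
    (locallyIntegrable_singularity h).integrable_smul_left_of_hasCompactSupport hg hs

theorem integrable_halfPow_mul {s : ℝ} (hs : -1 < s) {g : ℝ → ℝ} (hg : Continuous g)
    (hc : HasCompactSupport g) : Integrable fun t => halfPow s t * g t := by
  simpa [mul_comm] using (locallyIntegrable_of_intervalIntegrable
    (intervalIntegrable_halfPow hs)).integrable_smul_left_of_hasCompactSupport hg hc

end Singularity

/-! ### The mean relative to one form -/

section SingleForm

variable {P : Type} [NormedAddCommGroup P] [NormedSpace ℝ P]

/-- Exchanging `a` and `b` reflects `t`, which reduces the case of an integral first exponent to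
that of an integral second one. -/
theorem pairIntegral_swap [FiniteDimensional ℝ P] {α β : ℝ} (hα : 0 < α) (hβ : 0 < β) {F : ℝ → ℝ}
    (hF : Continuous F) {h : ℝ × ℝ × P → ℝ} (hh : IsTest h) (y : P) :
    pairIntegral α β F h y
      = pairIntegral β α (fun t => F (-t)) (fun q => h (q.2.1, q.1, q.2.2)) y := by
  have := isLocallyFiniteMeasure_powMeasure hα
  have := isLocallyFiniteMeasure_powMeasure hβ
  simp only [pairIntegral, neg_sub]
  exact integral_integral_swap_of_isTest (powMeasure α) (powMeasure β) (hh.slice y)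
    (F := fun z : ℝ × ℝ => F (z.1 - z.2)) (by fun_prop)

/-- A single density form of `pairIntegral_of_nat`, with `κ` equal up to sign to a total beta mass
and hence nonzero. The constant is chosen before `P` and `h`. -/
theorem pairIntegral_halfPow {α : ℝ} (hα : 0 < α) {m : ℕ} (hm : 1 ≤ m) :
    ∃ κ : ℝ, κ ≠ 0 ∧ ∀ {P : Type} [NormedAddCommGroup P] [NormedSpace ℝ P] [FiniteDimensional ℝ P]
      {h : ℝ × ℝ × P → ℝ}, IsTest h →
      ∃ ψ₀ ψ₁ : ℝ × P → ℝ, IsTest ψ₀ ∧ IsTest ψ₁ ∧ (∀ y, ψ₁ (0, y) = κ * h (0, 0, y)) ∧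
        ∀ F : ℝ → ℝ, Continuous F → ∀ y, pairIntegral α m F h y
          = ∫ t, F t * (ψ₀ (t, y) + halfPow (α + m - 1) t * ψ₁ (t, y)) := by
  have hm0 : (0 : ℝ) < m := by exact_mod_cast hm
  have := isFiniteMeasure_betaMeasure hα hm0
  refine ⟨-(-1) ^ (m - 1) * (betaMeasure α m).real univ, ?_, fun {P} _ _ _ {h} hh => ?_⟩
  · refine mul_ne_zero (by simp) ?_
    rw [Measure.real, ENNReal.toReal_ne_zero]
    exact ⟨betaMeasure_univ_pos _ _, measure_ne_top _ _⟩
  · obtain ⟨ψ₀, ψ₁, h0, h1, h2, h3⟩ := pairIntegral_of_nat hα hm hh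
    refine ⟨ψ₀, ψ₁, h0, h1, h2, fun F hF y => ?_⟩
    have hi0 : Integrable fun t => F t * ψ₀ (t, y) :=
      integrable_mul_of_isTest volume (h0.slice_fst y) hF
    have hi1 : Integrable fun t => halfPow (α + m - 1) t * (F t * ψ₁ (t, y)) :=
      integrable_halfPow_mul (by linarith) (hF.mul (h1.slice_fst y).smooth.continuous)
        (h1.slice_fst y).hasCompactSupport.mul_left
    rw [h3 F hF y, integral_powMeasure_eq_halfPow, ← integral_add hi0 hi1]
    refine integral_congr_ae (Eventually.of_forall fun t => ?_)
    simp only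
    ring

/-- The mean relative to one quadratic form, with parameters. -/
theorem exists_pairIntegral_eq {p q : ℕ} (hp : 1 ≤ p) (hq : 1 ≤ q) :
    ∃ κ : ℝ, κ ≠ 0 ∧ ∀ {P : Type} [NormedAddCommGroup P] [NormedSpace ℝ P] [FiniteDimensional ℝ P]
      {h : ℝ × ℝ × P → ℝ}, IsTest h →
      ∃ ψ₀ ψ₁ : ℝ × P → ℝ, IsTest ψ₀ ∧ IsTest ψ₁ ∧ (∀ y, ψ₁ (0, y) = κ * h (0, 0, y)) ∧
        ∀ F : ℝ → ℝ, Continuous F → ∀ y, pairIntegral (p / 2) (q / 2) F h y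
          = ∫ t, F t * (ψ₀ (t, y) + singularity p q t * ψ₁ (t, y)) := by
  have hpq : 2 ≤ p + q := by omega
  -- An even index makes the corresponding exponent an integer. If only `p` is even the variables
  -- are exchanged; if neither is, the hyperbolic expansion applies.
  by_cases he : Even q
  · obtain ⟨m, rfl⟩ := he.two_dvd
    obtain ⟨κ, hκ, H⟩ := pairIntegral_halfPow (half_pos_of_one_le hp) (m := m) (by omega)
    have em : (((2 * m : ℕ) : ℝ) / 2) = m := by push_cast; ring
    have es : ((p + 2 * m : ℕ) : ℝ) / 2 - 1 = (p : ℝ) / 2 + m - 1 := by push_cast; ring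
    refine ⟨κ, hκ, fun {P} _ _ _ {h} hh => ?_⟩
    obtain ⟨ψ₀, ψ₁, h0, h1, h2, h3⟩ := H hh
    rw [em]
    by_cases hpe : Even p
    -- The polynomial difference between `halfPow` and the symmetric singularity goes into the
    -- smooth part.
    · refine ⟨fun z => ψ₀ z + 1 / 2 * z.1 ^ ((p + 2 * m) / 2 - 1) * ψ₁ z, ψ₁,
        h0.add (IsTest.mul (contDiff_const.mul (contDiff_fst.pow _)) h1), h1, h2, fun F hF y => ?_⟩
      rw [h3 F hF y]
      refine integral_congr_ae ?_
      filter_upwards [compl_mem_ae_iff.2 (measure_singleton (0 : ℝ))] with t ht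
      rw [singularity_even_even hpe he hpq ht, es]
      ring
    · refine ⟨ψ₀, ψ₁, h0, h1, h2, fun F hF y => ?_⟩
      rw [h3 F hF y, singularity_odd_even hpe he, es]
  · by_cases hpe : Even p
    · obtain ⟨m, rfl⟩ := hpe.two_dvd
      obtain ⟨κ, hκ, H⟩ := pairIntegral_halfPow (half_pos_of_one_le hq) (m := m) (by omega)
      have em : (((2 * m : ℕ) : ℝ) / 2) = m := by push_cast; ring
      have es : ((2 * m + q : ℕ) : ℝ) / 2 - 1 = (q : ℝ) / 2 + m - 1 := by push_cast; ring
      refine ⟨κ, hκ, fun {P} _ _ _ {h} hh => ?_⟩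
      obtain ⟨ψ₀, ψ₁, h0, h1, h2, h3⟩ := H hh.swap
      have hneg : ∀ {ψ : ℝ × P → ℝ}, IsTest ψ → IsTest fun z : ℝ × P => ψ (-z.1, z.2) := fun hψ =>
        hψ.comp (by fun_prop) fun R => ⟨R, fun z hz => by simpa [Prod.norm_def] using hz⟩
      refine ⟨fun z => ψ₀ (-z.1, z.2), fun z => ψ₁ (-z.1, z.2), hneg h0, hneg h1,
        fun y => by simp only [neg_zero, h2], fun F hF y => ?_⟩
      rw [pairIntegral_swap (half_pos_of_one_le hp) (half_pos_of_one_le hq) hF hh, em,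
        h3 (fun t => F (-t)) (by fun_prop) y, ← integral_neg_eq_self, singularity_even_odd hpe he, es]
      simp only [neg_neg]
    · obtain ⟨i, rfl⟩ := Nat.not_even_iff_odd.1 hpe
      obtain ⟨j, rfl⟩ := Nat.not_even_iff_odd.1 he
      have ei : (((2 * i + 1 : ℕ) : ℝ) / 2) = i + 1 / 2 := by push_cast; ring
      have ej : (((2 * j + 1 : ℕ) : ℝ) / 2) = j + 1 / 2 := by push_cast; ring
      rw [singularity_odd_odd hpe he, ei, ej,
        show (2 * i + 1 + (2 * j + 1)) / 2 - 1 = i + j by omega]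
      exact pairIntegral_of_half i j

end SingleForm

end

end OrbitalMean


namespace OrbitalMean

noncomputable section

/-! ### Surjectivity for one form -/

section SingleFormSurjective

set_option linter.unusedSectionVars false

variable {P : Type} [NormedAddCommGroup P] [NormedSpace ℝ P]

/-- A smooth function equal to `a ^ s` for `2 ≤ a`. -/
def cutPow (s a : ℝ) : ℝ := a ^ s * Real.smoothTransition (a - 1)

theorem contDiff_cutPow (s : ℝ) : ContDiff ℝ ∞ (cutPow s) := by
  rw [contDiff_iff_contDiffAt]
  intro a
  rcases lt_or_ge 0 a with h | h
  · exact (Real.contDiffAt_rpow_const_of_ne h.ne').mul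
      (Real.smoothTransition.contDiff.comp (contDiff_id.sub contDiff_const)).contDiffAt
  · refine (contDiffAt_const (c := (0 : ℝ))).congr_of_eventuallyEq ?_
    filter_upwards [gt_mem_nhds (show a < 1 by linarith)] with x hx
    rw [cutPow, Real.smoothTransition.zero_of_nonpos (by linarith), mul_zero]

theorem rpow_mul_cutPow {α a : ℝ} (ha : 2 ≤ a) : a ^ (α - 1) * cutPow (1 - α) a = 1 := by
  rw [cutPow, Real.smoothTransition.one_of_one_le (by linarith), mul_one,
    ← Real.rpow_add (by linarith)]
  simp

/-- Spread `ψ (a - b, y)` with a unit-mass bump in `b` placed far out in the quadrant. There the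
weights are smooth and invertible, and `cutPow` divides them out. -/
theorem exists_pairIntegral_eq_smooth [FiniteDimensional ℝ P] (α β : ℝ) {ψ : ℝ × P → ℝ}
    (hψ : IsTest ψ) : ∃ h : ℝ × ℝ × P → ℝ, IsTest h ∧ ∀ F : ℝ → ℝ, Continuous F → ∀ y,
      pairIntegral α β F h y = ∫ t, F t * ψ (t, y) := by
  obtain ⟨R, hR1, hR⟩ := hψ.exists_radius
  -- Centre `R + 4` and outer radius `2` keep `b ≥ R + 2`; since `|a - b| ≤ R` on the support of
  -- `ψ`, also `a ≥ 2`, as `rpow_mul_cutPow` requires.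
  set φ : ContDiffBump (R + 4) := ⟨1, 2, one_pos, one_lt_two⟩ with hφ
  set ρ := φ.normed volume with hρ
  have hρ0 : ∀ b, ρ b ≠ 0 → R + 2 ≤ b ∧ b ≤ R + 6 := by
    intro b hb
    have h1 : b ∈ Function.support ρ := hb
    rw [hρ, φ.support_normed_eq, Metric.mem_ball, Real.dist_eq, abs_lt] at h1
    have h2 : φ.rOut = 2 := rfl
    rw [h2] at h1
    constructor <;> linarith [h1.1, h1.2]
  have hψ0 : ∀ t y, ψ (t, y) ≠ 0 → |t| ≤ R ∧ ‖y‖ ≤ R := by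
    intro t y h
    have h1 : ‖((t, y) : ℝ × P)‖ ≤ R := by
      by_contra! hlt
      exact h (hR _ hlt)
    exact max_le_iff.1 h1
  have hρs : ContDiff ℝ ∞ fun q : ℝ × ℝ × P => ρ q.2.1 :=
    (φ.contDiff_normed (n := (⊤ : ℕ∞))).comp (contDiff_fst.comp contDiff_snd)
  have hk : IsTest fun q : ℝ × ℝ × P => ρ q.2.1 * ψ (q.1 - q.2.1, q.2.2) := by
    refine ⟨hρs.mul
      (hψ.smooth.comp (contDiff_fst.sub (contDiff_fst.comp contDiff_snd) |>.prodMk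
        (contDiff_snd.comp contDiff_snd))),
      2 * R + 6, fun q hq => ?_⟩
    by_contra hne
    have h1 := hρ0 _ (left_ne_zero_of_mul hne)
    have h2 := hψ0 _ _ (right_ne_zero_of_mul hne)
    rw [abs_le] at h2
    simp only [Prod.norm_def, lt_max_iff, Real.norm_eq_abs, lt_abs] at hq
    rcases hq with (h | h) | (h | h) | h <;> linarith [h2.1.1, h2.1.2, h2.2, h1.1, h1.2]
  refine ⟨fun q => cutPow (1 - α) q.1 * cutPow (1 - β) q.2.1 * (ρ q.2.1 * ψ (q.1 - q.2.1, q.2.2)),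
    IsTest.mul (((contDiff_cutPow _).comp contDiff_fst).mul ((contDiff_cutPow _).comp
      (contDiff_fst.comp contDiff_snd))) hk, fun F hF y => ?_⟩
  have hbig : ∀ a b, ρ b * ψ (a - b, y) ≠ 0 → 2 ≤ a ∧ 2 ≤ b := by
    intro a b hne
    have h1 := hρ0 _ (left_ne_zero_of_mul hne)
    have h2 := hψ0 _ _ (right_ne_zero_of_mul hne)
    rw [abs_le] at h2
    constructor <;> linarith [h2.1.1, h1.1]
  have e1 : ∀ a, a ^ (α - 1) * ∫ b, F (a - b) * (cutPow (1 - α) a * cutPow (1 - β) b *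
      (ρ b * ψ (a - b, y))) ∂powMeasure β = ∫ b, F (a - b) * (ρ b * ψ (a - b, y)) := by
    intro a
    rw [integral_powMeasure, ← integral_const_mul, setIntegral_eq_integral_of_forall_compl_eq_zero]
    · refine integral_congr_ae (Eventually.of_forall fun b => ?_)
      simp only
      by_cases h0 : ρ b * ψ (a - b, y) = 0
      · simp [h0]
      · have h1 := rpow_mul_cutPow (α := α) (hbig a b h0).1
        have h2 := rpow_mul_cutPow (α := β) (hbig a b h0).2
        linear_combination (F (a - b) * (ρ b * ψ (a - b, y))) *
          (b ^ (β - 1) * cutPow (1 - β) b * h1 + h2)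
    · intro b hb
      have h0 : ρ b * ψ (a - b, y) = 0 := by
        by_contra hne
        exact hb (mem_Ioi.2 (by linarith [(hbig a b hne).2]))
      simp [h0]
  have e2 : ∀ b, ∫ a, F (a - b) * (ρ b * ψ (a - b, y)) = ρ b * ∫ t, F t * ψ (t, y) := by
    intro b
    rw [← integral_const_mul]
    have := integral_sub_right_eq_self (μ := volume) (fun t => ρ b * (F t * ψ (t, y))) b
    rw [← this]
    refine integral_congr_ae (Eventually.of_forall fun a => ?_)
    simp only
    ring
  rw [pairIntegral, integral_powMeasure]
  simp only [e1]
  rw [setIntegral_eq_integral_of_forall_compl_eq_zero]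
  · have := integral_integral_swap_of_isTest volume volume (hk.slice y)
      (F := fun z : ℝ × ℝ => F (z.1 - z.2)) (by fun_prop)
    simp only at this
    rw [this]
    simp only [e2]
    rw [integral_mul_const, hρ, φ.integral_normed, one_mul]
  · intro a ha
    have h0 : ∀ b, ρ b * ψ (a - b, y) = 0 := fun b => by
      by_contra hne
      exact ha (mem_Ioi.2 (by linarith [(hbig a b hne).1]))
    simp [h0]

/-- A factor depending only on `a - b` and the parameter can be moved to `F`, so it multiplies the
density. -/
theorem pairIntegral_mul (α β : ℝ) (F : ℝ → ℝ) (G : ℝ × P → ℝ) (h : ℝ × ℝ → ℝ) (y : P) :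
    pairIntegral α β F (fun q => G (q.1 - q.2.1, q.2.2) * h (q.1, q.2.1)) y
      = ∫ a, ∫ b, (F (a - b) * G (a - b, y)) * h (a, b) ∂powMeasure β ∂powMeasure α := by
  simp only [pairIntegral, mul_assoc]

/-- The function `bump a * bump b` has density `g₀ + η g₁` with `g₁ 0 = κ ≠ 0`. Multiplying it by `G
(a - b, y)`, where `G = χ ψ₁ / g₁` and `χ` cuts off to where `g₁ ≠ 0`, produces the singular part `η
χ ψ₁`. What is missing, `ψ₀ - g₀ G + (1 - χ) η ψ₁`, is smooth since `1 - χ` vanishes near `0`, and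
is attained by `exists_pairIntegral_eq_smooth`. -/
theorem exists_of_pairIntegral [FiniteDimensional ℝ P] {p q : ℕ} (hp : 1 ≤ p) (hq : 1 ≤ q)
    {ψ₀ ψ₁ : ℝ × P → ℝ} (h0 : IsTest ψ₀) (h1 : IsTest ψ₁) :
    ∃ h : ℝ × ℝ × P → ℝ, IsTest h ∧ ∀ F : ℝ → ℝ, Continuous F → ∀ y,
      pairIntegral (p / 2) (q / 2) F h y
        = ∫ t, F t * (ψ₀ (t, y) + singularity p q t * ψ₁ (t, y)) := by
  have hpq : 2 ≤ p + q := by omega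
  have hα := half_pos_of_one_le hp
  have hβ := half_pos_of_one_le hq
  have := isLocallyFiniteMeasure_powMeasure hα
  have := isLocallyFiniteMeasure_powMeasure hβ
  obtain ⟨κ, hκ, H⟩ := exists_pairIntegral_eq hp hq
  -- The third variable is a dummy parameter, set to `0` below.
  have hb3 : IsTest fun w : ℝ × ℝ × ℝ => bump w.1 * bump w.2.2 * bump w.2.1 :=
    isTest_mul_bump (g := fun w : ℝ × ℝ => bump w.1 * bump w.2) (isTest_bump_mul isTest_bump)
  obtain ⟨φ₀, φ₁, hφ₀, hφ₁, hφ, hφF⟩ := H hb3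
  have hb0 : bump 0 = 1 := bump_of_le (by simp)
  set g₀ : ℝ → ℝ := fun t => φ₀ (t, 0) with hg₀
  set g₁ : ℝ → ℝ := fun t => φ₁ (t, 0) with hg₁
  have hg₀t : IsTest g₀ := hφ₀.slice_fst 0
  have hg₁t : IsTest g₁ := hφ₁.slice_fst 0
  have hg10 : g₁ 0 ≠ 0 := by
    rw [hg₁]
    simp only [hφ, hb0, mul_one]
    exact hκ
  have hgF : ∀ F : ℝ → ℝ, Continuous F → ∫ a, ∫ b, F (a - b) * (bump a * bump b)
      ∂powMeasure ((q : ℝ) / 2) ∂powMeasure ((p : ℝ) / 2)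
        = ∫ t, F t * (g₀ t + singularity p q t * g₁ t) := by
    intro F hF
    rw [← hφF F hF 0]
    simp only [pairIntegral, hb0, mul_one]
  obtain ⟨ε, hε, hne⟩ : ∃ ε : ℝ, 0 < ε ∧ ∀ t, |t| < ε → g₁ t ≠ 0 := by
    have := hg₁t.smooth.continuous.continuousAt.eventually_ne hg10
    rw [Metric.eventually_nhds_iff] at this
    obtain ⟨ε, hε, h⟩ := this
    exact ⟨ε, hε, fun t ht => h (by simpa using ht)⟩
  set χ : ℝ → ℝ := fun t => bump (4 / ε * t) with hχ
  have hχs : ContDiff ℝ ∞ χ := contDiff_bump.comp (contDiff_const.mul contDiff_id)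
  have hχ1 : ∀ t, |t| < ε / 4 → χ t = 1 := fun t ht => bump_of_le (by
    rw [abs_mul, abs_of_pos (by positivity), div_mul_eq_mul_div, div_le_one hε]
    linarith)
  have hχ0 : ∀ t, ε / 2 ≤ |t| → χ t = 0 := fun t ht => bump_of_ge (by
    rw [abs_mul, abs_of_pos (by positivity), div_mul_eq_mul_div, le_div_iff₀ hε]
    linarith)
  have hdiv : ContDiff ℝ ∞ fun t => χ t * (g₁ t)⁻¹ := by
    rw [contDiff_iff_contDiffAt]
    intro t
    rcases lt_or_ge |t| ε with h | h
    · exact hχs.contDiffAt.mul (hg₁t.smooth.contDiffAt.inv (hne t h))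
    · refine (contDiffAt_const (c := (0 : ℝ))).congr_of_eventuallyEq ?_
      filter_upwards [continuous_abs.continuousAt.eventually_const_lt
        (show ε / 2 < |t| by linarith)] with s hs
      rw [hχ0 s hs.le, zero_mul]
  have hsing : ContDiff ℝ ∞ fun t => (1 - χ t) * singularity p q t := by
    rw [contDiff_iff_contDiffAt]
    intro t
    rcases eq_or_ne t 0 with rfl | ht
    · refine (contDiffAt_const (c := (0 : ℝ))).congr_of_eventuallyEq ?_
      filter_upwards [continuous_abs.continuousAt.eventually_lt_const
        (show |(0 : ℝ)| < ε / 4 by rw [abs_zero]; positivity)] with s hs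
      rw [hχ1 s hs, sub_self, zero_mul]
    · exact (contDiffAt_const.sub hχs.contDiffAt).mul (contDiffAt_singularity hpq ht)
  set G : ℝ × P → ℝ := fun z => χ z.1 * (g₁ z.1)⁻¹ * ψ₁ z with hG
  have hGt : IsTest G := IsTest.mul (hdiv.comp contDiff_fst) h1
  have hGg : ∀ t y, G (t, y) * g₁ t = χ t * ψ₁ (t, y) := by
    intro t y
    simp only [hG]
    rcases lt_or_ge |t| ε with h | h
    · have := hne t h
      field_simp
    · rw [hχ0 t (by linarith)]
      ring
  obtain ⟨h', hh', hF'⟩ := exists_pairIntegral_eq_smooth ((p : ℝ) / 2) ((q : ℝ) / 2)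
    (ψ := fun z => ψ₀ z - g₀ z.1 * G z + (1 - χ z.1) * singularity p q z.1 * ψ₁ z)
    ((h0.sub (IsTest.mul (hg₀t.smooth.comp contDiff_fst) hGt)).add
      (IsTest.mul (hsing.comp contDiff_fst) h1))
  have hh : IsTest fun w : ℝ × ℝ × P => G (w.1 - w.2.1, w.2.2) * (bump w.1 * bump w.2.1) := by
    obtain ⟨R, hR⟩ := hGt.bounded
    refine ⟨(hGt.smooth.comp (by fun_prop)).mul ((contDiff_bump.comp contDiff_fst).mul
      (contDiff_bump.comp (contDiff_fst.comp contDiff_snd))), max R 2, fun w hw => ?_⟩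
    simp only [Prod.norm_def, lt_max_iff, Real.norm_eq_abs] at hw
    rcases hw with h | h | h
    · rw [bump_of_ge ((le_max_right _ _).trans h.le)]; ring
    · rw [bump_of_ge (t := w.2.1) ((le_max_right _ _).trans h.le)]; ring
    · rw [hR _ (((le_max_left _ _).trans_lt h).trans_le (norm_snd_le (w.1 - w.2.1, w.2.2))),
        zero_mul]
  refine ⟨fun w => G (w.1 - w.2.1, w.2.2) * (bump w.1 * bump w.2.1) + h' w, hh.add hh',
    fun F hF y => ?_⟩
  have hFG : Continuous fun t => F t * G (t, y) := hF.mul (hGt.slice_fst y).smooth.continuous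
  have e1 : pairIntegral (p / 2) (q / 2) F
      (fun w => G (w.1 - w.2.1, w.2.2) * (bump w.1 * bump w.2.1) + h' w) y
      = pairIntegral (p / 2) (q / 2) F
          (fun w => G (w.1 - w.2.1, w.2.2) * (bump w.1 * bump w.2.1)) y
        + pairIntegral (p / 2) (q / 2) F h' y := by
    have hFc : Continuous fun z : ℝ × ℝ => F (z.1 - z.2) := by fun_prop
    have key : ∀ {k : ℝ × ℝ × P → ℝ}, IsTest k → pairIntegral (p / 2) (q / 2) F k y
        = ∫ z, F (z.1 - z.2) * k (z.1, z.2, y)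
          ∂(powMeasure ((p : ℝ) / 2)).prod (powMeasure ((q : ℝ) / 2)) := fun hk =>
      (integral_prod_of_isTest _ _ (hk.slice y) hFc).symm
    rw [key (hh.add hh'), key hh, key hh', ← integral_add
      (integrable_mul_of_isTest _ (hh.slice y) hFc) (integrable_mul_of_isTest _ (hh'.slice y) hFc)]
    simp only [mul_add]
  have hi0 : ∀ {g : ℝ → ℝ}, IsTest g → Integrable fun t => F t * g t := fun hg =>
    integrable_mul_of_isTest volume hg hF
  have hi1 : ∀ {g : ℝ → ℝ}, IsTest g → Integrable fun t => F t * (singularity p q t * g t) := by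
    intro g hg
    have := integrable_singularity_mul hpq (hF.mul hg.smooth.continuous)
      hg.hasCompactSupport.mul_left
    refine this.congr (Eventually.of_forall fun t => ?_)
    simp only [Pi.mul_apply]
    ring
  rw [e1, pairIntegral_mul (P := P) _ _ F G (fun z => bump z.1 * bump z.2)]
  simp only
  rw [hgF _ hFG, hF' F hF y, ← integral_add]
  · refine integral_congr_ae (Eventually.of_forall fun t => ?_)
    simp only
    linear_combination F t * singularity p q t * hGg t y
  · refine ((hi0 (IsTest.mul hg₀t.smooth (hGt.slice_fst y))).add
      (hi1 (IsTest.mul hg₁t.smooth (hGt.slice_fst y)))).congr (Eventually.of_forall fun t => ?_)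
    simp only [Pi.add_apply]
    ring
  · exact hi0 (((h0.sub (IsTest.mul (hg₀t.smooth.comp contDiff_fst) hGt)).add
      (IsTest.mul (hsing.comp contDiff_fst) h1)).slice_fst y)

/-- The image of test functions under the mean relative to one quadratic form. -/
theorem exists_mean_single [FiniteDimensional ℝ P] {p q : ℕ} (hp : 1 ≤ p) (hq : 1 ≤ q)
    {f : Space p q × P → ℝ} (hf : IsTest f) :
    ∃ ψ₀ ψ₁ : ℝ × P → ℝ, IsTest ψ₀ ∧ IsTest ψ₁ ∧ ∀ F : ℝ → ℝ, Continuous F → ∀ y,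
      ∫ x, F (quadForm p q x) * f (x, y)
        = ∫ t, F t * (ψ₀ (t, y) + singularity p q t * ψ₁ (t, y)) := by
  obtain ⟨h, hh, hF⟩ := exists_radial_pair hp hq hf
  obtain ⟨κ, -, H⟩ := exists_pairIntegral_eq hp hq
  obtain ⟨ψ₀, ψ₁, h0, h1, -, h2⟩ := H hh
  exact ⟨ψ₀, ψ₁, h0, h1, fun F hc y => (hF F hc y).trans (h2 F hc y)⟩

theorem exists_of_mean_single [FiniteDimensional ℝ P] {p q : ℕ} (hp : 1 ≤ p) (hq : 1 ≤ q)
    {ψ₀ ψ₁ : ℝ × P → ℝ} (h0 : IsTest ψ₀) (h1 : IsTest ψ₁) :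
    ∃ f : Space p q × P → ℝ, IsTest f ∧ ∀ F : ℝ → ℝ, Continuous F → ∀ y,
      ∫ x, F (quadForm p q x) * f (x, y)
        = ∫ t, F t * (ψ₀ (t, y) + singularity p q t * ψ₁ (t, y)) := by
  obtain ⟨h, hh, hF⟩ := exists_of_pairIntegral hp hq h0 h1
  obtain ⟨f, hf, hfF⟩ := exists_of_radial_pair hp hq hh
  exact ⟨f, hf, fun F hc y => (hfF F hc y).trans (hF F hc y)⟩

end SingleFormSurjective

end

end OrbitalMean


namespace OrbitalMean

noncomputable section

/-! ### Two forms: existence, uniqueness and surjectivity of the mean -/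

section TwoForms

theorem locallyIntegrable_mul_prod {X Y : Type} [TopologicalSpace X] [TopologicalSpace Y]
    [MeasurableSpace X] [MeasurableSpace Y] {μ : Measure X} {ν : Measure Y} [SFinite μ] [SFinite ν]
    {f : X → ℝ} {g : Y → ℝ} (hf : LocallyIntegrable f μ) (hg : LocallyIntegrable g ν) :
    LocallyIntegrable (fun z : X × Y => f z.1 * g z.2) (μ.prod ν) := by
  rintro ⟨x, y⟩
  obtain ⟨U, hU, hfU⟩ := hf x
  obtain ⟨V, hV, hgV⟩ := hg y
  refine ⟨U ×ˢ V, prod_mem_nhds hU hV, ?_⟩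
  rw [IntegrableOn, ← Measure.prod_restrict]
  exact Integrable.mul_prod hfU hgV

theorem integrable_locallyIntegrable_mul {X : Type} [NormedAddCommGroup X] [NormedSpace ℝ X]
    [FiniteDimensional ℝ X] [MeasurableSpace X] [BorelSpace X] {μ : Measure X} {c : X → ℝ}
    (hc : LocallyIntegrable c μ) {F g : X → ℝ} (hF : Continuous F) (hg : IsTest g) :
    Integrable (fun x => c x * (F x * g x)) μ := by
  have : ProperSpace X := FiniteDimensional.proper ℝ X
  have h := hc.integrable_smul_left_of_hasCompactSupport (hF.mul hg.smooth.continuous)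
    hg.hasCompactSupport.mul_left
  refine h.congr (Eventually.of_forall fun x => ?_)
  simp only [Pi.mul_apply, smul_eq_mul]
  ring

theorem locallyIntegrable_singularity_snd {X : Type} [NormedAddCommGroup X] [NormedSpace ℝ X]
    [MeasurableSpace X] {μ : Measure X} [SFinite μ] [IsLocallyFiniteMeasure μ] {p q : ℕ}
    (h : 2 ≤ p + q) : LocallyIntegrable (fun z : X × ℝ => singularity p q z.2) (μ.prod volume) := by
  simpa using locallyIntegrable_mul_prod (locallyIntegrable_const (1 : ℝ) (μ := μ))
    (locallyIntegrable_singularity h)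

theorem locallyIntegrable_singularity_fst {p q : ℕ}
    (h : 2 ≤ p + q) : LocallyIntegrable (fun z : ℝ × ℝ => singularity p q z.1) := by
  rw [Measure.volume_eq_prod]
  simpa using locallyIntegrable_mul_prod (locallyIntegrable_singularity h)
    (locallyIntegrable_const (1 : ℝ) (μ := (volume : Measure ℝ)))

theorem locallyIntegrable_singularity_mul {p₁ q₁ p₂ q₂ : ℕ} (h₁ : 2 ≤ p₁ + q₁) (h₂ : 2 ≤ p₂ + q₂) :
    LocallyIntegrable (fun z : ℝ × ℝ => singularity p₁ q₁ z.1 * singularity p₂ q₂ z.2) :=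
  locallyIntegrable_mul_prod (locallyIntegrable_singularity h₁) (locallyIntegrable_singularity h₂)

/-- Composition of the means relative to the two forms. -/
theorem integral_two_forms {p₁ q₁ p₂ q₂ : ℕ} (h₁ : 2 ≤ p₁ + q₁) (h₂ : 2 ≤ p₂ + q₂)
    {f : Space p₁ q₁ × Space p₂ q₂ → ℝ} (hf : IsTest f) {φ₀ φ₁ : ℝ × Space p₂ q₂ → ℝ}
    (hφ₀ : IsTest φ₀) (hφ₁ : IsTest φ₁) {ψ : Fin 4 → ℝ × ℝ → ℝ} (hψ : ∀ i, IsTest (ψ i))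
    (hf1 : ∀ F : ℝ → ℝ, Continuous F → ∀ y, ∫ x, F (quadForm p₁ q₁ x) * f (x, y)
      = ∫ t, F t * (φ₀ (t, y) + singularity p₁ q₁ t * φ₁ (t, y)))
    (hf0 : ∀ F : ℝ → ℝ, Continuous F → ∀ t, ∫ y, F (quadForm p₂ q₂ y) * φ₀ (t, y)
      = ∫ s, F s * (ψ 0 (t, s) + singularity p₂ q₂ s * ψ 2 (t, s)))
    (hf2 : ∀ F : ℝ → ℝ, Continuous F → ∀ t, ∫ y, F (quadForm p₂ q₂ y) * φ₁ (t, y)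
      = ∫ s, F s * (ψ 1 (t, s) + singularity p₂ q₂ s * ψ 3 (t, s)))
    {F : ℝ × ℝ → ℝ} (hF : Continuous F) :
    ∫ z : Space p₁ q₁ × Space p₂ q₂, F (quadForm p₁ q₁ z.1, quadForm p₂ q₂ z.2) * f z
      = ∫ t : ℝ × ℝ, F t * (ψ 0 t + singularity p₁ q₁ t.1 * ψ 1 t + singularity p₂ q₂ t.2 * ψ 2 t
        + singularity p₁ q₁ t.1 * singularity p₂ q₂ t.2 * ψ 3 t) := by
  have hQ₁ := (contDiff_quadForm p₁ q₁).continuous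
  have hQ₂ := (contDiff_quadForm p₂ q₂).continuous
  have hFQ : Continuous fun z : Space p₁ q₁ × Space p₂ q₂ =>
      F (quadForm p₁ q₁ z.1, quadForm p₂ q₂ z.2) := by fun_prop
  have hFy : ∀ y, Continuous fun t => F (t, quadForm p₂ q₂ y) := fun y => by fun_prop
  have hFt : ∀ t, Continuous fun s => F (t, s) := fun t => by fun_prop
  have hFs : Continuous fun z : Space p₂ q₂ × ℝ => F (z.2, quadForm p₂ q₂ z.1) := by fun_prop
  have hsw : ∀ {φ : ℝ × Space p₂ q₂ → ℝ}, IsTest φ →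
      IsTest fun z : Space p₂ q₂ × ℝ => φ (z.2, z.1) := fun hφ =>
    hφ.comp (by fun_prop) fun R => ⟨R, fun z hz => by
      simpa only [Prod.norm_def, max_comm] using hz⟩
  have hi0 : Integrable fun z : Space p₂ q₂ × ℝ =>
      F (z.2, quadForm p₂ q₂ z.1) * φ₀ (z.2, z.1) :=
    integrable_mul_of_isTest volume (hsw hφ₀) hFs
  have hi1 : Integrable fun z : Space p₂ q₂ × ℝ =>
      singularity p₁ q₁ z.2 * (F (z.2, quadForm p₂ q₂ z.1) * φ₁ (z.2, z.1)) :=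
    integrable_locallyIntegrable_mul (locallyIntegrable_singularity_snd h₁) hFs (hsw hφ₁)
  have hj0 : Integrable fun t : ℝ × ℝ => F t * ψ 0 t := integrable_mul_of_isTest volume (hψ 0) hF
  have hj1 := integrable_locallyIntegrable_mul (locallyIntegrable_singularity_fst h₁) hF (hψ 1)
  have hj2 := integrable_locallyIntegrable_mul
    (locallyIntegrable_singularity_snd (μ := (volume : Measure ℝ)) h₂) hF (hψ 2)
  have hj3 := integrable_locallyIntegrable_mul (locallyIntegrable_singularity_mul h₁ h₂) hF (hψ 3)
  have hi : Integrable fun z : Space p₂ q₂ × ℝ => F (z.2, quadForm p₂ q₂ z.1) *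
      (φ₀ (z.2, z.1) + singularity p₁ q₁ z.2 * φ₁ (z.2, z.1)) := by
    refine (hi0.add hi1).congr (Eventually.of_forall fun z => ?_)
    simp only [Pi.add_apply]
    ring
  have hj : Integrable fun t : ℝ × ℝ => F t * (ψ 0 t + singularity p₁ q₁ t.1 * ψ 1 t
      + singularity p₂ q₂ t.2 * ψ 2 t
      + singularity p₁ q₁ t.1 * singularity p₂ q₂ t.2 * ψ 3 t) := by
    refine (((hj0.add hj1).add hj2).add hj3).congr (Eventually.of_forall fun z => ?_)
    simp only [Pi.add_apply]
    ring
  have e1 : ∀ t, ∫ y, F (t, quadForm p₂ q₂ y) * (φ₀ (t, y) + singularity p₁ q₁ t * φ₁ (t, y))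
      = ∫ s, F (t, s) * (ψ 0 (t, s) + singularity p₁ q₁ t * ψ 1 (t, s)
        + singularity p₂ q₂ s * ψ 2 (t, s)
        + singularity p₁ q₁ t * singularity p₂ q₂ s * ψ 3 (t, s)) := by
    intro t
    have hc : Continuous fun y => F (t, quadForm p₂ q₂ y) := by fun_prop
    have ia : ∀ {g : Space p₂ q₂ → ℝ}, IsTest g →
        Integrable fun y => F (t, quadForm p₂ q₂ y) * g y := fun hg =>
      integrable_mul_of_isTest volume hg hc
    have ib : ∀ {g : ℝ → ℝ}, IsTest g → Integrable fun s => F (t, s) * g s := fun hg =>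
      integrable_mul_of_isTest volume hg (hFt t)
    have ic : ∀ {g : ℝ → ℝ}, IsTest g →
        Integrable fun s => singularity p₂ q₂ s * (F (t, s) * g s) := fun hg =>
      integrable_locallyIntegrable_mul (locallyIntegrable_singularity h₂) (hFt t) hg
    have id : ∀ i j, Integrable fun s => F (t, s) * (ψ i (t, s)
        + singularity p₂ q₂ s * ψ j (t, s)) := fun i j => by
      refine ((ib ((hψ i).slice_snd t)).add (ic ((hψ j).slice_snd t))).congr
        (Eventually.of_forall fun s => ?_)
      simp only [Pi.add_apply]
      ring
    calc _ = ∫ y, (F (t, quadForm p₂ q₂ y) * φ₀ (t, y)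
          + singularity p₁ q₁ t * (F (t, quadForm p₂ q₂ y) * φ₁ (t, y))) := by
          refine integral_congr_ae (Eventually.of_forall fun y => ?_)
          simp only
          ring
      _ = (∫ s, F (t, s) * (ψ 0 (t, s) + singularity p₂ q₂ s * ψ 2 (t, s)))
          + singularity p₁ q₁ t * ∫ s, F (t, s) * (ψ 1 (t, s) + singularity p₂ q₂ s * ψ 3 (t, s)) := by
          rw [integral_add (ia (hφ₀.slice_snd t)) ((ia (hφ₁.slice_snd t)).const_mul _),
            integral_const_mul, hf0 _ (hFt t) t, hf2 _ (hFt t) t]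
      _ = _ := by
          rw [← integral_const_mul, ← integral_add (id 0 2) ((id 1 3).const_mul _)]
          refine integral_congr_ae (Eventually.of_forall fun s => ?_)
          simp only
          ring
  calc _ = ∫ y, ∫ x, F (quadForm p₁ q₁ x, quadForm p₂ q₂ y) * f (x, y) :=
        integral_prod_symm _ (integrable_mul_of_isTest _ hf hFQ)
    _ = ∫ y, ∫ t, F (t, quadForm p₂ q₂ y) * (φ₀ (t, y) + singularity p₁ q₁ t * φ₁ (t, y)) :=
        integral_congr_ae (Eventually.of_forall fun y => hf1 _ (hFy y) y)
    _ = ∫ t, ∫ y, F (t, quadForm p₂ q₂ y) * (φ₀ (t, y) + singularity p₁ q₁ t * φ₁ (t, y)) :=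
        integral_integral_swap hi
    _ = _ := by
        simp only [e1]
        exact (integral_prod _ hj).symm

theorem isTest_coe {E : Type} [NormedAddCommGroup E] [NormedSpace ℝ E] (f : Test E) : IsTest f :=
  isTest_of_hasCompactSupport f.contDiff f.hasCompactSupport

/-- A smooth function with bounded support, as a bundled test function. -/
def IsTest.toTest {E : Type} [NormedAddCommGroup E] [NormedSpace ℝ E] [FiniteDimensional ℝ E]
    {f : E → ℝ} (hf : IsTest f) : Test E :=
  ⟨f, hf.smooth, by
    have : ProperSpace E := FiniteDimensional.proper ℝ E
    exact hf.hasCompactSupport, fun _ _ => trivial⟩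

theorem isTest_flip {E E' : Type} [NormedAddCommGroup E] [NormedSpace ℝ E] [NormedAddCommGroup E']
    [NormedSpace ℝ E'] {φ : E × E' → ℝ} (hφ : IsTest φ) : IsTest fun z : E' × E => φ (z.2, z.1) :=
  hφ.comp (contDiff_snd.prodMk contDiff_fst) fun R => ⟨R, fun z hz => by
    simpa only [Prod.norm_def, max_comm] using hz⟩

/-- The relation between a test function and a quadruple representing its mean. -/
def Represents {p₁ q₁ p₂ q₂ : ℕ} (f : Test (Space p₁ q₁ × Space p₂ q₂))
    (ψ : Fin 4 → Test (ℝ × ℝ)) : Prop :=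
  ∀ F : ℝ × ℝ → ℝ, Continuous F →
    ∫ z : Space p₁ q₁ × Space p₂ q₂, F (quadForm p₁ q₁ z.1, quadForm p₂ q₂ z.2) * f z
      = ∫ t : ℝ × ℝ, F t * assemble p₁ q₁ p₂ q₂ ψ t

variable {p₁ q₁ p₂ q₂ : ℕ}

/-- Take the mean in `x` with `y` as parameter, and the mean in `y` of both resulting coefficients
with `t₁` as parameter. -/
theorem exists_represents (hp₁ : 1 ≤ p₁) (hq₁ : 1 ≤ q₁) (hp₂ : 1 ≤ p₂) (hq₂ : 1 ≤ q₂)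
    (f : Test (Space p₁ q₁ × Space p₂ q₂)) : ∃ ψ, Represents f ψ := by
  obtain ⟨φ₀, φ₁, h0, h1, hF⟩ := exists_mean_single hp₁ hq₁ (isTest_coe f)
  obtain ⟨ψ₀, ψ₂, k0, k2, hF0⟩ := exists_mean_single hp₂ hq₂ (isTest_flip h0)
  obtain ⟨ψ₁, ψ₃, k1, k3, hF1⟩ := exists_mean_single hp₂ hq₂ (isTest_flip h1)
  refine ⟨![(isTest_flip k0).toTest, (isTest_flip k1).toTest, (isTest_flip k2).toTest,
    (isTest_flip k3).toTest], fun F hFc => ?_⟩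
  exact integral_two_forms (by omega) (by omega) (isTest_coe f) h0 h1
    (ψ := fun i => (![(isTest_flip k0).toTest, (isTest_flip k1).toTest, (isTest_flip k2).toTest,
    (isTest_flip k3).toTest] : Fin 4 → Test (ℝ × ℝ)) i) (fun i => isTest_coe _) hF
    (fun F hF t => hF0 F hF t) (fun F hF t => hF1 F hF t) hFc

/-- The lifts are made in the opposite order: the pairs `(ψ₀, ψ₂)` and `(ψ₁, ψ₃)` are lifted in `y`,
and the two results form a pair that is lifted in `x`. -/
theorem exists_of_represents (hp₁ : 1 ≤ p₁) (hq₁ : 1 ≤ q₁) (hp₂ : 1 ≤ p₂) (hq₂ : 1 ≤ q₂)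
    (ψ : Fin 4 → Test (ℝ × ℝ)) : ∃ f : Test (Space p₁ q₁ × Space p₂ q₂), Represents f ψ := by
  have hψ := fun i => isTest_coe (ψ i)
  obtain ⟨φ₀, h0, hF0⟩ := exists_of_mean_single hp₂ hq₂ (isTest_flip (hψ 0)) (isTest_flip (hψ 2))
  obtain ⟨φ₁, h1, hF1⟩ := exists_of_mean_single hp₂ hq₂ (isTest_flip (hψ 1)) (isTest_flip (hψ 3))
  obtain ⟨f, hf, hF⟩ := exists_of_mean_single hp₁ hq₁ (isTest_flip h0) (isTest_flip h1)
  refine ⟨hf.toTest, fun F hFc => ?_⟩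
  exact integral_two_forms (by omega) (by omega) hf (isTest_flip h0) (isTest_flip h1) hψ hF
    (fun F hF t => hF0 F hF t) (fun F hF t => hF1 F hF t) hFc

theorem isOpen_regSet : IsOpen regSet :=
  (isOpen_ne_fun continuous_fst continuous_const).inter
    (isOpen_ne_fun continuous_snd continuous_const)

theorem extendZero_of_mem (φ : Reg → ℝ) (t : Reg) : extendZero φ t = φ t :=
  Subtype.val_injective.extend_apply _ _ _

theorem ae_mem_regSet : ∀ᵐ t : ℝ × ℝ, t ∈ regSet := by
  have h : ∀ᵐ x : ℝ, x ≠ 0 := compl_mem_ae_iff.2 (measure_singleton (0 : ℝ))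
  have h1 : ∀ᵐ t : ℝ × ℝ, t.1 ≠ 0 := Measure.quasiMeasurePreserving_fst.ae h
  have h2 : ∀ᵐ t : ℝ × ℝ, t.2 ≠ 0 := Measure.quasiMeasurePreserving_snd.ae h
  filter_upwards [h1, h2] with t h1 h2 using ⟨h1, h2⟩

/-- Two integrable densities with the same integrals against test functions agree almost everywhere;
both are continuous on the open set `regSet`, so they agree there. -/
theorem IsMean.unique {f : Test (Space p₁ q₁ × Space p₂ q₂)} {g g' : Reg → ℝ} (h : IsMean f g)
    (h' : IsMean f g') : g = g' := by
  have h0 := ae_eq_zero_of_integral_contDiff_smul_eq_zero (μ := (volume : Measure (ℝ × ℝ)))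
    (f := fun t => extendZero g t - extendZero g' t) (h.2.1.sub h'.2.1).locallyIntegrable
    fun F hF hFc => by
      have e1 := h.2.2 ⟨F, hF, hFc, fun _ _ => trivial⟩
      have e2 := h'.2.2 ⟨F, hF, hFc, fun _ _ => trivial⟩
      have i : ∀ {k : Reg → ℝ}, Integrable (extendZero k) →
          Integrable fun t => F t * extendZero k t := fun hk => by
        simpa using hk.locallyIntegrable.integrable_smul_left_of_hasCompactSupport hF.continuous hFc
      simp only [smul_eq_mul, mul_sub]
      rw [integral_sub (i h.2.1) (i h'.2.1)]
      exact sub_eq_zero.2 (e1.symm.trans e2)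
  have h1 : extendZero g =ᵐ[volume.restrict regSet] extendZero g' :=
    ae_restrict_of_ae (h0.mono fun t ht => sub_eq_zero.1 ht)
  have h2 := Measure.eqOn_open_of_ae_eq h1 isOpen_regSet h.1.continuousOn h'.1.continuousOn
  funext t
  have := h2 t.2
  rwa [extendZero_of_mem, extendZero_of_mem] at this

theorem contDiffAt_assemble (h₁ : 2 ≤ p₁ + q₁) (h₂ : 2 ≤ p₂ + q₂) (ψ : Fin 4 → Test (ℝ × ℝ))
    {t : ℝ × ℝ} (ht : t ∈ regSet) : ContDiffAt ℝ ∞ (assemble p₁ q₁ p₂ q₂ ψ) t := by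
  have h1 : ContDiffAt ℝ ∞ (fun t : ℝ × ℝ => singularity p₁ q₁ t.1) t :=
    (contDiffAt_singularity h₁ ht.1).comp t contDiffAt_fst
  have h2 : ContDiffAt ℝ ∞ (fun t : ℝ × ℝ => singularity p₂ q₂ t.2) t :=
    (contDiffAt_singularity h₂ ht.2).comp t contDiffAt_snd
  have hψ := fun i => (isTest_coe (ψ i)).smooth.contDiffAt (x := t)
  exact (((hψ 0).add (h1.mul (hψ 1))).add (h2.mul (hψ 2))).add ((h1.mul h2).mul (hψ 3))

theorem integrable_assemble (h₁ : 2 ≤ p₁ + q₁) (h₂ : 2 ≤ p₂ + q₂) (ψ : Fin 4 → Test (ℝ × ℝ)) :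
    Integrable (assemble p₁ q₁ p₂ q₂ ψ) := by
  have hψ := fun i => isTest_coe (ψ i)
  have hF : Continuous fun _ : ℝ × ℝ => (1 : ℝ) := continuous_const
  have hj0 : Integrable fun t : ℝ × ℝ => 1 * ψ 0 t := integrable_mul_of_isTest volume (hψ 0) hF
  have hj1 := integrable_locallyIntegrable_mul (locallyIntegrable_singularity_fst h₁) hF (hψ 1)
  have hj2 := integrable_locallyIntegrable_mul
    (locallyIntegrable_singularity_snd (μ := (volume : Measure ℝ)) h₂) hF (hψ 2)
  have hj3 := integrable_locallyIntegrable_mul (locallyIntegrable_singularity_mul h₁ h₂) hF (hψ 3)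
  refine (((hj0.add hj1).add hj2).add hj3).congr (Eventually.of_forall fun z => ?_)
  simp only [Pi.add_apply, one_mul, assemble]

theorem Represents.isMean (h₁ : 2 ≤ p₁ + q₁) (h₂ : 2 ≤ p₂ + q₂)
    {f : Test (Space p₁ q₁ × Space p₂ q₂)} {ψ : Fin 4 → Test (ℝ × ℝ)} (h : Represents f ψ) :
    IsMean f fun t => assemble p₁ q₁ p₂ q₂ ψ t := by
  have he : EqOn (extendZero fun t => assemble p₁ q₁ p₂ q₂ ψ t) (assemble p₁ q₁ p₂ q₂ ψ) regSet :=
    fun t ht => extendZero_of_mem _ ⟨t, ht⟩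
  have hae : (extendZero fun t => assemble p₁ q₁ p₂ q₂ ψ t) =ᵐ[volume] assemble p₁ q₁ p₂ q₂ ψ :=
    ae_mem_regSet.mono fun t ht => he ht
  refine ⟨?_, (integrable_assemble h₁ h₂ ψ).congr hae.symm, fun F => ?_⟩
  · exact ContDiffOn.congr (fun t ht => (contDiffAt_assemble h₁ h₂ ψ ht).contDiffWithinAt) he
  · rw [h F F.continuous]
    exact integral_congr_ae (hae.mono fun t ht => by simp only [ht])

theorem isMean_mean (hp₁ : 1 ≤ p₁) (hq₁ : 1 ≤ q₁) (hp₂ : 1 ≤ p₂) (hq₂ : 1 ≤ q₂)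
    (f : Test (Space p₁ q₁ × Space p₂ q₂)) : IsMean f (mean f) := by
  obtain ⟨ψ, hψ⟩ := exists_represents hp₁ hq₁ hp₂ hq₂ f
  have h : ∃ g, IsMean f g := ⟨_, hψ.isMean (by omega) (by omega)⟩
  rw [mean, dif_pos h]
  exact h.choose_spec

theorem isMean_iff (hp₁ : 1 ≤ p₁) (hq₁ : 1 ≤ q₁) (hp₂ : 1 ≤ p₂) (hq₂ : 1 ≤ q₂)
    (f : Test (Space p₁ q₁ × Space p₂ q₂)) (g : Reg → ℝ) : IsMean f g ↔ g = mean f :=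
  ⟨fun h => h.unique (isMean_mean hp₁ hq₁ hp₂ hq₂ f),
    fun h => h ▸ isMean_mean hp₁ hq₁ hp₂ hq₂ f⟩

theorem Represents.mean_eq (hp₁ : 1 ≤ p₁) (hq₁ : 1 ≤ q₁) (hp₂ : 1 ≤ p₂) (hq₂ : 1 ≤ q₂)
    {f : Test (Space p₁ q₁ × Space p₂ q₂)} {ψ : Fin 4 → Test (ℝ × ℝ)} (h : Represents f ψ) :
    mean f = fun t : Reg => assemble p₁ q₁ p₂ q₂ ψ t :=
  ((isMean_iff hp₁ hq₁ hp₂ hq₂ f _).1 (h.isMean (by omega) (by omega))).symm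

theorem mean_mem (hp₁ : 1 ≤ p₁) (hq₁ : 1 ≤ q₁) (hp₂ : 1 ≤ p₂) (hq₂ : 1 ≤ q₂)
    (f : Test (Space p₁ q₁ × Space p₂ q₂)) : mean f ∈ singularSpace p₁ q₁ p₂ q₂ := by
  obtain ⟨ψ, hψ⟩ := exists_represents hp₁ hq₁ hp₂ hq₂ f
  exact ⟨ψ, fun t => congrFun (hψ.mean_eq hp₁ hq₁ hp₂ hq₂) t⟩

theorem exists_mean_eq (hp₁ : 1 ≤ p₁) (hq₁ : 1 ≤ q₁) (hp₂ : 1 ≤ p₂) (hq₂ : 1 ≤ q₂)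
    (φ : singularSpace p₁ q₁ p₂ q₂) :
    ∃ f : Test (Space p₁ q₁ × Space p₂ q₂), mean f = φ.1 := by
  obtain ⟨ψ, hψ⟩ := φ.2
  obtain ⟨f, hf⟩ := exists_of_represents hp₁ hq₁ hp₂ hq₂ ψ
  exact ⟨f, by rw [hf.mean_eq hp₁ hq₁ hp₂ hq₂]; exact funext fun t => (hψ t).symm⟩

end TwoForms

end

end OrbitalMean


namespace OrbitalMean

noncomputable section


/-! ### The open mapping theorem for complete metrizable spaces -/

section OpenMapping

variable {X Y : Type} [AddCommGroup X] [UniformSpace X] [IsUniformAddGroup X]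
  [AddCommGroup Y] [TopologicalSpace Y] [IsTopologicalAddGroup Y]

/-- The substitute for a geometric series: halving neighbourhoods absorb finite sums taken from
successive levels. -/
theorem sum_range_mem_of_add_subset {X : Type} [AddCommGroup X] {v : ℕ → Set X} (h0 : ∀ n, 0 ∈ v n)
    (hv : ∀ n, ∀ a ∈ v (n + 1), ∀ b ∈ v (n + 1), a + b ∈ v n) {x : ℕ → X}
    (hx : ∀ n, x n ∈ v (n + 1)) (k : ℕ) : ∀ m, ∑ i ∈ Finset.range k, x (m + i) ∈ v m := by
  induction k with
  | zero => intro m; simpa using h0 m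
  | succ k ih =>
    intro m
    rw [Finset.sum_range_succ']
    refine hv m _ ?_ _ (by simpa using hx m)
    simpa only [add_assoc, add_comm, add_left_comm] using ih (m + 1)

open scoped Pointwise

/-- A continuous almost open homomorphism from a complete metrizable group is open. -/
theorem image_mem_nhds_of_closure [CompleteSpace X] [FirstCountableTopology X] [T2Space Y]
    (π : X →+ Y) (hπ : Continuous π) (hcl : ∀ V ∈ 𝓝 (0 : X), closure (π '' V) ∈ 𝓝 (0 : Y))
    {U : Set X} (hU : U ∈ 𝓝 (0 : X)) : π '' U ∈ 𝓝 (0 : Y) := by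
  obtain ⟨u, hu, huu⟩ := IsTopologicalAddGroup.exists_antitone_basis_nhds_zero X
  obtain ⟨C, hC, hCc, hCU⟩ := exists_mem_nhds_isClosed_subset hU
  obtain ⟨m, -, hm⟩ := hu.1.mem_iff.1 hC
  set v : ℕ → Set X := fun n => u (m + n) with hv
  have hvn : ∀ n, v n ∈ 𝓝 (0 : X) := fun n => hu.1.mem_of_mem trivial
  have hv0 : ∀ n, (0 : X) ∈ v n := fun n => mem_of_mem_nhds (hvn n)
  have hvv : ∀ n, ∀ a ∈ v (n + 1), ∀ b ∈ v (n + 1), a + b ∈ v n := fun n a ha b hb =>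
    huu (m + n) (add_mem_add ha hb)
  have hvb : ∀ V ∈ 𝓝 (0 : X), ∃ n, v n ⊆ V := fun V hV => by
    obtain ⟨k, -, hk⟩ := hu.1.mem_iff.1 hV
    exact ⟨k, (hu.2 (Nat.le_add_left k m)).trans hk⟩
  refine mem_of_superset (hcl (v 1) (hvn 1)) fun y hy => ?_
  -- Almost openness improves an approximation: a residual in one closure is reduced to a residual
  -- in the next by an element of `v (n + 1)`. The corrections sum to a preimage of `y`.
  have step : ∀ (n : ℕ) (r : Y), r ∈ closure (π '' v (n + 1)) →
      ∃ x, x ∈ v (n + 1) ∧ r - π x ∈ closure (π '' v (n + 2)) := by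
    intro n r hr
    have hN : {a : Y | r - a ∈ closure (π '' v (n + 2))} ∈ 𝓝 r := by
      have hc : Continuous fun a : Y => r - a := by fun_prop
      exact hc.continuousAt (by simpa using hcl _ (hvn (n + 2)))
    obtain ⟨_, ha, x, hx, rfl⟩ := mem_closure_iff_nhds.1 hr _ hN
    exact ⟨x, hx, ha⟩
  choose! g hg hg' using step
  let r : ℕ → Y := fun n => Nat.rec y (fun n s => s - π (g n s)) n
  have hr : ∀ n, r n ∈ closure (π '' v (n + 1)) := by
    intro n
    induction n with
    | zero => exact hy
    | succ n ih => exact hg' n (r n) ih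
  let x : ℕ → X := fun n => g n (r n)
  have hx : ∀ n, x n ∈ v (n + 1) := fun n => hg n _ (hr n)
  have hrs : ∀ n, r n = y - π (∑ i ∈ Finset.range n, x i) := by
    intro n
    induction n with
    | zero => simp [r]
    | succ n ih =>
      have h1 : r (n + 1) = r n - π (x n) := rfl
      rw [h1, ih, Finset.sum_range_succ, map_add, sub_sub]
  have hsum := sum_range_mem_of_add_subset hv0 hvv hx
  have hcs : CauchySeq fun n => ∑ i ∈ Finset.range n, x i := by
    refine cauchySeq_of_controlled (fun n => {p | ∃ a ∈ v n, ∃ b ∈ v n, p.2 - p.1 = b - a})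
      (fun S hS => ?_) fun N k l hk hl => ?_
    · rw [uniformity_eq_comap_nhds_zero X, mem_comap] at hS
      obtain ⟨W, hW, hWS⟩ := hS
      have h : (fun z : X × X => z.2 - z.1) ⁻¹' W ∈ 𝓝 ((0 : X), (0 : X)) := by
        have hc : Continuous fun z : X × X => z.2 - z.1 := by fun_prop
        exact hc.continuousAt (by simpa using hW)
      rw [nhds_prod_eq, mem_prod_same_iff] at h
      obtain ⟨W', hW', h⟩ := h
      obtain ⟨n, hn⟩ := hvb W' hW'
      refine ⟨n, fun p ⟨a, ha, b, hb, hp⟩ => hWS ?_⟩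
      rw [mem_preimage, hp]
      exact h (mk_mem_prod (hn ha) (hn hb))
    · obtain ⟨k, rfl⟩ := Nat.exists_eq_add_of_le hk
      obtain ⟨l, rfl⟩ := Nat.exists_eq_add_of_le hl
      refine ⟨_, hsum k N, _, hsum l N, ?_⟩
      simp only [Finset.sum_range_add]
      abel
  obtain ⟨s, hs⟩ := cauchySeq_tendsto_of_complete hcs
  refine ⟨s, hCU (hCc.mem_of_tendsto hs (Eventually.of_forall fun n => hm ?_)), ?_⟩
  · simpa only [hv, zero_add, add_zero] using hsum n 0
  · have h1 : Tendsto r atTop (𝓝 (y - π s)) := by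
      refine Tendsto.congr (fun n => (hrs n).symm) ?_
      exact tendsto_const_nhds.sub ((hπ.tendsto s).comp hs)
    -- Continuity of `π` puts the images of small `v n`, and their closures, inside any closed
    -- neighbourhood of `0`.
    have h2 : Tendsto r atTop (𝓝 0) := by
      rw [(closed_nhds_basis (0 : Y)).tendsto_right_iff]
      rintro N ⟨hN, hNc⟩
      obtain ⟨k, hk⟩ := hvb _ (hπ.continuousAt (x := 0) (by simpa using hN))
      filter_upwards [eventually_ge_atTop k] with n hn
      refine (closure_minimal ?_ hNc) (hr n)
      refine image_subset_iff.2 (Subset.trans ?_ hk)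
      exact hu.2 (by omega)
    exact (sub_eq_zero.1 (tendsto_nhds_unique h1 h2)).symm

/-- Baire: the dilates of `closure (π '' W)` cover `Y`, so one of them, hence the set itself, has an
interior point. Differences of its points lie in `closure (π '' V)` when `W - W ⊆ V`. -/
theorem closure_image_mem_nhds [Module ℝ X] [ContinuousSMul ℝ X] [Module ℝ Y] [ContinuousSMul ℝ Y]
    [BaireSpace Y] (π : X →ₗ[ℝ] Y) (hπs : Function.Surjective π) {V : Set X}
    (hV : V ∈ 𝓝 (0 : X)) : closure (π '' V) ∈ 𝓝 (0 : Y) := by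
  obtain ⟨W, hW, hWV⟩ : ∃ W ∈ 𝓝 (0 : X), ∀ a ∈ W, ∀ b ∈ W, a - b ∈ V := by
    have h : (fun z : X × X => z.1 - z.2) ⁻¹' V ∈ 𝓝 ((0 : X), (0 : X)) := by
      have hc : Continuous fun z : X × X => z.1 - z.2 := by fun_prop
      exact hc.continuousAt (by simpa using hV)
    rw [nhds_prod_eq, mem_prod_same_iff] at h
    obtain ⟨W, hW, h⟩ := h
    exact ⟨W, hW, fun a ha b hb => h (mk_mem_prod ha hb)⟩
  have hun : ⋃ n : ℕ, (((n : ℝ) + 1) • closure (π '' W)) = univ := by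
    refine eq_univ_of_forall fun y => ?_
    obtain ⟨x, rfl⟩ := hπs y
    have h1 : Tendsto (fun n : ℕ => ((n : ℝ) + 1)⁻¹ • x) atTop (𝓝 0) := by
      have := (tendsto_one_div_add_atTop_nhds_zero_nat (𝕜 := ℝ)).smul_const x
      simpa using this
    obtain ⟨n, hn⟩ := (h1.eventually hW).exists
    refine mem_iUnion.2 ⟨n, ?_⟩
    have h0 : ((n : ℝ) + 1) ≠ 0 := by positivity
    rw [mem_smul_set_iff_inv_smul_mem₀ h0, ← map_smul]
    exact subset_closure ⟨_, hn, rfl⟩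
  obtain ⟨n, y, hy⟩ := nonempty_interior_of_iUnion_of_closed
    (fun n : ℕ => isClosed_closure.smul_of_ne_zero (c := (n : ℝ) + 1) (by positivity)) hun
  have h0 : ((n : ℝ) + 1) ≠ 0 := by positivity
  rw [interior_smul₀ h0] at hy
  obtain ⟨z, hz, -⟩ := hy
  have h1 : {a : Y | z + a ∈ closure (π '' W)} ∈ 𝓝 (0 : Y) := by
    have hc : Continuous fun a : Y => z + a := by fun_prop
    exact hc.continuousAt (by simpa using mem_interior_iff_mem_nhds.1 hz)
  refine mem_of_superset h1 fun a ha => ?_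
  have h2 : ∀ b ∈ closure (π '' W), ∀ c ∈ closure (π '' W), b - c ∈ closure (π '' V) :=
    fun b hb c hc => map_mem_closure₂ continuous_sub hb hc (by
      rintro _ ⟨b, hb, rfl⟩ _ ⟨c, hc, rfl⟩
      exact ⟨b - c, hWV b hb c hc, map_sub π b c⟩)
  simpa using h2 _ ha _ (interior_subset hz)

/-- The open mapping theorem for Fréchet spaces. -/
theorem image_mem_nhds_of_surjective [Module ℝ X] [ContinuousSMul ℝ X] [Module ℝ Y]
    [ContinuousSMul ℝ Y] [BaireSpace Y] [CompleteSpace X] [FirstCountableTopology X] [T2Space Y]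
    (π : X →ₗ[ℝ] Y) (hπ : Continuous π) (hπs : Function.Surjective π) {U : Set X}
    (hU : U ∈ 𝓝 (0 : X)) : π '' U ∈ 𝓝 (0 : Y) :=
  image_mem_nhds_of_closure π.toAddMonoidHom hπ
    (fun _ hV => closure_image_mem_nhds π hπs hV) hU

end OpenMapping

/-! ### Completeness of the spaces of functions with fixed support -/

section Completeness

open scoped Distributions

variable {E : Type} [NormedAddCommGroup E] [NormedSpace ℝ E] {K : Compacts E}

/-- If all derivatives of a sequence converge uniformly, the limits are the derivatives of the limit
function, and the support condition passes to the limit. -/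
theorem isClosed_range_pi_structureMapCLM : IsClosed (range
    (ContinuousLinearMap.pi (ContDiffMapSupportedIn.structureMapCLM ℝ ⊤) :
      ContDiffMapSupportedIn E ℝ ⊤ K →L[ℝ] Π i, BoundedContinuousFunction E (E [×i]→L[ℝ] ℝ))) := by
  refine IsSeqClosed.isClosed fun f g hf hg => ?_
  choose φ hφ using hf
  have h1 : ∀ n i x, f n i x = iteratedFDeriv ℝ i (φ n) x := fun n i x => by
    rw [← hφ n]
    exact congrFun (ContDiffMapSupportedIn.structureMapCLM_top_apply ℝ (φ n)) x
  have h2 : ∀ i, TendstoUniformly (fun n x => f n i x) (g i) atTop := fun i =>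
    BoundedContinuousFunction.tendsto_iff_tendstoUniformly.1 ((tendsto_pi_nhds.1 hg) i)
  let g0 : E → ℝ := fun x => (g 0 x).curry0
  have hT : HasFTaylorSeriesUpTo (⊤ : ℕ∞) g0 (fun x i => g i x) := by
    refine ⟨fun x => rfl, fun m hm x => ?_, fun m hm => (g m).continuous⟩
    have hu : TendstoUniformly (fun n x => (f n (m + 1) x).curryLeft)
        (fun x => (g (m + 1) x).curryLeft) atTop :=
      ((continuousMultilinearCurryLeftEquiv ℝ (fun _ : Fin (m + 1) => E)
        ℝ).isometry.uniformContinuous).comp_tendstoUniformly (h2 (m + 1))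
    refine hasFDerivAt_of_tendstoUniformly hu (f := fun n x => f n m x) (fun n x => ?_)
      (fun x => (h2 m).tendsto_at x) x
    simp only [h1]
    have h3 := ((φ n).contDiff.ftaylorSeries (𝕜 := ℝ)).fderiv m
      (by exact_mod_cast WithTop.coe_lt_top _) x
    exact h3
  have hz : ∀ x ∉ K, g0 x = 0 := fun x hx => by
    have h3 : g 0 x = 0 := by
      refine tendsto_nhds_unique ((h2 0).tendsto_at x) ?_
      simp only [h1]
      refine tendsto_const_nhds.congr fun n => ?_
      ext v
      simpa using ((φ n).zero_on_compl hx).symm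
    simp only [g0, h3]
    rfl
  refine ⟨⟨g0, hT.contDiff, fun x hx => hz x hx⟩, ?_⟩
  funext i
  ext1 x
  have h4 := congrFun (ContDiffMapSupportedIn.structureMapCLM_top_apply ℝ (i := i)
    (⟨g0, hT.contDiff, fun x hx => hz x hx⟩ : ContDiffMapSupportedIn E ℝ ⊤ K)) x
  exact h4.trans (hT.eq_iteratedFDeriv (by exact_mod_cast le_top) x).symm

/-- The map to all derivatives is a uniform embedding into a complete product, with closed range. -/
instance : CompleteSpace (ContDiffMapSupportedIn E ℝ ⊤ K) :=
  (completeSpace_iff_isComplete_range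
    (ContDiffMapSupportedIn.isUniformEmbedding_pi_structureMapCLM ℝ).isUniformInducing).2
    isClosed_range_pi_structureMapCLM.isComplete

instance : (uniformity (ContDiffMapSupportedIn E ℝ ⊤ K)).IsCountablyGenerated := by
  rw [← (ContDiffMapSupportedIn.isUniformEmbedding_pi_structureMapCLM
    (E := E) (F := ℝ) (n := ⊤) (K := K) ℝ).comap_uniformity]
  infer_instance

end Completeness

end

end OrbitalMean


namespace OrbitalMean

noncomputable section


/-! ### Small test functions have small representing quadruples -/

section SmallRepresentatives

/-- The inclusion of the functions supported in `K` into the test functions. -/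
abbrev inclTest {E : Type} [NormedAddCommGroup E] [NormedSpace ℝ E] (K : Compacts E) :
    ContDiffMapSupportedIn E ℝ ⊤ K →L[ℝ] Test E :=
  TestFunction.ofSupportedInCLM ℝ fun _ _ => trivial

/-- The weights of the four terms of `assemble`. -/
def weight (p₁ q₁ p₂ q₂ : ℕ) : Fin 4 → ℝ × ℝ → ℝ :=
  ![fun _ => 1, fun t => singularity p₁ q₁ t.1, fun t => singularity p₂ q₂ t.2,
    fun t => singularity p₁ q₁ t.1 * singularity p₂ q₂ t.2]

variable {p₁ q₁ p₂ q₂ : ℕ}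

theorem assemble_eq_sum (ψ : Fin 4 → Test (ℝ × ℝ)) (t : ℝ × ℝ) :
    assemble p₁ q₁ p₂ q₂ ψ t = ∑ i, weight p₁ q₁ p₂ q₂ i t * ψ i t := by
  simp [Fin.sum_univ_four, weight, assemble]

theorem locallyIntegrable_weight (h₁ : 2 ≤ p₁ + q₁) (h₂ : 2 ≤ p₂ + q₂) (i : Fin 4) :
    LocallyIntegrable (weight p₁ q₁ p₂ q₂ i) := by
  fin_cases i
  · exact locallyIntegrable_const 1
  · exact locallyIntegrable_singularity_fst h₁
  · exact locallyIntegrable_singularity_snd (μ := (volume : Measure ℝ)) h₂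
  · exact locallyIntegrable_singularity_mul h₁ h₂

theorem integral_mul_assemble (h₁ : 2 ≤ p₁ + q₁) (h₂ : 2 ≤ p₂ + q₂) {F : ℝ × ℝ → ℝ}
    (hF : Continuous F) (ψ : Fin 4 → Test (ℝ × ℝ)) :
    ∫ t : ℝ × ℝ, F t * assemble p₁ q₁ p₂ q₂ ψ t
      = ∑ i, ∫ t : ℝ × ℝ, ψ i t * (F t * weight p₁ q₁ p₂ q₂ i t) := by
  rw [← integral_finsetSum]
  · refine integral_congr_ae (Eventually.of_forall fun t => ?_)
    simp only [assemble_eq_sum, Finset.mul_sum]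
    exact Finset.sum_congr rfl fun i _ => by ring
  · intro i _
    refine (integrable_locallyIntegrable_mul (locallyIntegrable_weight h₁ h₂ i) hF
      (isTest_coe (ψ i))).congr (Eventually.of_forall fun t => ?_)
    simp only
    ring

/-- Integration against a locally integrable function. -/
def integralCLM {E : Type} [NormedAddCommGroup E] [NormedSpace ℝ E] [MeasurableSpace E]
    [OpensMeasurableSpace E] (μ : Measure E) (w : E → ℝ) : Test E →L[ℝ] ℝ :=
  TestFunction.integralAgainstBilinCLM (ContinuousLinearMap.mul ℝ ℝ) μ w

theorem integralCLM_apply {E : Type} [NormedAddCommGroup E] [NormedSpace ℝ E] [MeasurableSpace E]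
    [OpensMeasurableSpace E] {μ : Measure E} {w : E → ℝ} (hw : LocallyIntegrable w μ)
    (f : Test E) : integralCLM μ w f = ∫ x, f x * w x ∂μ :=
  TestFunction.integralAgainstBilinCLM_eq_integral (hw.locallyIntegrableOn _)

/-- The difference of the two sides of the identity that defines `Represents`. -/
def representsDefect (p₁ q₁ p₂ q₂ : ℕ) (K : Compacts (Space p₁ q₁ × Space p₂ q₂))
    (K' : Compacts (ℝ × ℝ)) (F : C(ℝ × ℝ, ℝ)) :
    (ContDiffMapSupportedIn (Space p₁ q₁ × Space p₂ q₂) ℝ ⊤ K ×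
      (Fin 4 → ContDiffMapSupportedIn (ℝ × ℝ) ℝ ⊤ K')) →L[ℝ] ℝ :=
  ((integralCLM volume fun z : Space p₁ q₁ × Space p₂ q₂ =>
      F (quadForm p₁ q₁ z.1, quadForm p₂ q₂ z.2)).comp (inclTest K)).comp
        (ContinuousLinearMap.fst ℝ _ _)
    - ∑ i, ((integralCLM volume fun t => F t * weight p₁ q₁ p₂ q₂ i t).comp (inclTest K')).comp
        ((ContinuousLinearMap.proj i).comp (ContinuousLinearMap.snd ℝ _ _))

theorem representsDefect_eq_zero_iff (h₁ : 2 ≤ p₁ + q₁) (h₂ : 2 ≤ p₂ + q₂)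
    {K : Compacts (Space p₁ q₁ × Space p₂ q₂)} {K' : Compacts (ℝ × ℝ)}
    (z : ContDiffMapSupportedIn (Space p₁ q₁ × Space p₂ q₂) ℝ ⊤ K ×
      (Fin 4 → ContDiffMapSupportedIn (ℝ × ℝ) ℝ ⊤ K')) :
    (∀ F, representsDefect p₁ q₁ p₂ q₂ K K' F z = 0) ↔
      Represents (inclTest K z.1) fun i => inclTest K' (z.2 i) := by
  have hQ : Continuous fun z : Space p₁ q₁ × Space p₂ q₂ =>
      (quadForm p₁ q₁ z.1, quadForm p₂ q₂ z.2) :=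
    ((contDiff_quadForm p₁ q₁).continuous.comp continuous_fst).prodMk
      ((contDiff_quadForm p₂ q₂).continuous.comp continuous_snd)
  have key : ∀ F : C(ℝ × ℝ, ℝ), representsDefect p₁ q₁ p₂ q₂ K K' F z
      = (∫ x : Space p₁ q₁ × Space p₂ q₂,
          F (quadForm p₁ q₁ x.1, quadForm p₂ q₂ x.2) * inclTest K z.1 x)
        - ∫ t : ℝ × ℝ, F t * assemble p₁ q₁ p₂ q₂ (fun i => inclTest K' (z.2 i)) t := by
    intro F
    have hw : ∀ i, LocallyIntegrable fun t => F t * weight p₁ q₁ p₂ q₂ i t := fun i =>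
      (locallyIntegrable_weight h₁ h₂ i).continuous_mul F.continuous
    have hz : integralCLM volume (fun z : Space p₁ q₁ × Space p₂ q₂ =>
        F (quadForm p₁ q₁ z.1, quadForm p₂ q₂ z.2)) (inclTest K z.1)
        = ∫ x : Space p₁ q₁ × Space p₂ q₂,
          F (quadForm p₁ q₁ x.1, quadForm p₂ q₂ x.2) * inclTest K z.1 x := by
      rw [integralCLM_apply (w := fun z : Space p₁ q₁ × Space p₂ q₂ =>
        F (quadForm p₁ q₁ z.1, quadForm p₂ q₂ z.2)) (F.continuous.comp hQ).locallyIntegrable]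
      simp only [mul_comm]
    rw [integral_mul_assemble h₁ h₂ F.continuous, ← hz]
    simp only [representsDefect, _root_.sub_apply, _root_.sum_apply,
      ContinuousLinearMap.comp_apply, integralCLM_apply (hw _)]
    rfl
  simp only [key, sub_eq_zero, Represents]
  exact ⟨fun h F hF => h ⟨F, hF⟩, fun h F => h F F.continuous⟩

/-- A representing quadruple may be multiplied by a cutoff equal to `1` on the image of `K` under
the two forms: the cutoff can be shifted to `F`, which ranges over all continuous functions. This
makes the support uniform in `f`. -/
theorem exists_represents_supported (hp₁ : 1 ≤ p₁) (hq₁ : 1 ≤ q₁) (hp₂ : 1 ≤ p₂) (hq₂ : 1 ≤ q₂)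
    (K : Compacts (Space p₁ q₁ × Space p₂ q₂)) : ∃ K' : Compacts (ℝ × ℝ),
    ∀ f : ContDiffMapSupportedIn (Space p₁ q₁ × Space p₂ q₂) ℝ ⊤ K,
    ∃ ψ : Fin 4 → ContDiffMapSupportedIn (ℝ × ℝ) ℝ ⊤ K',
      Represents (inclTest K f) fun i => inclTest K' (ψ i) := by
  have hQ : Continuous fun z : Space p₁ q₁ × Space p₂ q₂ =>
      (quadForm p₁ q₁ z.1, quadForm p₂ q₂ z.2) :=
    ((contDiff_quadForm p₁ q₁).continuous.comp continuous_fst).prodMk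
      ((contDiff_quadForm p₂ q₂).continuous.comp continuous_snd)
  obtain ⟨R, hR0, hR⟩ := (K.isCompact.image hQ).isBounded.exists_pos_norm_le
  let ρ : ContDiffBump (0 : ℝ × ℝ) := ⟨R, R + 1, hR0, by linarith⟩
  have hρ : ContDiff ℝ ∞ ρ := ρ.contDiff
  have hρ1 : ∀ z ∈ K, ρ (quadForm p₁ q₁ z.1, quadForm p₂ q₂ z.2) = 1 := fun z hz =>
    ρ.one_of_mem_closedBall (by simpa using hR _ (mem_image_of_mem _ hz))
  refine ⟨⟨tsupport ρ, ρ.hasCompactSupport⟩, fun f => ?_⟩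
  obtain ⟨ψ, hψ⟩ := exists_represents hp₁ hq₁ hp₂ hq₂ (inclTest K f)
  refine ⟨fun i => ⟨fun t => ρ t * ψ i t, hρ.mul (ψ i).contDiff, fun t ht => ?_⟩, fun F hF => ?_⟩
  · have : ρ t = 0 := image_eq_zero_of_notMem_tsupport ht
    simp [this]
  · have h := hψ (fun t => F t * ρ t) (hF.mul hρ.continuous)
    refine Eq.trans (integral_congr_ae (Eventually.of_forall fun z => ?_)) (h.trans
      (integral_congr_ae (Eventually.of_forall fun t => ?_)))
    · by_cases hz : z ∈ K
      · simp only [hρ1 z hz, mul_one]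
      · have : inclTest K f z = 0 := f.zero_on_compl hz
        simp only [this, mul_zero]
    · simp only [assemble]
      change F t * ρ t * _ = F t * (ρ t * ψ 0 t + _ * (ρ t * ψ 1 t) + _ * (ρ t * ψ 2 t)
        + _ * (ρ t * ψ 3 t))
      ring

/-- Small test functions have small representations. -/
theorem exists_small_represents (hp₁ : 1 ≤ p₁) (hq₁ : 1 ≤ q₁) (hp₂ : 1 ≤ p₂) (hq₂ : 1 ≤ q₂)
    (K : Compacts (Space p₁ q₁ × Space p₂ q₂)) : ∃ K' : Compacts (ℝ × ℝ),
    (∀ f : ContDiffMapSupportedIn (Space p₁ q₁ × Space p₂ q₂) ℝ ⊤ K,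
      ∃ ψ : Fin 4 → ContDiffMapSupportedIn (ℝ × ℝ) ℝ ⊤ K',
        Represents (inclTest K f) fun i => inclTest K' (ψ i)) ∧
    ∀ U ∈ 𝓝 (0 : Fin 4 → ContDiffMapSupportedIn (ℝ × ℝ) ℝ ⊤ K'),
      ∀ᶠ f in 𝓝 (0 : ContDiffMapSupportedIn (Space p₁ q₁ × Space p₂ q₂) ℝ ⊤ K),
        ∃ ψ ∈ U, Represents (inclTest K f) fun i => inclTest K' (ψ i) := by
  obtain ⟨K', hK'⟩ := exists_represents_supported hp₁ hq₁ hp₂ hq₂ K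
  refine ⟨K', hK', fun U hU => ?_⟩
  -- The graph of the relation is an intersection of kernels of continuous functionals, so it is
  -- closed and complete. Its projection to `f` is onto by `hK'`, hence open. No continuous linear
  -- choice of `ψ` is needed.
  let Z : Submodule ℝ (ContDiffMapSupportedIn (Space p₁ q₁ × Space p₂ q₂) ℝ ⊤ K ×
      (Fin 4 → ContDiffMapSupportedIn (ℝ × ℝ) ℝ ⊤ K')) :=
    ⨅ F, LinearMap.ker (representsDefect p₁ q₁ p₂ q₂ K K' F).toLinearMap
  have hZm : ∀ z, z ∈ Z ↔ Represents (inclTest K z.1) fun i => inclTest K' (z.2 i) := fun z => by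
    rw [← representsDefect_eq_zero_iff (by omega) (by omega)]
    simp [Z, Submodule.mem_iInf]
  have hZ : IsClosed (Z : Set (ContDiffMapSupportedIn (Space p₁ q₁ × Space p₂ q₂) ℝ ⊤ K ×
      (Fin 4 → ContDiffMapSupportedIn (ℝ × ℝ) ℝ ⊤ K'))) := by
    simp only [Z, Submodule.coe_iInf]
    exact isClosed_iInter fun F => (representsDefect p₁ q₁ p₂ q₂ K K' F).isClosed_ker
  have : CompleteSpace Z := hZ.completeSpace_coe
  have : IsUniformAddGroup Z := Z.toAddSubgroup.isUniformAddGroup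
  have : (uniformity Z).IsCountablyGenerated := comap.isCountablyGenerated _ _
  have : FirstCountableTopology Z := UniformSpace.firstCountableTopology Z
  have h := image_mem_nhds_of_surjective (X := Z) ((LinearMap.fst ℝ _ _).comp Z.subtype)
    (continuous_fst.comp continuous_subtype_val) (fun f => by
      obtain ⟨ψ, hψ⟩ := hK' f
      exact ⟨⟨(f, ψ), (hZm _).2 hψ⟩, rfl⟩)
    (U := {z : Z | z.1.2 ∈ U})
    ((continuous_snd.comp continuous_subtype_val).continuousAt hU)
  filter_upwards [h] with f hf
  obtain ⟨z, hz, rfl⟩ := hf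
  exact ⟨z.1.2, hz, (hZm _).1 z.2⟩

end SmallRepresentatives

end

end OrbitalMean


namespace OrbitalMean

noncomputable section


/-! ### Finite smoothness of powers times singularities -/

section FiniteSmoothness

/-- A function `t * c t` with derivative `a * c + b` is as smooth as `c` and `b` allow. -/
theorem hasDerivAt_of_eq_mul {f c d : ℝ → ℝ} (hf : ∀ t, f t = t * c t) (hc : ContinuousAt c 0)
    (hd0 : d 0 = c 0) (hd : ∀ t ≠ 0, HasDerivAt f (d t) t) (t : ℝ) : HasDerivAt f (d t) t := by
  rcases eq_or_ne t 0 with rfl | ht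
  · rw [hasDerivAt_iff_tendsto_slope, hd0]
    refine (hc.tendsto.mono_left nhdsWithin_le_nhds).congr' ?_
    filter_upwards [self_mem_nhdsWithin] with s hs
    have hs : s ≠ 0 := hs
    rw [slope_def_field, hf s, hf 0, zero_mul, sub_zero, sub_zero, mul_div_cancel_left₀ _ hs]
  · exact hd t ht

theorem contDiff_succ_of_hasDerivAt {f d : ℝ → ℝ} {m : ℕ} (h : ∀ t, HasDerivAt f (d t) t)
    (hd : ContDiff ℝ m d) : ContDiff ℝ (m + 1 : ℕ) f := by
  have h1 : deriv f = d := funext fun t => (h t).deriv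
  push_cast
  rw [contDiff_succ_iff_deriv]
  exact ⟨fun t => (h t).differentiableAt, by simp, by rwa [h1]⟩

theorem halfPow_zero (s : ℝ) : halfPow s 0 = 0 := if_neg (lt_irrefl 0)

theorem mul_halfPow (s t : ℝ) : halfPow (s + 1) t = t * halfPow s t := by
  unfold halfPow
  split_ifs with h
  · rw [Real.rpow_add_one h.ne', mul_comm]
  · rw [mul_zero]

theorem pow_mul_halfPow (N : ℕ) (s t : ℝ) : t ^ N * halfPow s t = halfPow (s + N) t := by
  induction N with
  | zero => simp
  | succ N ih =>
    rw [pow_succ', mul_assoc, ih, ← mul_halfPow]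
    push_cast
    rw [add_assoc]

theorem continuous_halfPow {s : ℝ} (hs : 0 < s) : Continuous (halfPow s) := by
  have h : halfPow s = fun t => (max t 0) ^ s := by
    funext t
    unfold halfPow
    split_ifs with h
    · rw [max_eq_left h.le]
    · rw [max_eq_right (not_lt.1 h), Real.zero_rpow hs.ne']
  rw [h]
  exact (continuous_id.max continuous_const).rpow_const fun _ => Or.inr hs.le

/-- Induction: the derivative is `s * halfPow (s - 1)`, also at `0`, because `halfPow s t = t *
halfPow (s - 1) t` with a continuous second factor. -/
theorem contDiff_halfPow (m : ℕ) {s : ℝ} (hs : (m : ℝ) < s) : ContDiff ℝ m (halfPow s) := by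
  induction m generalizing s with
  | zero => exact contDiff_zero.2 (continuous_halfPow (by exact_mod_cast hs))
  | succ m ih =>
    push_cast at hs
    have hs0 : 0 < s - 1 := by linarith [(Nat.cast_nonneg m : (0 : ℝ) ≤ m)]
    refine contDiff_succ_of_hasDerivAt (d := fun t => s * halfPow (s - 1) t)
      (hasDerivAt_of_eq_mul (c := halfPow (s - 1)) (fun t => ?_)
        (continuous_halfPow hs0).continuousAt (by simp [halfPow_zero]) fun t ht => ?_)
      (contDiff_const.mul (ih (by linarith)))
    · rw [← mul_halfPow, sub_add_cancel]
    · rcases lt_or_gt_of_ne ht with h | h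
      · refine (hasDerivAt_const t (0 : ℝ)).congr_of_eventuallyEq ?_ |>.congr_deriv ?_
        · filter_upwards [gt_mem_nhds h] with x hx
          exact if_neg (not_lt.2 hx.le)
        · simp [halfPow, not_lt.2 h.le]
      · refine ((Real.hasDerivAt_rpow_const (p := s) (Or.inl ht)).congr_of_eventuallyEq ?_
          ).congr_deriv ?_
        · filter_upwards [lt_mem_nhds h] with x hx
          exact if_pos hx
        · simp [halfPow, h]

theorem contDiff_pow_mul_log (m : ℕ) {M : ℕ} (hM : m < M) :
    ContDiff ℝ m fun t : ℝ => t ^ M * Real.log t := by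
  have hc : ∀ M : ℕ, Continuous fun t : ℝ => t ^ (M + 1) * Real.log t := fun M => by
    have : (fun t : ℝ => t ^ (M + 1) * Real.log t) = fun t => t ^ M * (t * Real.log t) := by
      funext t
      ring
    rw [this]
    exact (continuous_pow M).mul Real.continuous_mul_log
  induction m generalizing M with
  | zero =>
    obtain ⟨M, rfl⟩ := Nat.exists_eq_succ_of_ne_zero hM.ne'
    exact contDiff_zero.2 (hc M)
  | succ m ih =>
    obtain ⟨M, rfl⟩ := Nat.exists_eq_add_of_le' (show 2 ≤ M by omega)
    refine contDiff_succ_of_hasDerivAt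
      (d := fun t => ((M + 2 : ℕ) : ℝ) * (t ^ (M + 1) * Real.log t) + t ^ (M + 1))
      (hasDerivAt_of_eq_mul (c := fun t => t ^ (M + 1) * Real.log t) (fun t => by ring)
        (hc M).continuousAt (by simp) fun t ht => ?_)
      ((contDiff_const.mul (ih (by omega))).add (contDiff_id.pow _))
    refine ((hasDerivAt_pow (M + 2) t).mul (Real.hasDerivAt_log ht)).congr_deriv ?_
    field_simp
    simp
    ring

/-- The hypothesis says `m < N + n/2 = (N + 1) + (n/2 - 1)`, the total exponent. Strictness is what
the half-line power and logarithmic lemmas require. -/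
theorem contDiff_pow_mul_singularity {p q : ℕ} (h : 2 ≤ p + q) {m N : ℕ}
    (hm : 2 * m < 2 * N + (p + q)) :
    ContDiff ℝ m fun t => t ^ (N + 1) * singularity p q t := by
  have hs : (m : ℝ) < (((p + q : ℕ) : ℝ) / 2 - 1) + ((N + 1 : ℕ) : ℝ) := by
    have : (2 * m : ℝ) < 2 * N + (p + q : ℕ) := by exact_mod_cast hm
    push_cast at this ⊢
    linarith
  by_cases hp : Even p <;> by_cases hq : Even q
  · have he : (fun t => t ^ (N + 1) * singularity p q t) = fun t =>
        halfPow ((((p + q : ℕ) : ℝ) / 2 - 1) + ((N + 1 : ℕ) : ℝ)) t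
          - t ^ (N + 1) * (1 / 2 * t ^ ((p + q) / 2 - 1)) := by
      funext t
      rw [← pow_mul_halfPow, ← mul_sub]
      rcases eq_or_ne t 0 with rfl | ht
      · simp
      · rw [singularity_even_even hp hq h ht]
    rw [he]
    exact (contDiff_halfPow m hs).sub (by fun_prop)
  · have he : (fun t => t ^ (N + 1) * singularity p q t) = fun t =>
        (-1) ^ (N + 1) * halfPow ((((p + q : ℕ) : ℝ) / 2 - 1) + ((N + 1 : ℕ) : ℝ)) (-t) := by
      funext t
      rw [← pow_mul_halfPow, singularity_even_odd hp hq, ← mul_assoc, ← mul_pow, neg_one_mul,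
        neg_neg]
    rw [he]
    exact contDiff_const.mul ((contDiff_halfPow m hs).comp contDiff_neg)
  · simp only [singularity_odd_even hp hq, pow_mul_halfPow]
    exact contDiff_halfPow m hs
  · have he : (fun t => t ^ (N + 1) * singularity p q t) = fun t =>
        t ^ (N + 1 + ((p + q) / 2 - 1)) * Real.log t := by
      funext t
      simp only [singularity_odd_odd hp hq, Real.log_abs]
      ring
    rw [he]
    refine contDiff_pow_mul_log m ?_
    have : (p + q) % 2 = 0 := Nat.even_iff.1 (Nat.not_even_iff_odd.1 hp |>.add_odd
      (Nat.not_even_iff_odd.1 hq))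
    omega

end FiniteSmoothness

/-! ### Taylor remainders with cutoff -/

section TaylorRemainder

variable {P : Type} [NormedAddCommGroup P] [NormedSpace ℝ P] [FiniteDimensional ℝ P]

theorem iteratedDeriv_id_mul {h : ℝ → ℝ} (hh : ContDiff ℝ ∞ h) (k : ℕ) (t : ℝ) :
    iteratedDeriv (k + 1) (fun s => s * h s) t
      = t * iteratedDeriv (k + 1) h t + (k + 1) * iteratedDeriv k h t := by
  have hd : ∀ k t, HasDerivAt (iteratedDeriv k h) (iteratedDeriv (k + 1) h t) t := fun k t => by
    rw [iteratedDeriv_succ]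
    exact ((hh.differentiable_iteratedDeriv k (by exact_mod_cast WithTop.coe_lt_top _)) t).hasDerivAt
  induction k generalizing t with
  | zero =>
    rw [iteratedDeriv_one]
    refine ((hasDerivAt_id t).mul (hd 0 t)).deriv.trans ?_
    simp [add_comm]
  | succ k ih =>
    rw [iteratedDeriv_succ, funext ih]
    have := ((hasDerivAt_id t).mul (hd (k + 1) t)).add ((hd k t).const_mul ((k : ℝ) + 1))
    refine this.deriv.trans ?_
    simp only [id]
    push_cast
    ring

omit [FiniteDimensional ℝ P] in
theorem contDiff_section_fst {φ : ℝ × P → ℝ} (hφ : ContDiff ℝ ∞ φ) (e : P) :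
    ContDiff ℝ ∞ fun s => φ (s, e) := hφ.comp (contDiff_id.prodMk contDiff_const)

/-- Taylor's formula at `t = 0`, with a smooth remainder. -/
theorem exists_taylor {φ : ℝ × P → ℝ} (hφ : ContDiff ℝ ∞ φ) (N : ℕ) : ∃ (c : ℕ → P → ℝ)
    (h : ℝ × P → ℝ), (∀ k, ContDiff ℝ ∞ (c k)) ∧ ContDiff ℝ ∞ h ∧
      (∀ k ≤ N, ∀ e, iteratedDeriv k (fun s => φ (s, e)) 0 / (k.factorial : ℝ) = c k e) ∧
      ∀ t e, φ (t, e) = ∑ k ∈ Finset.range (N + 1), t ^ k * c k e + t ^ (N + 1) * h (t, e) := by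
  induction N generalizing φ with
  | zero =>
    refine ⟨fun _ e => φ (0, e), hadamard φ, fun _ => hφ.comp (contDiff_const.prodMk contDiff_id),
      contDiff_hadamard hφ, fun k hk e => ?_, fun t e => ?_⟩
    · obtain rfl : k = 0 := by omega
      simp
    · simpa using eq_add_smul_hadamard hφ t e
  | succ N ih =>
    obtain ⟨c, h, hc, hh, hk, hs⟩ := ih (contDiff_hadamard hφ)
    refine ⟨fun k => k.rec (fun e => φ (0, e)) fun k _ => c k, h, fun k => ?_, hh,
      fun k hkN e => ?_, fun t e => ?_⟩
    · cases k with
      | zero => exact hφ.comp (contDiff_const.prodMk contDiff_id)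
      | succ k => exact hc k
    · cases k with
      | zero => simp
      | succ k =>
        have h1 : (fun s => φ (s, e)) = fun s => φ (0, e) + s * hadamard φ (s, e) :=
          funext fun s => eq_add_smul_hadamard hφ s e
        refine Eq.trans ?_ (hk k (by omega) e)
        rw [h1, iteratedDeriv_const_add (Nat.succ_pos k),
          iteratedDeriv_id_mul (contDiff_section_fst (contDiff_hadamard hφ) e), Nat.factorial_succ]
        have := Nat.factorial_ne_zero k
        push_cast
        field_simp
        ring
    · rw [eq_add_smul_hadamard hφ t e, hs t e, Finset.sum_range_succ' _ (N + 1), smul_eq_mul, mul_add,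
        Finset.mul_sum]
      simp only [pow_zero, one_mul]
      have h1 : ∑ k ∈ Finset.range (N + 1), t ^ (k + 1) * c k e
          = ∑ k ∈ Finset.range (N + 1), t * (t ^ k * c k e) :=
        Finset.sum_congr rfl fun k _ => by ring
      change _ = ∑ k ∈ Finset.range (N + 1), t ^ (k + 1) * c k e + φ (0, e) + _
      rw [h1]
      ring

/-- A smooth function vanishing near `0` is divisible by any power of the variable. -/
theorem exists_eq_pow_mul {g : ℝ → ℝ} (hg : ContDiff ℝ ∞ g) (h0 : ∀ᶠ t in 𝓝 0, g t = 0) (N : ℕ) :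
    ∃ w : ℝ → ℝ, ContDiff ℝ ∞ w ∧ ∀ t, g t = t ^ N * w t := by
  refine ⟨fun t => g t / t ^ N, contDiff_iff_contDiffAt.2 fun t => ?_, fun t => ?_⟩
  · rcases eq_or_ne t 0 with rfl | ht
    · refine (contDiffAt_const (c := (0 : ℝ))).congr_of_eventuallyEq ?_
      filter_upwards [h0] with s hs
      rw [hs, zero_div]
    · exact hg.contDiffAt.div (contDiff_id.pow N).contDiffAt (pow_ne_zero N ht)
  · rcases eq_or_ne t 0 with rfl | ht
    · simp [h0.self_of_nhds]
    · field_simp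

/-- The remainder of a test function after its Taylor polynomial of degree `N`, cut off by `χ`. -/
def taylorRemainder (χ : ℝ → ℝ) (N : ℕ) (φ : ℝ × P → ℝ) (z : ℝ × P) : ℝ :=
  φ z - χ z.1 * ∑ k ∈ Finset.range (N + 1),
    z.1 ^ k * (iteratedDeriv k (fun s => φ (s, z.2)) 0 / (k.factorial : ℝ))

/-- The cutoff costs only `(1 - χ)` times the Taylor polynomial. As `1 - χ` vanishes near `0`, it is
divisible by `t ^ (N + 1)`. -/
theorem exists_taylorRemainder_eq {χ : ℝ → ℝ} (hχ : IsTest χ) (hχ1 : ∀ᶠ t in 𝓝 0, χ t = 1) (N : ℕ)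
    {φ : ℝ × P → ℝ} (hφ : IsTest φ) :
    ∃ g : ℝ × P → ℝ, IsTest g ∧ ∀ z, taylorRemainder χ N φ z = z.1 ^ (N + 1) * g z := by
  obtain ⟨c, h, hc, hh, hk, hs⟩ := exists_taylor hφ.smooth N
  obtain ⟨w, hw, hww⟩ := exists_eq_pow_mul (g := fun t => 1 - χ t) (contDiff_const.sub hχ.smooth)
    (hχ1.mono fun t ht => by rw [ht, sub_self]) (N + 1)
  have hT : ∀ z, taylorRemainder χ N φ z
      = φ z - χ z.1 * ∑ k ∈ Finset.range (N + 1), z.1 ^ k * c k z.2 := fun z => by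
    unfold taylorRemainder
    congr 2
    exact Finset.sum_congr rfl fun k hkN => by
      rw [hk k (by simpa [Nat.lt_succ_iff] using hkN)]
  have hE : ∀ z, taylorRemainder χ N φ z = z.1 ^ (N + 1)
      * (w z.1 * (∑ k ∈ Finset.range (N + 1), z.1 ^ k * c k z.2) + h z) := by
    rintro ⟨t, e⟩
    have h1 : χ t = 1 - t ^ (N + 1) * w t := by rw [← hww t]; ring
    rw [hT, hs t e]
    simp only [h1]
    ring
  refine ⟨_, ?_, hE⟩
  have hsm : ContDiff ℝ ∞ fun z : ℝ × P =>
      w z.1 * (∑ k ∈ Finset.range (N + 1), z.1 ^ k * c k z.2) + h z :=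
    ((hw.comp contDiff_fst).mul (ContDiff.sum fun k _ => (contDiff_fst.pow k).mul
      ((hc k).comp contDiff_snd))).add hh
  obtain ⟨R, hR⟩ := hφ.bounded
  obtain ⟨R', hR'⟩ := hχ.bounded
  refine isTest_of_ne hsm (R := max R R') fun t e ht hlt => ?_
  have h2 : taylorRemainder χ N φ (t, e) = 0 := by
    have hφ0 : φ (t, e) = 0 := hR _ ((le_max_left _ _).trans_lt hlt)
    rw [Prod.norm_def, lt_max_iff] at hlt
    rcases hlt with hlt | hlt
    · simp [taylorRemainder, hφ0, hR' t ((le_max_right _ _).trans_lt hlt)]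
    · have h3 : (fun s => φ (s, e)) = fun _ => 0 := funext fun s =>
        hR _ ((le_max_left _ _).trans_lt (hlt.trans_le (le_max_right _ _)))
      simp [taylorRemainder, h3, hφ0]
  have h3 := hE (t, e)
  rw [h2] at h3
  exact (mul_eq_zero.1 h3.symm).resolve_left (pow_ne_zero _ ht)

end TaylorRemainder

end

end OrbitalMean


namespace OrbitalMean

noncomputable section


/-! ### Partial derivatives on the plane -/

section PartialDerivatives

/-- The partial derivative in the first variable. -/
def derivFst (g : ℝ × ℝ → ℝ) (t : ℝ × ℝ) : ℝ := deriv (fun s => g (s, t.2)) t.1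

/-- The partial derivative in the second variable. -/
def derivSnd (g : ℝ × ℝ → ℝ) (t : ℝ × ℝ) : ℝ := deriv (fun u => g (t.1, u)) t.2

theorem partialDeriv_zero_zero (g : ℝ × ℝ → ℝ) : partialDeriv 0 0 g = g := by
  funext t
  simp [partialDeriv]

theorem partialDeriv_succ_snd (k l : ℕ) (g : ℝ × ℝ → ℝ) :
    partialDeriv k (l + 1) g = partialDeriv k l (derivSnd g) := by
  funext t
  simp only [partialDeriv, iteratedDeriv_succ', derivSnd]

theorem partialDeriv_succ_fst (k : ℕ) (g : ℝ × ℝ → ℝ) :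
    partialDeriv (k + 1) 0 g = partialDeriv k 0 (derivFst g) := by
  funext t
  simp only [partialDeriv, iteratedDeriv_succ', derivFst, iteratedDeriv_zero]

theorem derivFst_eq {g : ℝ × ℝ → ℝ} (hg : Differentiable ℝ g) :
    derivFst g = fun t => fderiv ℝ g t (1, 0) := by
  funext t
  have h : HasDerivAt (fun s : ℝ => (s, t.2)) ((1 : ℝ), (0 : ℝ)) t.1 :=
    (hasDerivAt_id t.1).prodMk (hasDerivAt_const t.1 t.2)
  exact ((hg t).hasFDerivAt.comp_hasDerivAt t.1 h).deriv

theorem derivSnd_eq {g : ℝ × ℝ → ℝ} (hg : Differentiable ℝ g) :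
    derivSnd g = fun t => fderiv ℝ g t (0, 1) := by
  funext t
  have h : HasDerivAt (fun u : ℝ => (t.1, u)) ((0 : ℝ), (1 : ℝ)) t.2 :=
    (hasDerivAt_const t.2 t.1).prodMk (hasDerivAt_id t.2)
  exact ((hg t).hasFDerivAt.comp_hasDerivAt t.2 h).deriv

/-- Functions of class `C^m` with compact support on the plane. -/
def IsCompactSmooth (m : ℕ) (g : ℝ × ℝ → ℝ) : Prop := ContDiff ℝ m g ∧ HasCompactSupport g

theorem IsCompactSmooth.differentiable {m : ℕ} {g : ℝ × ℝ → ℝ} (hg : IsCompactSmooth (m + 1) g) :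
    Differentiable ℝ g :=
  hg.1.differentiable (by simp)

theorem IsCompactSmooth.derivFst {m : ℕ} {g : ℝ × ℝ → ℝ} (hg : IsCompactSmooth (m + 1) g) :
    IsCompactSmooth m (derivFst g) := by
  rw [derivFst_eq hg.differentiable]
  exact ⟨(hg.1.fderiv_right (by norm_cast)).clm_apply contDiff_const, hg.2.fderiv_apply ℝ _⟩

theorem IsCompactSmooth.derivSnd {m : ℕ} {g : ℝ × ℝ → ℝ} (hg : IsCompactSmooth (m + 1) g) :
    IsCompactSmooth m (derivSnd g) := by
  rw [derivSnd_eq hg.differentiable]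
  exact ⟨(hg.1.fderiv_right (by norm_cast)).clm_apply contDiff_const, hg.2.fderiv_apply ℝ _⟩

theorem IsCompactSmooth.partialDeriv {m k l : ℕ} {g : ℝ × ℝ → ℝ}
    (hg : IsCompactSmooth (m + k + l) g) : IsCompactSmooth m (partialDeriv k l g) := by
  induction l generalizing g with
  | zero =>
    induction k generalizing g with
    | zero => rwa [partialDeriv_zero_zero]
    | succ k ih =>
      rw [partialDeriv_succ_fst]
      exact ih hg.derivFst
  | succ l ih =>
    rw [partialDeriv_succ_snd]
    exact ih hg.derivSnd

theorem IsCompactSmooth.exists_abs_le {g : ℝ × ℝ → ℝ} (hg : IsCompactSmooth 0 g) :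
    ∃ C, ∀ t, |g t| ≤ C := by
  obtain ⟨C, hC⟩ := hg.1.continuous.bounded_above_of_compact_support hg.2
  exact ⟨C, hC⟩

theorem IsTest.isCompactSmooth {g : ℝ × ℝ → ℝ} (hg : IsTest g) (m : ℕ) : IsCompactSmooth m g :=
  ⟨hg.smooth.of_le (by exact_mod_cast le_top), hg.hasCompactSupport⟩

theorem IsTest.partialDeriv {g : ℝ × ℝ → ℝ} (hg : IsTest g) (k l : ℕ) :
    IsTest (partialDeriv k l g) :=
  isTest_of_hasCompactSupport (contDiff_infty.2 fun m => (hg.isCompactSmooth (m + k + l)).partialDeriv.1)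
    (hg.isCompactSmooth (0 + k + l)).partialDeriv.2

theorem partialDeriv_fst_apply (k : ℕ) (g : ℝ × ℝ → ℝ) (t : ℝ × ℝ) :
    partialDeriv k 0 g t = iteratedDeriv k (fun s => g (s, t.2)) t.1 := by
  simp only [partialDeriv, iteratedDeriv_zero]

theorem partialDeriv_snd_apply (l : ℕ) (g : ℝ × ℝ → ℝ) (t : ℝ × ℝ) :
    partialDeriv 0 l g t = iteratedDeriv l (fun u => g (t.1, u)) t.2 := by
  simp only [partialDeriv, iteratedDeriv_zero]

end PartialDerivatives

/-! ### Continuous functionals on barrelled spaces -/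

section ContinuousLinear

variable {X : Type} [AddCommGroup X] [Module ℝ X] [UniformSpace X]

/-- The functional `L` is linear and continuous. -/
def IsContinuousLinear (L : X → ℝ) : Prop := ∃ T : X →L[ℝ] ℝ, ∀ x, T x = L x

theorem IsContinuousLinear.add [IsUniformAddGroup X] {L L' : X → ℝ} (h : IsContinuousLinear L)
    (h' : IsContinuousLinear L') : IsContinuousLinear fun x => L x + L' x := by
  obtain ⟨T, hT⟩ := h
  obtain ⟨T', hT'⟩ := h'
  exact ⟨T + T', fun x => by simp [hT, hT']⟩

theorem IsContinuousLinear.const_mul [IsUniformAddGroup X] {L : X → ℝ} (h : IsContinuousLinear L)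
    (c : ℝ) : IsContinuousLinear fun x => c * L x := by
  obtain ⟨T, hT⟩ := h
  exact ⟨c • T, fun x => by simp [hT]⟩

theorem IsContinuousLinear.sub [IsUniformAddGroup X] {L L' : X → ℝ} (h : IsContinuousLinear L)
    (h' : IsContinuousLinear L') : IsContinuousLinear fun x => L x - L' x := by
  obtain ⟨T, hT⟩ := h
  obtain ⟨T', hT'⟩ := h'
  exact ⟨T - T', fun x => by simp [hT, hT']⟩

theorem IsContinuousLinear.div_const [IsUniformAddGroup X] {L : X → ℝ} (h : IsContinuousLinear L)
    (c : ℝ) : IsContinuousLinear fun x => L x / c := by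
  simpa only [div_eq_inv_mul] using h.const_mul c⁻¹

theorem IsContinuousLinear.sum [IsUniformAddGroup X] {ι : Type} {s : Finset ι} {L : ι → X → ℝ}
    (h : ∀ i, IsContinuousLinear (L i)) : IsContinuousLinear fun x => ∑ i ∈ s, L i x := by
  choose T hT using h
  exact ⟨∑ i ∈ s, T i, fun x => by simp [hT]⟩

variable [IsUniformAddGroup X] [ContinuousSMul ℝ X] [BarrelledSpace ℝ X]

/-- Banach–Steinhaus: on a barrelled space a pointwise limit of continuous functionals is
continuous. -/
theorem isContinuousLinear_of_tendsto {ι : Type} {l : Filter ι} [l.IsCountablyGenerated] [l.NeBot]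
    {g : ι → X → ℝ} {L : X → ℝ} (hg : ∀ i, IsContinuousLinear (g i))
    (h : ∀ x, Tendsto (fun i => g i x) l (𝓝 (L x))) : IsContinuousLinear L := by
  choose T hT using hg
  exact ⟨continuousLinearMapOfTendsto T (l := l) (f := L)
    (tendsto_pi_nhds.2 fun x => by simpa only [hT] using h x), fun x => rfl⟩

/-- A derivative is a pointwise limit of difference quotients. Continuity of derivatives of
remainders thus follows from continuity of their values, with no explicit estimate. -/
theorem isContinuousLinear_deriv {G : X → ℝ → ℝ} (hG : ∀ s, IsContinuousLinear fun x => G x s)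
    (hd : ∀ x, Differentiable ℝ (G x)) (s : ℝ) : IsContinuousLinear fun x => deriv (G x) s := by
  refine isContinuousLinear_of_tendsto (l := 𝓝[≠] (0 : ℝ))
    (g := fun u x => u⁻¹ * (G x (s + u) - G x s)) (fun u => ?_) fun x => ?_
  · exact ((hG (s + u)).sub (hG s)).const_mul _
  · exact (hd x s).hasDerivAt.tendsto_slope_zero

theorem isContinuousLinear_iteratedDeriv {j : ℕ} {G : X → ℝ → ℝ}
    (hG : ∀ s, IsContinuousLinear fun x => G x s) (hd : ∀ x, ContDiff ℝ j (G x)) (s : ℝ) :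
    IsContinuousLinear fun x => iteratedDeriv j (G x) s := by
  induction j generalizing G with
  | zero => simpa only [iteratedDeriv_zero] using hG s
  | succ j ih =>
    simp only [iteratedDeriv_succ']
    push_cast at hd
    exact ih (isContinuousLinear_deriv hG fun x => (hd x).differentiable (by simp))
      fun x => (contDiff_succ_iff_deriv.1 (hd x)).2.2

theorem isContinuousLinear_partialDeriv {k l : ℕ} {G : X → ℝ × ℝ → ℝ}
    (hG : ∀ t, IsContinuousLinear fun x => G x t) (hd : ∀ x, IsCompactSmooth (k + l) (G x))
    (t : ℝ × ℝ) : IsContinuousLinear fun x => partialDeriv k l (G x) t := by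
  induction l generalizing G with
  | zero =>
    simp only [partialDeriv_fst_apply]
    refine isContinuousLinear_iteratedDeriv (fun s => hG (s, t.2)) (fun x => ?_) t.1
    exact (hd x).1.comp (contDiff_id.prodMk contDiff_const)
  | succ l ih =>
    simp only [partialDeriv_succ_snd]
    refine ih (fun t => ?_) fun x => (hd x).derivSnd
    exact isContinuousLinear_deriv (G := fun x u => G x (t.1, u)) (fun s => hG (t.1, s))
      (fun x => ((hd x).differentiable (m := k + l)).comp
        ((differentiable_const _).prodMk differentiable_id)) t.2

/-- The uniform boundedness principle, for families of functionals. -/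
theorem eventually_abs_le {ι : Type} {L : ι → X → ℝ} (hL : ∀ i, IsContinuousLinear (L i))
    (hb : ∀ x, ∃ C, ∀ i, |L i x| ≤ C) {ε : ℝ} (hε : 0 < ε) :
    ∀ᶠ x in 𝓝 (0 : X), ∀ i, |L i x| ≤ ε := by
  choose T hT using hL
  have h := (norm_withSeminorms ℝ ℝ).banach_steinhaus (𝓕 := T) fun _ x => by
    obtain ⟨C, hC⟩ := hb x
    exact ⟨C, by rintro _ ⟨i, rfl⟩; simpa [hT] using hC i⟩
  filter_upwards [h.equicontinuous 0 _ (Metric.dist_mem_uniformity hε)] with x hx i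
  have h1 : dist (T i 0) (T i x) < ε := hx i
  rw [map_zero, dist_zero_left, hT] at h1
  exact h1.le

end ContinuousLinear

end

end OrbitalMean


namespace OrbitalMean

noncomputable section


/-! ### The remainders as Taylor remainders times singularities -/

section RemainderExpansion

theorem IsCompactSmooth.add {m : ℕ} {f g : ℝ × ℝ → ℝ} (hf : IsCompactSmooth m f)
    (hg : IsCompactSmooth m g) : IsCompactSmooth m fun t => f t + g t :=
  ⟨hf.1.add hg.1, hf.2.add hg.2⟩

theorem IsCompactSmooth.mul {m : ℕ} {f g : ℝ × ℝ → ℝ} (hf : ContDiff ℝ m f)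
    (hg : IsCompactSmooth m g) : IsCompactSmooth m fun t => f t * g t :=
  ⟨hf.mul hg.1, hg.2.mul_left⟩

/-- The remainder of a test function in the second variable. -/
def taylorRemainderSnd (χ : ℝ → ℝ) (N : ℕ) (φ : ℝ × ℝ → ℝ) (t : ℝ × ℝ) : ℝ :=
  taylorRemainder χ N (fun z => φ (z.2, z.1)) (t.2, t.1)

theorem exists_taylorRemainderSnd_eq {χ : ℝ → ℝ} (hχ : IsTest χ) (hχ1 : ∀ᶠ t in 𝓝 0, χ t = 1)
    (N : ℕ) {φ : ℝ × ℝ → ℝ} (hφ : IsTest φ) :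
    ∃ g : ℝ × ℝ → ℝ, IsTest g ∧ ∀ t, taylorRemainderSnd χ N φ t = t.2 ^ (N + 1) * g t := by
  obtain ⟨g, hg, h⟩ := exists_taylorRemainder_eq hχ hχ1 N (isTest_flip hφ)
  exact ⟨_, isTest_flip hg, fun t => h (t.2, t.1)⟩

theorem taylorRemainderSnd_apply (χ : ℝ → ℝ) (N : ℕ) (φ : ℝ × ℝ → ℝ) (t : ℝ × ℝ) :
    taylorRemainderSnd χ N φ t = φ t - χ t.2 * ∑ l ∈ Finset.range (N + 1),
      t.2 ^ l * (partialDeriv 0 l φ (t.1, 0) / (l.factorial : ℝ)) := by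
  simp only [taylorRemainderSnd, taylorRemainder, partialDeriv_snd_apply]

theorem taylorRemainder_apply (χ : ℝ → ℝ) (N : ℕ) (φ : ℝ × ℝ → ℝ) (t : ℝ × ℝ) :
    taylorRemainder χ N φ t = φ t - χ t.1 * ∑ k ∈ Finset.range (N + 1),
      t.1 ^ k * (partialDeriv k 0 φ (0, t.2) / (k.factorial : ℝ)) := by
  simp only [taylorRemainder, partialDeriv_fst_apply]

theorem iteratedDeriv_partialDeriv (k l : ℕ) (φ : ℝ × ℝ → ℝ) (s u : ℝ) :
    iteratedDeriv k (fun s => partialDeriv 0 l φ (s, u)) s = partialDeriv k l φ (s, u) := by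
  simp only [partialDeriv, iteratedDeriv_zero]

/-- Derivatives in the first variable pass through the Taylor expansion in the second, so the
iterated remainder of `ψ 3` reproduces the double sum in `remainder`. -/
theorem partialDeriv_taylorRemainderSnd (χ : ℝ → ℝ) (N k : ℕ) {φ : ℝ × ℝ → ℝ} (hφ : IsTest φ)
    (t : ℝ × ℝ) :
    partialDeriv k 0 (taylorRemainderSnd χ N φ) t = partialDeriv k 0 φ t
      - χ t.2 * ∑ l ∈ Finset.range (N + 1),
        t.2 ^ l * (partialDeriv k l φ (t.1, 0) / (l.factorial : ℝ)) := by
  have hs : ∀ {ψ : ℝ × ℝ → ℝ}, IsTest ψ → ∀ u s : ℝ, ContDiffAt ℝ k (fun s => ψ (s, u)) s :=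
    fun hψ u s => ((hψ.slice_fst u).smooth.of_le (by exact_mod_cast le_top)).contDiffAt
  have hd : ∀ l, ContDiffAt ℝ k (fun s => t.2 ^ l * (partialDeriv 0 l φ (s, 0)
      / (l.factorial : ℝ))) t.1 := fun l =>
    contDiffAt_const.mul ((hs (hφ.partialDeriv 0 l) 0 t.1).div_const _)
  simp only [partialDeriv_fst_apply, taylorRemainderSnd_apply]
  rw [iteratedDeriv_fun_sub (hs hφ t.2 t.1) (contDiffAt_const.mul (ContDiffAt.sum fun l _ => hd l)),
    iteratedDeriv_const_mul_field, iteratedDeriv_fun_sum fun l _ => hd l]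
  congr 2
  refine Finset.sum_congr rfl fun l _ => ?_
  rw [iteratedDeriv_const_mul_field]
  simp only [div_eq_inv_mul]
  rw [iteratedDeriv_const_mul_field, iteratedDeriv_partialDeriv]

variable {p₁ q₁ p₂ q₂ : ℕ}

/-- Inclusion–exclusion: removing the Taylor polynomials in both variables from `ψ 3` subtracts each
one and adds back the mixed sum, which is the sign pattern of `remainder`. -/
theorem remainder_eq (χ₁ χ₂ : Test ℝ) (N : ℕ) (ψ : Fin 4 → Test (ℝ × ℝ)) (t : ℝ × ℝ) :
    remainder p₁ q₁ p₂ q₂ χ₁ χ₂ N ψ t = ψ 0 t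
      + singularity p₁ q₁ t.1 * taylorRemainder χ₁ N (ψ 1) t
      + singularity p₂ q₂ t.2 * taylorRemainderSnd χ₂ N (ψ 2) t
      + singularity p₁ q₁ t.1 * singularity p₂ q₂ t.2
        * taylorRemainder χ₁ N (taylorRemainderSnd χ₂ N (ψ 3)) t := by
  simp only [remainder, assemble, coeffFst, coeffSnd, coeffBoth, taylorRemainder_apply,
    partialDeriv_taylorRemainderSnd _ _ _ (isTest_coe (ψ 3))]
  simp only [taylorRemainderSnd_apply, add_div, sub_div, mul_add, mul_sub, Finset.sum_add_distrib,
    Finset.sum_sub_distrib]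
  have e1 : ∑ k ∈ Finset.range (N + 1), t.1 ^ k * (singularity p₂ q₂ t.2
        * partialDeriv k 0 (ψ 3) (0, t.2) / (k.factorial : ℝ))
      = singularity p₂ q₂ t.2 * ∑ k ∈ Finset.range (N + 1), t.1 ^ k
        * (partialDeriv k 0 (ψ 3) (0, t.2) / (k.factorial : ℝ)) := by
    rw [Finset.mul_sum]
    exact Finset.sum_congr rfl fun k _ => by ring
  have e2 : ∑ l ∈ Finset.range (N + 1), t.2 ^ l * (singularity p₁ q₁ t.1
        * partialDeriv 0 l (ψ 3) (t.1, 0) / (l.factorial : ℝ))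
      = singularity p₁ q₁ t.1 * ∑ l ∈ Finset.range (N + 1), t.2 ^ l
        * (partialDeriv 0 l (ψ 3) (t.1, 0) / (l.factorial : ℝ)) := by
    rw [Finset.mul_sum]
    exact Finset.sum_congr rfl fun l _ => by ring
  have e3 : ∑ k ∈ Finset.range (N + 1), t.1 ^ k * (χ₂ t.2 * (∑ l ∈ Finset.range (N + 1),
        t.2 ^ l * (partialDeriv k l (ψ 3) (0, 0) / (l.factorial : ℝ))) / (k.factorial : ℝ))
      = χ₂ t.2 * ∑ k ∈ Finset.range (N + 1), ∑ l ∈ Finset.range (N + 1), t.1 ^ k * t.2 ^ l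
        * (partialDeriv k l (ψ 3) (0, 0) / ((k.factorial : ℝ) * (l.factorial : ℝ))) := by
    rw [Finset.mul_sum]
    refine Finset.sum_congr rfl fun k _ => ?_
    rw [Finset.mul_sum, Finset.mul_sum, Finset.sum_div, Finset.mul_sum]
    exact Finset.sum_congr rfl fun l _ => by
      field_simp
  rw [e1, e2, e3]
  ring

/-- In `remainder_eq` every factor `η_j` meets a Taylor remainder in the same variable, hence a
factor `t_j ^ (N + 1)`; for `ψ 3` this happens in both variables. -/
theorem isCompactSmooth_remainder (h₁ : 2 ≤ p₁ + q₁) (h₂ : 2 ≤ p₂ + q₂) {χ₁ χ₂ : Test ℝ}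
    (hχ₁ : ∀ᶠ t in 𝓝 (0 : ℝ), χ₁ t = 1) (hχ₂ : ∀ᶠ t in 𝓝 (0 : ℝ), χ₂ t = 1) {m N : ℕ}
    (hm : 2 * m < 2 * N + min (p₁ + q₁) (p₂ + q₂)) (ψ : Fin 4 → Test (ℝ × ℝ)) :
    IsCompactSmooth m (remainder p₁ q₁ p₂ q₂ χ₁ χ₂ N ψ) := by
  have hψ := fun i => isTest_coe (ψ i)
  obtain ⟨g1, hg1, e1⟩ := exists_taylorRemainder_eq (isTest_coe χ₁) hχ₁ N (hψ 1)
  obtain ⟨g2, hg2, e2⟩ := exists_taylorRemainderSnd_eq (isTest_coe χ₂) hχ₂ N (hψ 2)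
  obtain ⟨g, hg, e⟩ := exists_taylorRemainderSnd_eq (isTest_coe χ₂) hχ₂ N (hψ 3)
  obtain ⟨g3, hg3, e3⟩ := exists_taylorRemainder_eq (isTest_coe χ₁) hχ₁ N hg
  have e4 : ∀ t, taylorRemainder χ₁ N (taylorRemainderSnd χ₂ N (ψ 3)) t
      = t.2 ^ (N + 1) * (t.1 ^ (N + 1) * g3 t) := fun t => by
    have hs : ∑ k ∈ Finset.range (N + 1), t.1 ^ k * (t.2 ^ (N + 1)
          * iteratedDeriv k (fun s => g (s, t.2)) 0 / (k.factorial : ℝ))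
        = t.2 ^ (N + 1) * ∑ k ∈ Finset.range (N + 1), t.1 ^ k
          * (iteratedDeriv k (fun s => g (s, t.2)) 0 / (k.factorial : ℝ)) := by
      rw [Finset.mul_sum]
      exact Finset.sum_congr rfl fun k _ => by ring
    rw [← e3]
    simp only [taylorRemainder, e, iteratedDeriv_const_mul_field, hs]
    ring
  have h : remainder p₁ q₁ p₂ q₂ χ₁ χ₂ N ψ = fun t => ψ 0 t
      + (t.1 ^ (N + 1) * singularity p₁ q₁ t.1) * g1 t
      + (t.2 ^ (N + 1) * singularity p₂ q₂ t.2) * g2 t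
      + ((t.1 ^ (N + 1) * singularity p₁ q₁ t.1) * (t.2 ^ (N + 1) * singularity p₂ q₂ t.2)) * g3 t := by
    funext t
    rw [remainder_eq, e1, e2, e4]
    ring
  have k1 : ContDiff ℝ m fun t : ℝ × ℝ => t.1 ^ (N + 1) * singularity p₁ q₁ t.1 :=
    (contDiff_pow_mul_singularity h₁ (N := N) (by omega)).comp contDiff_fst
  have k2 : ContDiff ℝ m fun t : ℝ × ℝ => t.2 ^ (N + 1) * singularity p₂ q₂ t.2 :=
    (contDiff_pow_mul_singularity h₂ (N := N) (by omega)).comp contDiff_snd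
  rw [h]
  exact ((((hψ 0).isCompactSmooth m).add (.mul k1 (hg1.isCompactSmooth m))).add
    (.mul k2 (hg2.isCompactSmooth m))).add (.mul (k1.mul k2) (hg3.isCompactSmooth m))

theorem contDiff_add_mul_compact {m : ℕ} {a b c : ℝ → ℝ} (ha : IsTest a) (hb : ContDiff ℝ m b)
    (hc : IsTest c) : ContDiff ℝ m (fun s => a s + b s * c s) ∧
      HasCompactSupport fun s => a s + b s * c s :=
  ⟨(ha.smooth.of_le (by exact_mod_cast le_top)).add
    (hb.mul (hc.smooth.of_le (by exact_mod_cast le_top))),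
    ha.hasCompactSupport.add hc.hasCompactSupport.mul_left⟩

/-- At `t₁ = 0` only the expansion in the second variable is left: the `η₂`-part is the `k`-th
derivative of a Taylor remainder of `ψ 3`, divisible by `s ^ (N + 1)`. -/
theorem contDiff_remainderFst (h₂ : 2 ≤ p₂ + q₂) {χ₂ : Test ℝ}
    (hχ₂ : ∀ᶠ t in 𝓝 (0 : ℝ), χ₂ t = 1) {m N : ℕ} (hm : 2 * m < 2 * N + (p₂ + q₂)) (k : ℕ)
    (ψ : Fin 4 → Test (ℝ × ℝ)) : ContDiff ℝ m (remainderFst p₂ q₂ χ₂ N k ψ) ∧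
      HasCompactSupport (remainderFst p₂ q₂ χ₂ N k ψ) := by
  have hψ := fun i => isTest_coe (ψ i)
  obtain ⟨g, hg, e⟩ := exists_taylorRemainderSnd_eq (isTest_coe χ₂) hχ₂ N (hψ 3)
  have h1 : ∀ s, partialDeriv k 0 (taylorRemainderSnd χ₂ N (ψ 3)) (0, s)
      = s ^ (N + 1) * partialDeriv k 0 g (0, s) := fun s => by
    simp only [partialDeriv_fst_apply, e, iteratedDeriv_const_mul_field]
  have h : remainderFst p₂ q₂ χ₂ N k ψ = fun s => (k.factorial : ℝ)⁻¹ * partialDeriv k 0 (ψ 1) (0, s)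
      + (s ^ (N + 1) * singularity p₂ q₂ s) * ((k.factorial : ℝ)⁻¹ * partialDeriv k 0 g (0, s)) := by
    funext s
    have h2 := h1 s
    rw [partialDeriv_taylorRemainderSnd _ _ _ (hψ 3), sub_eq_iff_eq_add] at h2
    have h3 : ∑ l ∈ Finset.range (N + 1), coeffBoth ψ k l * s ^ l
        = (k.factorial : ℝ)⁻¹ * ∑ l ∈ Finset.range (N + 1),
          s ^ l * (partialDeriv k l (ψ 3) (0, 0) / (l.factorial : ℝ)) := by
      rw [Finset.mul_sum]
      refine Finset.sum_congr rfl fun l _ => ?_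
      rw [coeffBoth]
      field_simp
    rw [remainderFst, coeffFst, h2, h3]
    ring
  rw [h]
  exact contDiff_add_mul_compact (.mul contDiff_const (((hψ 1).partialDeriv k 0).slice_snd 0))
    (contDiff_pow_mul_singularity h₂ hm) (.mul contDiff_const ((hg.partialDeriv k 0).slice_snd 0))

theorem contDiff_remainderSnd (h₁ : 2 ≤ p₁ + q₁) {χ₁ : Test ℝ}
    (hχ₁ : ∀ᶠ t in 𝓝 (0 : ℝ), χ₁ t = 1) {m N : ℕ} (hm : 2 * m < 2 * N + (p₁ + q₁)) (l : ℕ)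
    (ψ : Fin 4 → Test (ℝ × ℝ)) : ContDiff ℝ m (remainderSnd p₁ q₁ χ₁ N l ψ) ∧
      HasCompactSupport (remainderSnd p₁ q₁ χ₁ N l ψ) := by
  have hψ := fun i => isTest_coe (ψ i)
  obtain ⟨g, hg, e⟩ := exists_taylorRemainder_eq (isTest_coe χ₁) hχ₁ N ((hψ 3).partialDeriv 0 l)
  have h : remainderSnd p₁ q₁ χ₁ N l ψ = fun s => (l.factorial : ℝ)⁻¹ * partialDeriv 0 l (ψ 2) (s, 0)
      + (s ^ (N + 1) * singularity p₁ q₁ s) * ((l.factorial : ℝ)⁻¹ * g (s, 0)) := by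
    funext s
    have h2 := e (s, 0)
    simp only [taylorRemainder, iteratedDeriv_partialDeriv] at h2
    rw [sub_eq_iff_eq_add] at h2
    have h3 : ∑ k ∈ Finset.range (N + 1), coeffBoth ψ k l * s ^ k
        = (l.factorial : ℝ)⁻¹ * ∑ k ∈ Finset.range (N + 1),
          s ^ k * (partialDeriv k l (ψ 3) (0, 0) / (k.factorial : ℝ)) := by
      rw [Finset.mul_sum]
      refine Finset.sum_congr rfl fun k _ => ?_
      rw [coeffBoth]
      field_simp
    rw [remainderSnd, coeffSnd, h2, h3]
    ring
  rw [h]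
  exact contDiff_add_mul_compact (.mul contDiff_const (((hψ 2).partialDeriv 0 l).slice_fst 0))
    (contDiff_pow_mul_singularity h₁ hm) (.mul contDiff_const (hg.slice_fst 0))

end RemainderExpansion

end

end OrbitalMean


namespace OrbitalMean

noncomputable section


/-! ### The seminorms as suprema of bounded families of functionals -/

section BoundedFamilies

/-- The inclusion of the quadruples of functions supported in `K`. -/
abbrev inclQuad (K : Compacts (ℝ × ℝ)) (x : Fin 4 → ContDiffMapSupportedIn (ℝ × ℝ) ℝ ⊤ K) :
    Fin 4 → Test (ℝ × ℝ) := fun i => inclTest K (x i)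

/-- A pointwise bounded family of functionals on the quadruples of test functions whose restrictions
to the quadruples with a fixed support are linear and continuous. -/
structure IsBoundedFamily {ι : Type} (L : ι → (Fin 4 → Test (ℝ × ℝ)) → ℝ) : Prop where
  continuousLinear : ∀ K i, IsContinuousLinear fun x => L i (inclQuad K x)
  bounded : ∀ ψ, ∃ C, ∀ i, |L i ψ| ≤ C

theorem exists_inclTest_eq {E : Type} [NormedAddCommGroup E] [NormedSpace ℝ E] (f : Test E) :
    ∀ K : Compacts E, tsupport f ⊆ K → ∃ x, inclTest K x = f := fun _ hK =>
  ⟨⟨f, f.contDiff, fun _ hx => image_eq_zero_of_notMem_tsupport fun h => hx (hK h)⟩, rfl⟩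

theorem exists_inclQuad_eq (ψ ψ' : Fin 4 → Test (ℝ × ℝ)) :
    ∃ K x x', inclQuad K x = ψ ∧ inclQuad K x' = ψ' := by
  let K : Compacts (ℝ × ℝ) := ⟨⋃ i, (tsupport (ψ i) ∪ tsupport (ψ' i)),
    isCompact_iUnion fun i => (ψ i).hasCompactSupport.union (ψ' i).hasCompactSupport⟩
  have h := fun i => exists_inclTest_eq (ψ i) K
    (subset_union_left.trans (subset_iUnion (fun i => tsupport (ψ i) ∪ tsupport (ψ' i)) i))
  have h' := fun i => exists_inclTest_eq (ψ' i) K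
    (subset_union_right.trans (subset_iUnion (fun i => tsupport (ψ i) ∪ tsupport (ψ' i)) i))
  choose x hx using h
  choose x' hx' using h'
  exact ⟨K, x, x', funext hx, funext hx'⟩

theorem IsBoundedFamily.map_add {ι : Type} {L : ι → (Fin 4 → Test (ℝ × ℝ)) → ℝ}
    (hL : IsBoundedFamily L) (i : ι) (ψ ψ' : Fin 4 → Test (ℝ × ℝ)) :
    L i (ψ + ψ') = L i ψ + L i ψ' := by
  obtain ⟨K, x, x', rfl, rfl⟩ := exists_inclQuad_eq ψ ψ'
  obtain ⟨T, hT⟩ := hL.continuousLinear K i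
  have h1 := hT (x + x')
  rw [_root_.map_add, hT, hT] at h1
  exact h1.symm

/-- Uniform boundedness turns a pointwise bound into smallness of the supremum near zero. -/
theorem IsBoundedFamily.eventually_enorm_le {ι : Type} {L : ι → (Fin 4 → Test (ℝ × ℝ)) → ℝ}
    (hL : IsBoundedFamily L) (K : Compacts (ℝ × ℝ)) {ε : NNReal} (hε : 0 < ε) :
    ∀ᶠ x in 𝓝 (0 : Fin 4 → ContDiffMapSupportedIn (ℝ × ℝ) ℝ ⊤ K),
      ⨆ i, ‖L i (inclQuad K x)‖ₑ ≤ ε := by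
  filter_upwards [eventually_abs_le (hL.continuousLinear K) (fun x => hL.bounded (inclQuad K x))
    (NNReal.coe_pos.2 hε)] with x hx
  refine iSup_le fun i => ?_
  rw [enorm_le_coe, ← NNReal.coe_le_coe, coe_nnnorm, Real.norm_eq_abs]
  exact hx i

variable {K : Compacts (ℝ × ℝ)}

theorem isContinuousLinear_eval (i : Fin 4) (t : ℝ × ℝ) :
    IsContinuousLinear fun x : Fin 4 → ContDiffMapSupportedIn (ℝ × ℝ) ℝ ⊤ K => inclQuad K x i t :=
  ⟨⟨⟨⟨fun x => x i t, fun _ _ => rfl⟩, fun _ _ => rfl⟩,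
    (continuous_eval_const (F := ContDiffMapSupportedIn (ℝ × ℝ) ℝ ⊤ K) t).comp
      (continuous_apply i)⟩, fun _ => rfl⟩

theorem isContinuousLinear_partialDeriv_inclQuad (i : Fin 4) (k l : ℕ) (t : ℝ × ℝ) :
    IsContinuousLinear fun x : Fin 4 → ContDiffMapSupportedIn (ℝ × ℝ) ℝ ⊤ K =>
      partialDeriv k l (inclQuad K x i) t :=
  isContinuousLinear_partialDeriv (G := fun x => inclQuad K x i) (isContinuousLinear_eval i)
    (fun _ => (isTest_coe _).isCompactSmooth _) t

theorem isContinuousLinear_coeffFst (p₂ q₂ k : ℕ) (s : ℝ) :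
    IsContinuousLinear fun x => coeffFst p₂ q₂ (inclQuad K x) k s :=
  ((isContinuousLinear_partialDeriv_inclQuad 1 k 0 (0, s)).add
    ((isContinuousLinear_partialDeriv_inclQuad 3 k 0 (0, s)).const_mul _)).div_const _

theorem isContinuousLinear_coeffSnd (p₁ q₁ l : ℕ) (s : ℝ) :
    IsContinuousLinear fun x => coeffSnd p₁ q₁ (inclQuad K x) l s :=
  ((isContinuousLinear_partialDeriv_inclQuad 2 0 l (s, 0)).add
    ((isContinuousLinear_partialDeriv_inclQuad 3 0 l (s, 0)).const_mul _)).div_const _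

theorem isContinuousLinear_coeffBoth (k l : ℕ) :
    IsContinuousLinear fun x => coeffBoth (inclQuad K x) k l :=
  (isContinuousLinear_partialDeriv_inclQuad 3 k l (0, 0)).div_const _

theorem isContinuousLinear_assemble (p₁ q₁ p₂ q₂ : ℕ) (t : ℝ × ℝ) :
    IsContinuousLinear fun x => assemble p₁ q₁ p₂ q₂ (inclQuad K x) t :=
  (((isContinuousLinear_eval 0 t).add ((isContinuousLinear_eval 1 t).const_mul _)).add
    ((isContinuousLinear_eval 2 t).const_mul _)).add ((isContinuousLinear_eval 3 t).const_mul _)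

theorem isContinuousLinear_remainder (p₁ q₁ p₂ q₂ : ℕ) (χ₁ χ₂ : Test ℝ) (N : ℕ) (t : ℝ × ℝ) :
    IsContinuousLinear fun x => remainder p₁ q₁ p₂ q₂ χ₁ χ₂ N (inclQuad K x) t := by
  refine (((isContinuousLinear_assemble p₁ q₁ p₂ q₂ t).sub
    (IsContinuousLinear.const_mul (.sum fun k => ?_) _)).sub
    (IsContinuousLinear.const_mul (.sum fun l => ?_) _)).add
    (IsContinuousLinear.const_mul (.sum fun k => .sum fun l => ?_) _)
  · exact (isContinuousLinear_coeffFst p₂ q₂ k t.2).const_mul _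
  · exact (isContinuousLinear_coeffSnd p₁ q₁ l t.1).const_mul _
  · exact (isContinuousLinear_coeffBoth k l).const_mul _

theorem isContinuousLinear_remainderFst (p₂ q₂ : ℕ) (χ₂ : Test ℝ) (N k : ℕ) (s : ℝ) :
    IsContinuousLinear fun x => remainderFst p₂ q₂ χ₂ N k (inclQuad K x) s := by
  refine (isContinuousLinear_coeffFst p₂ q₂ k s).sub
    (IsContinuousLinear.const_mul (.sum fun l => ?_) _)
  simpa only [mul_comm] using (isContinuousLinear_coeffBoth k l).const_mul (s ^ l)

theorem isContinuousLinear_remainderSnd (p₁ q₁ : ℕ) (χ₁ : Test ℝ) (N l : ℕ) (s : ℝ) :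
    IsContinuousLinear fun x => remainderSnd p₁ q₁ χ₁ N l (inclQuad K x) s := by
  refine (isContinuousLinear_coeffSnd p₁ q₁ l s).sub
    (IsContinuousLinear.const_mul (.sum fun k => ?_) _)
  simpa only [mul_comm] using (isContinuousLinear_coeffBoth k l).const_mul (s ^ k)

theorem exists_abs_iteratedDeriv_le {j : ℕ} {g : ℝ → ℝ} (hg : ContDiff ℝ j g)
    (hs : HasCompactSupport g) : ∃ C, ∀ s, |iteratedDeriv j g s| ≤ C := by
  induction j generalizing g with
  | zero =>
    obtain ⟨C, hC⟩ := hg.continuous.bounded_above_of_compact_support hs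
    exact ⟨C, by simpa only [iteratedDeriv_zero, Real.norm_eq_abs] using hC⟩
  | succ j ih =>
    simp only [iteratedDeriv_succ']
    push_cast at hg
    exact ih (contDiff_succ_iff_deriv.1 hg).2.2 hs.deriv

variable {p₁ q₁ p₂ q₂ : ℕ} {χ₁ χ₂ : Test ℝ}

/-- Each seminorm is the least supremum of a bounded family of functionals. -/
theorem exists_isBoundedFamily (h₁ : 2 ≤ p₁ + q₁) (h₂ : 2 ≤ p₂ + q₂)
    (hχ₁ : ∀ᶠ t in 𝓝 (0 : ℝ), χ₁ t = 1) (hχ₂ : ∀ᶠ t in 𝓝 (0 : ℝ), χ₂ t = 1)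
    {σ : singularSpace p₁ q₁ p₂ q₂ → ℝ≥0∞} (hσ : σ ∈ seminorms p₁ q₁ p₂ q₂ χ₁ χ₂) :
    ∃ (ι : Type) (L : ι → (Fin 4 → Test (ℝ × ℝ)) → ℝ), IsBoundedFamily L ∧
      ∀ φ : singularSpace p₁ q₁ p₂ q₂, σ φ = ⨅ ψ : Rep p₁ q₁ p₂ q₂ φ, ⨆ i, ‖L i ψ.1‖ₑ := by
  obtain ⟨N, k, l, hN, rfl⟩ | ⟨N, j, k, hN, rfl⟩ | ⟨N, j, l, hN, rfl⟩ | ⟨k, l, rfl⟩ := hσ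
  · have hs := fun ψ => isCompactSmooth_remainder h₁ h₂ hχ₁ hχ₂ hN ψ
    refine ⟨Reg, fun t ψ => partialDeriv k l (remainder p₁ q₁ p₂ q₂ χ₁ χ₂ N ψ) t,
      ⟨fun K t => ?_, fun ψ => ?_⟩, fun φ => rfl⟩
    · exact isContinuousLinear_partialDeriv
        (G := fun x => remainder p₁ q₁ p₂ q₂ χ₁ χ₂ N (inclQuad K x))
        (isContinuousLinear_remainder p₁ q₁ p₂ q₂ χ₁ χ₂ N) (fun x => hs _) t
    · obtain ⟨C, hC⟩ := IsCompactSmooth.exists_abs_le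
        (IsCompactSmooth.partialDeriv (m := 0) (k := k) (l := l) (by simpa using hs ψ))
      exact ⟨C, fun t => hC t⟩
  · have hs := fun ψ => contDiff_remainderFst h₂ hχ₂ hN k ψ
    refine ⟨{s : ℝ // s ≠ 0}, fun s ψ => iteratedDeriv j (remainderFst p₂ q₂ χ₂ N k ψ) s,
      ⟨fun K s => ?_, fun ψ => ?_⟩, fun φ => rfl⟩
    · exact isContinuousLinear_iteratedDeriv (G := fun x => remainderFst p₂ q₂ χ₂ N k (inclQuad K x))
        (isContinuousLinear_remainderFst p₂ q₂ χ₂ N k) (fun x => (hs _).1) s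
    · obtain ⟨C, hC⟩ := exists_abs_iteratedDeriv_le (hs ψ).1 (hs ψ).2
      exact ⟨C, fun t => hC t⟩
  · have hs := fun ψ => contDiff_remainderSnd h₁ hχ₁ hN l ψ
    refine ⟨{s : ℝ // s ≠ 0}, fun s ψ => iteratedDeriv j (remainderSnd p₁ q₁ χ₁ N l ψ) s,
      ⟨fun K s => ?_, fun ψ => ?_⟩, fun φ => rfl⟩
    · exact isContinuousLinear_iteratedDeriv (G := fun x => remainderSnd p₁ q₁ χ₁ N l (inclQuad K x))
        (isContinuousLinear_remainderSnd p₁ q₁ χ₁ N l) (fun x => (hs _).1) s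
    · obtain ⟨C, hC⟩ := exists_abs_iteratedDeriv_le (hs ψ).1 (hs ψ).2
      exact ⟨C, fun t => hC t⟩
  · refine ⟨Unit, fun _ ψ => coeffBoth ψ k l,
      ⟨fun K _ => isContinuousLinear_coeffBoth k l, fun ψ => ⟨_, fun _ => le_rfl⟩⟩, fun φ => ?_⟩
    simp only [coeffBothNorm, ciSup_const]

/-- Sums of representations represent the sum, so subadditivity passes to the infimum. Independence
of the representation is not needed. -/
theorem seminorms_add_le (h₁ : 2 ≤ p₁ + q₁) (h₂ : 2 ≤ p₂ + q₂)
    (hχ₁ : ∀ᶠ t in 𝓝 (0 : ℝ), χ₁ t = 1) (hχ₂ : ∀ᶠ t in 𝓝 (0 : ℝ), χ₂ t = 1)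
    {σ : singularSpace p₁ q₁ p₂ q₂ → ℝ≥0∞} (hσ : σ ∈ seminorms p₁ q₁ p₂ q₂ χ₁ χ₂)
    (φ φ' : singularSpace p₁ q₁ p₂ q₂) : σ (φ + φ') ≤ σ φ + σ φ' := by
  obtain ⟨ι, L, hL, hσL⟩ := exists_isBoundedFamily h₁ h₂ hχ₁ hχ₂ hσ
  simp only [hσL, ENNReal.iInf_add, ENNReal.add_iInf]
  refine le_iInf fun ψ' => le_iInf fun ψ => iInf_le_of_le ⟨ψ.1 + ψ'.1, fun t => ?_⟩ ?_
  · simp only [Submodule.coe_add, Pi.add_apply, ψ.2 t, ψ'.2 t, assemble, FunLike.coe_add]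
    ring
  · refine iSup_le fun i => ?_
    rw [hL.map_add]
    exact (enorm_add_le _ _).trans (add_le_add (le_iSup (fun i => ‖L i ψ.1‖ₑ) i)
      (le_iSup (fun i => ‖L i ψ'.1‖ₑ) i))

end BoundedFamilies

end

end OrbitalMean


namespace OrbitalMean

noncomputable section


/-! ### Linearity and continuity of the mean -/

section ContinuityOfMean

variable {p₁ q₁ p₂ q₂ : ℕ}

theorem Represents.mean_apply (hp₁ : 1 ≤ p₁) (hq₁ : 1 ≤ q₁) (hp₂ : 1 ≤ p₂) (hq₂ : 1 ≤ q₂)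
    {f : Test (Space p₁ q₁ × Space p₂ q₂)} {ψ : Fin 4 → Test (ℝ × ℝ)} (h : Represents f ψ)
    (t : Reg) : mean f t = assemble p₁ q₁ p₂ q₂ ψ t := congrFun (h.mean_eq hp₁ hq₁ hp₂ hq₂) t

/-- Representation is a linear relation, being the vanishing of the linear maps `representsDefect`,
and any representing quadruple computes the mean. -/
theorem mean_add (hp₁ : 1 ≤ p₁) (hq₁ : 1 ≤ q₁) (hp₂ : 1 ≤ p₂) (hq₂ : 1 ≤ q₂)
    (f f' : Test (Space p₁ q₁ × Space p₂ q₂)) : mean (f + f') = mean f + mean f' := by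
  let K : Compacts (Space p₁ q₁ × Space p₂ q₂) :=
    ⟨tsupport f ∪ tsupport f', f.hasCompactSupport.union f'.hasCompactSupport⟩
  obtain ⟨x, hx⟩ := exists_inclTest_eq f K subset_union_left
  obtain ⟨x', hx'⟩ := exists_inclTest_eq f' K subset_union_right
  clear_value K
  subst hx hx'
  obtain ⟨K', hK'⟩ := exists_represents_supported hp₁ hq₁ hp₂ hq₂ K
  obtain ⟨ψ, hψ⟩ := hK' x
  obtain ⟨ψ', hψ'⟩ := hK' x'
  have h := (representsDefect_eq_zero_iff (by omega) (by omega) (x + x', ψ + ψ')).1 fun F => by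
    have h1 := (representsDefect_eq_zero_iff (by omega) (by omega) (x, ψ)).2 hψ F
    have h2 := (representsDefect_eq_zero_iff (by omega) (by omega) (x', ψ')).2 hψ' F
    rw [← Prod.mk_add_mk, _root_.map_add, h1, h2, add_zero]
  funext t
  rw [Pi.add_apply, hψ.mean_apply hp₁ hq₁ hp₂ hq₂, hψ'.mean_apply hp₁ hq₁ hp₂ hq₂]
  refine (h.mean_apply hp₁ hq₁ hp₂ hq₂ t).trans ?_
  obtain ⟨T, hT⟩ := isContinuousLinear_assemble (K := K') p₁ q₁ p₂ q₂ t
  exact (hT _).symm.trans ((_root_.map_add T ψ ψ').trans (congrArg₂ _ (hT _) (hT _)))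

theorem mean_smul (hp₁ : 1 ≤ p₁) (hq₁ : 1 ≤ q₁) (hp₂ : 1 ≤ p₂) (hq₂ : 1 ≤ q₂) (c : ℝ)
    (f : Test (Space p₁ q₁ × Space p₂ q₂)) : mean (c • f) = c • mean f := by
  let K : Compacts (Space p₁ q₁ × Space p₂ q₂) := ⟨tsupport f, f.hasCompactSupport⟩
  obtain ⟨x, hx⟩ := exists_inclTest_eq f K subset_rfl
  clear_value K
  subst hx
  obtain ⟨K', hK'⟩ := exists_represents_supported hp₁ hq₁ hp₂ hq₂ K
  obtain ⟨ψ, hψ⟩ := hK' x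
  have h := (representsDefect_eq_zero_iff (by omega) (by omega) (c • x, c • ψ)).1 fun F => by
    have h1 := (representsDefect_eq_zero_iff (by omega) (by omega) (x, ψ)).2 hψ F
    rw [← Prod.smul_mk, _root_.map_smul, h1, smul_zero]
  funext t
  rw [Pi.smul_apply, hψ.mean_apply hp₁ hq₁ hp₂ hq₂]
  refine (h.mean_apply hp₁ hq₁ hp₂ hq₂ t).trans ?_
  obtain ⟨T, hT⟩ := isContinuousLinear_assemble (K := K') p₁ q₁ p₂ q₂ t
  exact (hT _).symm.trans ((_root_.map_smul T c ψ).trans (congrArg _ (hT _)))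

/-- The mean as a linear map. -/
def meanMap (hp₁ : 1 ≤ p₁) (hq₁ : 1 ≤ q₁) (hp₂ : 1 ≤ p₂) (hq₂ : 1 ≤ q₂) :
    Test (Space p₁ q₁ × Space p₂ q₂) →ₗ[ℝ] singularSpace p₁ q₁ p₂ q₂ where
  toFun f := ⟨mean f, mean_mem hp₁ hq₁ hp₂ hq₂ f⟩
  map_add' f f' := Subtype.ext (mean_add hp₁ hq₁ hp₂ hq₂ f f')
  map_smul' c f := Subtype.ext (mean_smul hp₁ hq₁ hp₂ hq₂ c f)

variable {χ₁ χ₂ : Test ℝ}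

theorem exists_meanMap_mem_supportedIn (hp₁ : 1 ≤ p₁) (hq₁ : 1 ≤ q₁) (hp₂ : 1 ≤ p₂)
    (hq₂ : 1 ≤ q₂) (K : Compacts (Space p₁ q₁ × Space p₂ q₂)) : ∃ K' : Compacts (ℝ × ℝ), ∀ f,
      meanMap hp₁ hq₁ hp₂ hq₂ (inclTest K f) ∈ supportedIn p₁ q₁ p₂ q₂ K' := by
  obtain ⟨K', hK'⟩ := exists_represents_supported hp₁ hq₁ hp₂ hq₂ K
  refine ⟨K', fun f t ht => ?_⟩
  obtain ⟨ψ, hψ⟩ := hK' f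
  refine (hψ.mean_apply hp₁ hq₁ hp₂ hq₂ t).trans ?_
  have h0 : ∀ i, inclTest K' (ψ i) t = 0 := fun i => (ψ i).zero_on_compl ht
  simp [assemble, h0]

/-- The open mapping theorem provides for small `f` a quadruple on which the bounded family is
small, and that quadruple bounds the infimum from above. -/
theorem eventually_seminorm_le (hp₁ : 1 ≤ p₁) (hq₁ : 1 ≤ q₁) (hp₂ : 1 ≤ p₂) (hq₂ : 1 ≤ q₂)
    (hχ₁ : ∀ᶠ t in 𝓝 (0 : ℝ), χ₁ t = 1) (hχ₂ : ∀ᶠ t in 𝓝 (0 : ℝ), χ₂ t = 1)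
    {σ : singularSpace p₁ q₁ p₂ q₂ → ℝ≥0∞} (hσ : σ ∈ seminorms p₁ q₁ p₂ q₂ χ₁ χ₂)
    (K : Compacts (Space p₁ q₁ × Space p₂ q₂)) {ε : NNReal} (hε : 0 < ε) :
    ∀ᶠ f in 𝓝 (0 : ContDiffMapSupportedIn (Space p₁ q₁ × Space p₂ q₂) ℝ ⊤ K),
      σ (meanMap hp₁ hq₁ hp₂ hq₂ (inclTest K f)) ≤ ε := by
  obtain ⟨ι, L, hL, hσL⟩ := exists_isBoundedFamily (by omega) (by omega) hχ₁ hχ₂ hσ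
  obtain ⟨K', -, hK'⟩ := exists_small_represents hp₁ hq₁ hp₂ hq₂ K
  filter_upwards [hK' _ (hL.eventually_enorm_le K' hε)] with f hf
  obtain ⟨ψ, hψ, hr⟩ := hf
  rw [hσL]
  exact iInf_le_of_le ⟨inclQuad K' ψ, hr.mean_apply hp₁ hq₁ hp₂ hq₂⟩ hψ

theorem continuous_meanMap_supported (hp₁ : 1 ≤ p₁) (hq₁ : 1 ≤ q₁) (hp₂ : 1 ≤ p₂) (hq₂ : 1 ≤ q₂)
    (hχ₁ : ∀ᶠ t in 𝓝 (0 : ℝ), χ₁ t = 1) (hχ₂ : ∀ᶠ t in 𝓝 (0 : ℝ), χ₂ t = 1)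
    (K : Compacts (Space p₁ q₁ × Space p₂ q₂)) (K' : Compacts (ℝ × ℝ))
    (hK' : ∀ f, meanMap hp₁ hq₁ hp₂ hq₂ (inclTest K f) ∈ supportedIn p₁ q₁ p₂ q₂ K') :
    Continuous[ContDiffMapSupportedIn.topologicalSpace, supportedInTopology p₁ q₁ p₂ q₂ χ₁ χ₂ K']
      fun f => (⟨meanMap hp₁ hq₁ hp₂ hq₂ (inclTest K f), hK' f⟩ : supportedIn p₁ q₁ p₂ q₂ K') := by
  refine continuous_generateFrom_iff.2 ?_
  rintro _ ⟨σ, hσ, φ₀, ε, -, rfl⟩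
  refine isOpen_iff_mem_nhds.2 fun f₀ hf₀ => ?_
  have hlt : σ (meanMap hp₁ hq₁ hp₂ hq₂ (inclTest K f₀) - φ₀) < ε := hf₀
  -- The balls are centred at arbitrary points. The slack `δ` together with subadditivity reduces
  -- openness at `f₀` to smallness near `0`.
  obtain ⟨δ, hδ, hlt⟩ := ENNReal.lt_iff_exists_add_pos_lt.1 hlt
  have h := eventually_seminorm_le hp₁ hq₁ hp₂ hq₂ hχ₁ hχ₂ hσ K hδ
  have hsub : Tendsto (fun f => f - f₀) (𝓝 f₀) (𝓝 0) := by
    have hc : Continuous fun f => f - f₀ := continuous_id.sub continuous_const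
    exact sub_self f₀ ▸ hc.tendsto f₀
  filter_upwards [hsub.eventually h] with f hf
  change σ (meanMap hp₁ hq₁ hp₂ hq₂ (inclTest K f) - φ₀) < ε
  have he : meanMap hp₁ hq₁ hp₂ hq₂ (inclTest K f) - φ₀
      = (meanMap hp₁ hq₁ hp₂ hq₂ (inclTest K f₀) - φ₀)
        + meanMap hp₁ hq₁ hp₂ hq₂ (inclTest K (f - f₀)) := by
    rw [_root_.map_sub, _root_.map_sub]
    abel
  rw [he]
  exact (seminorms_add_le (by omega) (by omega) hχ₁ hχ₂ hσ _ _).trans_lt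
    ((add_le_add le_rfl hf).trans_lt hlt)

theorem continuous_of_forall_supported {E V : Type} [NormedAddCommGroup E] [NormedSpace ℝ E]
    [AddCommGroup V] [Module ℝ V] [TopologicalSpace V] [IsTopologicalAddGroup V]
    [ContinuousSMul ℝ V] [LocallyConvexSpace ℝ V] (M : Test E →ₗ[ℝ] V)
    (h : ∀ K : Compacts E, Continuous fun f => M (inclTest K f)) : Continuous M :=
  (TestFunction.continuous_iff_continuous_comp M).2 fun K _ => h K

/-- Continuity into the infimum means continuity into each admissible locally convex `τ`. For these
the universal property of the LF topology reduces to fixed supports, where the map factors through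
some `supportedIn K'`. -/
theorem continuous_meanMap (hp₁ : 1 ≤ p₁) (hq₁ : 1 ≤ q₁) (hp₂ : 1 ≤ p₂) (hq₂ : 1 ≤ q₂)
    (hχ₁ : ∀ᶠ t in 𝓝 (0 : ℝ), χ₁ t = 1) (hχ₂ : ∀ᶠ t in 𝓝 (0 : ℝ), χ₂ t = 1) :
    Continuous[TestFunction.topologicalSpace _ _ _, singularSpaceTopology p₁ q₁ p₂ q₂ χ₁ χ₂]
      (meanMap hp₁ hq₁ hp₂ hq₂) := by
  refine continuous_sInf_rng.2 ?_
  rintro τ ⟨hτ, hg, hs, hc⟩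
  refine @continuous_of_forall_supported _ _ _ _ _ _ τ hg hs hc _ fun K => ?_
  obtain ⟨K', hK'⟩ := exists_meanMap_mem_supportedIn hp₁ hq₁ hp₂ hq₂ K
  have h := continuous_meanMap_supported hp₁ hq₁ hp₂ hq₂ hχ₁ hχ₂ K K' hK'
  exact @Continuous.comp _ _ _ _ (supportedInTopology p₁ q₁ p₂ q₂ χ₁ χ₂ K') τ _ _ (hτ K') h

end ContinuityOfMean

end

end OrbitalMean

theorem proposition2p2p1 (p₁ q₁ p₂ q₂ : ℕ) (hp₁ : 1 ≤ p₁) (hq₁ : 1 ≤ q₁) (hp₂ : 1 ≤ p₂)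
    (hq₂ : 1 ≤ q₂) (χ₁ χ₂ : OrbitalMean.Test ℝ)
    (hχ₁ : ∀ᶠ t in 𝓝 (0 : ℝ), χ₁ t = 1) (hχ₂ : ∀ᶠ t in 𝓝 (0 : ℝ), χ₂ t = 1) :
    (∀ (f : OrbitalMean.Test (OrbitalMean.Space p₁ q₁ × OrbitalMean.Space p₂ q₂))
        (g : OrbitalMean.Reg → ℝ), OrbitalMean.IsMean f g ↔ g = OrbitalMean.mean f) ∧
    ∃ hmem : ∀ f : OrbitalMean.Test (OrbitalMean.Space p₁ q₁ × OrbitalMean.Space p₂ q₂),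
        OrbitalMean.mean f ∈ OrbitalMean.singularSpace p₁ q₁ p₂ q₂,
      Continuous[TestFunction.topologicalSpace _ _ _,
          OrbitalMean.singularSpaceTopology p₁ q₁ p₂ q₂ χ₁ χ₂]
        (fun f => (⟨OrbitalMean.mean f, hmem f⟩ : OrbitalMean.singularSpace p₁ q₁ p₂ q₂)) ∧
      Function.Surjective
        (fun f : OrbitalMean.Test (OrbitalMean.Space p₁ q₁ × OrbitalMean.Space p₂ q₂) =>
          (⟨OrbitalMean.mean f, hmem f⟩ : OrbitalMean.singularSpace p₁ q₁ p₂ q₂)) := by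
  exact ⟨OrbitalMean.isMean_iff hp₁ hq₁ hp₂ hq₂, OrbitalMean.mean_mem hp₁ hq₁ hp₂ hq₂,
    OrbitalMean.continuous_meanMap hp₁ hq₁ hp₂ hq₂ hχ₁ hχ₂, fun φ => by
      obtain ⟨f, hf⟩ := OrbitalMean.exists_mean_eq hp₁ hq₁ hp₂ hq₂ φ
      exact ⟨f, Subtype.ext hf⟩⟩
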